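/- **Setting.** Let $(W,\mathcal S)$ be a finite Coxeter system with Coxeter matrix $(m_{st})$ and let $m\ge 0$ be an integer. Let $B^+$ be the positive Artin monoid of $(W,\mathcal S)$, i.e. the monoid of words in $\mathcal S$ modulo the braid relations $sts\cdots=tst\cdots$ ($m_{st}$ letters on each side), ordered by the (right) weak order: $u\le w$ iff $w=uv$ for some $v\in B^+$ with $\ell(u)+\ell(v)=\ell(w)$. Let $w_\circ\in B^+$ be the element given by a reduced word of the longest element of $W$, and let $W^{(m)}=[1,w_\circ^m]\subseteq B^+$, with the induced order. Let $\mathbf c=s_1s_2\cdots s_n$ be a word containing every simple reflection exactly once, i.e. a reduced word for a Coxeter element $c$. The $c$-sorting word of $w\in B^+$ is the lexicographically first (as a sequence of positions) subword of $\mathbf c^\infty=\mathbf c\,\mathbf c\,\mathbf c\cdots$ that is a word for $w$. An element $w\in W^{(m)}$ is called $c$-sortable, $w\in\mathrm{Sort}^{(m)}(W,c)$, if the sets $I_0,I_1,I_2,\ldots\subseteq\{1,\dots,n\}$ of positions used by its $c$-sorting word in the successive copies of $\mathbf c$ satisfy $I_0\supseteq I_1\supseteq I_2\supseteq\cdots$.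 Let $(a_{st})_{s,t\in\mathcal S}$ be a real matrix with $a_{ss}=2$ and, for $s\ne t$, $a_{st}\le 0$, $a_{st}a_{ts}=4\cos^2(\pi/m_{st})$ and $a_{st}=0\Leftrightarrow a_{ts}=0$. Let $V$ be the real vector space with basis the simple roots $(\alpha_s)_{s\in\mathcal S}$, let $s\in\mathcal S$ act linearly on $V$ by $s(\alpha_t)=\alpha_t-a_{st}\alpha_s$, and let $\Phi=\{s_1\cdots s_k(\alpha_s)\}$ be the set of roots. Assume that $\Phi\cap\mathbb R\beta=\{\beta,-\beta\}$ for every $\beta\in\Phi$. A simple reflection $s$ acts on colored positive roots $\beta^{(k)}$, $k\in\mathbb Z_{\ge0}$, by $s(\beta^{(k)})=[s(\beta)]^{(k)}$ if $\beta\ne\alpha_s$ and $s(\alpha_s^{(k)})=\alpha_s^{(k+1)}$. The colored inversion set of $w\in B^+$ is $$\mathrm{inv}(w)=\{\,s_1\cdots s_{i-1}(\alpha_{s_i}^{(0)}) : 1\le i\le p\,\},$$ where $s_1\cdots s_p$ is any word for $w$; it does not depend on the word. **Theorem.** For all $w,u\in\mathrm{Sort}^{(m)}(W,c)$: 1. $w\le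 u$ if and only if $\mathrm{inv}(w)\subseteq\mathrm{inv}(u)$; 2. the meet $w\wedge u$ in $W^{(m)}$ exists, and $\mathrm{inv}(w\wedge u)=\mathrm{inv}(w)\cap\mathrm{inv}(u)$. -/

import Mathlib

open scoped Matrix

noncomputable section

/-! ### The positive Artin monoid and its weak order -/

/-- The braid relations `s t s ⋯ = t s t ⋯` (both sides of length `M s t`) as relations between
words. If `M s t = 0` (which encodes `∞`), both sides are the empty word. -/
def braidRel {B : Type*} (M : CoxeterMatrix B) (x y : FreeMonoid B) : Prop :=
  ∃ s t : B, x = FreeMonoid.ofList (CoxeterSystem.braidWord M s t) ∧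
    y = FreeMonoid.ofList (CoxeterSystem.braidWord M t s)

/-- The positive Artin monoid `B⁺`: words in the simple generators modulo braid moves. -/
def ArtinMonoid {B : Type*} (M : CoxeterMatrix B) : Type _ := PresentedMonoid (braidRel M)

namespace ArtinMonoid

variable {B : Type*} {M : CoxeterMatrix B}

instance : Monoid (ArtinMonoid M) := inferInstanceAs (Monoid (PresentedMonoid (braidRel M)))

/-- The element of `B⁺` given by a word in the simple generators. -/
def ofWord (M : CoxeterMatrix B) (Q : List B) : ArtinMonoid M :=
  PresentedMonoid.mk (braidRel M) (FreeMonoid.ofList Q)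

theorem ofWord_append (Q R : List B) : ofWord M (Q ++ R) = ofWord M Q * ofWord M R :=
  map_mul (PresentedMonoid.mk (braidRel M)) (FreeMonoid.ofList Q) (FreeMonoid.ofList R)

theorem ofWord_nil : ofWord M [] = 1 := rfl

theorem ofWord_surjective : Function.Surjective (ofWord M) := fun x => by
  obtain ⟨q, hq⟩ := PresentedMonoid.surjective_mk (rels := braidRel M) x
  exact ⟨FreeMonoid.toList q, hq⟩

/-- The length of `w ∈ B⁺`: the length of a shortest word for `w`. -/
def length (w : ArtinMonoid M) : ℕ := sInf {k | ∃ Q : List B, ofWord M Q = w ∧ Q.length = k}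

theorem length_eq_of_ofWord_eq {Q R : List B} (h : ofWord M Q = ofWord M R) :
    Q.length = R.length := by
  have hrel : ∀ a b : FreeMonoid B, braidRel M a b →
      FreeMonoid.lift (fun _ : B => Multiplicative.ofAdd (1 : ℕ)) a =
        FreeMonoid.lift (fun _ : B => Multiplicative.ofAdd (1 : ℕ)) b := by
    rintro a b ⟨s, t, rfl, rfl⟩
    simp [FreeMonoid.lift_apply, CoxeterSystem.length_alternatingWord, M.symmetric s t]
  have key : ∀ L : List B,
      (PresentedMonoid.lift (fun _ : B => Multiplicative.ofAdd (1 : ℕ)) hrel)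
        (PresentedMonoid.mk (braidRel M) (FreeMonoid.ofList L)) =
          Multiplicative.ofAdd (1 : ℕ) ^ L.length := by
    intro L
    change FreeMonoid.lift (fun _ : B => Multiplicative.ofAdd (1 : ℕ)) (FreeMonoid.ofList L) = _
    simp [FreeMonoid.lift_apply]
  have h' := (key Q).symm.trans ((congrArg _ h).trans (key R))
  simpa [← ofAdd_nsmul] using h'

/-- All words for an element of `B⁺` have the same length. -/
theorem length_ofWord (Q : List B) : length (ofWord M Q) = Q.length := by
  have : {k | ∃ R : List B, ofWord M R = ofWord M Q ∧ R.length = k} = {Q.length} := by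
    ext k
    constructor
    · rintro ⟨R, hR, rfl⟩
      exact length_eq_of_ofWord_eq hR
    · rintro rfl
      exact ⟨Q, rfl, rfl⟩
  rw [length, this, csInf_singleton]

theorem length_mul (u v : ArtinMonoid M) : length (u * v) = length u + length v := by
  obtain ⟨Q, rfl⟩ := ofWord_surjective u
  obtain ⟨R, rfl⟩ := ofWord_surjective v
  rw [← ofWord_append, length_ofWord, length_ofWord, length_ofWord, List.length_append]

theorem eq_one_of_length_eq_zero {u : ArtinMonoid M} (h : length u = 0) : u = 1 := by
  obtain ⟨Q, rfl⟩ := ofWord_surjective u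
  rw [length_ofWord, List.length_eq_zero_iff] at h
  rw [h, ofWord_nil]

/-- The (right) weak order on `B⁺`: `u ≤ w` if `w = u v` with `ℓ(u) + ℓ(v) = ℓ(w)`. -/
instance : PartialOrder (ArtinMonoid M) where
  le u w := ∃ v, u * v = w ∧ length u + length v = length w
  le_refl u := ⟨1, mul_one u, by rw [← length_mul, mul_one]⟩
  le_trans := by
    rintro u v w ⟨x, rfl, -⟩ ⟨y, rfl, -⟩
    exact ⟨x * y, (mul_assoc u x y).symm, by simp only [length_mul, add_assoc]⟩
  le_antisymm := by
    rintro u w ⟨x, rfl, -⟩ ⟨y, hy, hl⟩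
    rw [length_mul] at hl
    rw [eq_one_of_length_eq_zero (u := x) (by omega), mul_one]

end ArtinMonoid

/-! ### The fundamental element and the `m`-weak order -/

namespace CoxeterSystem

variable {B W : Type*} [Group W] {M : CoxeterMatrix B}

/-- The element of `B⁺` given by a reduced word of `w ∈ W`. -/
def toArtin (cs : CoxeterSystem M W) (w : W) : ArtinMonoid M :=
  ArtinMonoid.ofWord M (Classical.choose (cs.exists_isReduced w))

/-- An element of maximal length of a finite Coxeter group. -/
def longest [Finite W] (cs : CoxeterSystem M W) : W :=
  Classical.choose (Finite.exists_max cs.length)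

theorem length_le_length_longest [Finite W] (cs : CoxeterSystem M W) (w : W) :
    cs.length w ≤ cs.length cs.longest :=
  Classical.choose_spec (Finite.exists_max cs.length) w

/-- The set `W⁽ᵐ⁾`, the interval `[1, w₀ᵐ]` of the weak order on `B⁺`. Its coercion to a type
carries the induced order, the `m`-weak order. -/
def mWeak [Finite W] (cs : CoxeterSystem M W) (m : ℕ) : Set (ArtinMonoid M) :=
  Set.Icc 1 (cs.toArtin cs.longest ^ m)

end CoxeterSystem

/-! ### Sorting words and sortable elements -/

section Sortable

variable {B : Type*} {n : ℕ}

/-- A sequence of positions in `𝐜^∞` describing a subword for `w`. Here `𝐜 = c 0, c 1, …, c (n-1)`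
is an ordering of all the simple generators, that is, a reduced word for a Coxeter element, and
the position `(k, i)` is that of the `i`-th letter in the `k`-th copy of `𝐜`. -/
def IsSubwordFor (M : CoxeterMatrix B) (c : Fin n ≃ B) (w : ArtinMonoid M)
    (P : List (ℕ ×ₗ Fin n)) : Prop :=
  P.Pairwise (· < ·) ∧ ArtinMonoid.ofWord M (P.map fun p => c (ofLex p).2) = w

/-- `P` is the sequence of positions of the `c`-sorting word of `w`: the lexicographically first
subword of `𝐜^∞` that is a word for `w`. -/
def IsSortingWord (M : CoxeterMatrix B) (c : Fin n ≃ B) (w : ArtinMonoid M)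
    (P : List (ℕ ×ₗ Fin n)) : Prop :=
  IsLeast {P' | IsSubwordFor M c w P'} P

/-- `w` is `c`-sortable: the sets of positions in the successive copies of `𝐜` that are used by
its sorting word form a decreasing sequence. -/
def IsSortable {M : CoxeterMatrix B} (c : Fin n ≃ B) (w : ArtinMonoid M) : Prop :=
  ∃ P, IsSortingWord M c w P ∧
    ∀ k : ℕ, {i : Fin n | toLex (k + 1, i) ∈ P} ⊆ {i : Fin n | toLex (k, i) ∈ P}

/-- The set `Sort⁽ᵐ⁾(W, c)` of `m`-eralized `c`-sortable elements. -/
def mSort {W : Type*} [Group W] [Finite W] {M : CoxeterMatrix B} (cs : CoxeterSystem M W) (m : ℕ)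
    (c : Fin n ≃ B) : Set (cs.mWeak m) :=
  {w | IsSortable c (w : ArtinMonoid M)}

end Sortable

/-! ### Roots and colored inversion sets -/

section Roots

variable {B : Type*} [Fintype B]

/-- A generalized Cartan matrix for a Coxeter system with Coxeter matrix `M`. -/
structure IsGeneralizedCartanMatrix (M : CoxeterMatrix B) (a : Matrix B B ℝ) : Prop where
  diag : ∀ s, a s s = 2
  nonpos : ∀ s t, s ≠ t → a s t ≤ 0
  mul_eq : ∀ s t, s ≠ t → a s t * a t s = 4 * Real.cos (Real.pi / M s t) ^ 2
  zero_iff : ∀ s t, s ≠ t → (a s t = 0 ↔ a t s = 0)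

open Classical in
/-- The simple root `α_s`, in the real vector space with basis the simple roots. -/
def simpleRoot (s : B) : B → ℝ := Pi.single s 1

/-- The simple reflection `s`, the linear map with `s (α_t) = α_t - a_{st} α_s`. -/
def simpleRefl (a : Matrix B B ℝ) (s : B) (v : B → ℝ) : B → ℝ :=
  v - (a *ᵥ v) s • simpleRoot s

/-- The roots: the vectors `s₁ ⋯ s_k (α_s)`. -/
def roots (a : Matrix B B ℝ) : Set (B → ℝ) :=
  {β | ∃ (Q : List B) (s : B), β = Q.foldr (simpleRefl a) (simpleRoot s)}

/-- Each line spanned by a root contains precisely two roots, `β` and `-β`. -/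
def IsReducedRoots (a : Matrix B B ℝ) : Prop :=
  ∀ β ∈ roots a, ∀ r : ℝ, r • β ∈ roots a → r = 1 ∨ r = -1

open Classical in
/-- The action of `s` on colored positive roots `β⁽ᵏ⁾ = (β, k)`:
`s (β⁽ᵏ⁾) = (s β)⁽ᵏ⁾` if `β ≠ α_s`, and `s (α_s⁽ᵏ⁾) = α_s⁽ᵏ⁺¹⁾`. -/
def coloredRefl (a : Matrix B B ℝ) (s : B) (b : (B → ℝ) × ℕ) : (B → ℝ) × ℕ :=
  if b.1 = simpleRoot s then (simpleRoot s, b.2 + 1) else (simpleRefl a s b.1, b.2)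

/-- The colored inversion sequence of the word `s₁ ⋯ s_p`, whose `i`-th entry is
`s₁ ⋯ s_{i-1} (α_{s_i}⁽⁰⁾)`. -/
def coloredInvSeq (a : Matrix B B ℝ) : List B → List ((B → ℝ) × ℕ)
  | [] => []
  | s :: Q => (simpleRoot s, 0) :: (coloredInvSeq a Q).map (coloredRefl a s)

/-- The colored inversion set of `w ∈ B⁺`: the set of entries of the colored inversion sequence
of a word for `w`. (This set is the same for all words for `w`.) -/
def coloredInv {M : CoxeterMatrix B} (a : Matrix B B ℝ) (w : ArtinMonoid M) :
    Set ((B → ℝ) × ℕ) :=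
  {b | ∃ Q : List B, ArtinMonoid.ofWord M Q = w ∧ b ∈ coloredInvSeq a Q}

end Roots

end

noncomputable section

/-! ### The geometric representation -/

section Geometric

/-! Meets are taken in B⁺: Garside theory gives left cancellation and greatest lower bounds
(`exists_isGLB`), and the meet of two elements of [1, w₀ᵐ] stays in this interval. The heart is
inv(w ∧ u) = inv(w) ∩ inv(u). It implies the order statement because |inv(w)| = ℓ(w)
(`ncard_coloredInv`): if inv(w) ⊆ inv(u), then w ∧ u ≤ w have equal lengths and coincide.

The inclusion ⊆ is monotonicity of inv. For ⊇ one inducts on the lengths of two words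
(`coloredInv_eq_inter_of_haveCommonBase`). The critical case is that of words Xx and Yy whose last
letters create the same colored root. It suffices that X = hp and Y = hq with px = ep and qy = eq
for one generator e (`HaveCommonBase`): then some generator e' satisfies (X ∧ Y)e' ≤ Xx, Yy, and the
inversion created by e' must be the common one.

To find such a base, a c-sortable element is encoded by a cyclic reading of c in which each letter
met is either used and kept, or discarded for good (`IsSortingSeq`). This permits induction by
conjugating with the first letter. Two forms on V control the roots: a W-invariant positive definite
form F, and a skew form ω_c with ω_{scs}(sx, sy) = ω_c(x, y) for the initial letter s of c. Suppose
that a letter creates γ⁽⁰⁾ and that ρ⁽ˡ⁾ was created before. If l = 0, then ω_c(ρ, γ) ≤ 0, strictly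
if γ = pρ + qσ with p, q > 0 and σ⁽⁰⁾ not yet created (`IsSortingSeq.omega_nonpos`). If l > 0, then
F(ρ, γ) = 0 (`IsSortingSeq.form_eq_zero`).

Orthogonality lets the letters of positive color commute past those of color 0
(`IsAligned.exists_split_concat`), and a letter creating β⁽ᵏ⁾ is conjugate to an earlier one
creating β⁽⁰⁾ (`IsSortingSeq.exists_chain`). This reduces the search to words X, Y such that Xx and
Yy are reduced in W. Write X = hP₁, Y = hP₂ with h = X ∧ Y; by the inductive hypothesis inv(P₁) and
inv(P₂) are disjoint, and P₁(α_x) = P₂(α_y) = γ. If γ is a simple root α_e, then P₁ and P₂ conjugate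
x and y to e. Otherwise γ is a positive combination of two positive roots, of which each inv(Pᵢ)
contains exactly one, and these differ by disjointness. The images of the two roots under h then
have negative ω_c in both orders, which contradicts skew-symmetry (`IsAligned.haveCommonBase`). -/

theorem simpleRoot_self {B : Type*} (s : B) : simpleRoot s s = 1 := by simp [simpleRoot]

theorem simpleRoot_of_ne {B : Type*} {s t : B} (h : t ≠ s) : simpleRoot s t = 0 := by simp [simpleRoot, h]

variable {B : Type*} [Fintype B] {M : CoxeterMatrix B} {a : Matrix B B ℝ}

theorem mulVec_simpleRoot (a : Matrix B B ℝ) (s t : B) : (a *ᵥ simpleRoot s) t = a t s := by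
  classical
  simp [simpleRoot]

theorem simpleRefl_apply_ne (a : Matrix B B ℝ) {s t : B} (h : t ≠ s) (v : B → ℝ) :
    simpleRefl a s v t = v t := by
  simp [simpleRefl, simpleRoot_of_ne h]

theorem simpleRefl_apply_self (a : Matrix B B ℝ) (s : B) (v : B → ℝ) :
    simpleRefl a s v s = v s - (a *ᵥ v) s := by
  simp [simpleRefl, simpleRoot_self]

/-- The simple reflection as a linear map. -/
def simpleReflLin (a : Matrix B B ℝ) (s : B) : Module.End ℝ (B → ℝ) where
  toFun := simpleRefl a s
  map_add' v w := by
    simp only [simpleRefl, Matrix.mulVec_add, Pi.add_apply, add_smul]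
    abel
  map_smul' r v := by
    simp only [simpleRefl, Matrix.mulVec_smul, Pi.smul_apply, smul_eq_mul, mul_smul, smul_sub,
      RingHom.id_apply]

theorem simpleReflLin_apply (a : Matrix B B ℝ) (s : B) (v : B → ℝ) :
    simpleReflLin a s v = simpleRefl a s v := rfl

theorem simpleRefl_simpleRoot (a : Matrix B B ℝ) (s t : B) :
    simpleRefl a s (simpleRoot t) = simpleRoot t - a s t • simpleRoot s := by
  rw [simpleRefl, mulVec_simpleRoot]

namespace IsGeneralizedCartanMatrix

variable (ha : IsGeneralizedCartanMatrix M a)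
include ha

theorem simpleRefl_simpleRoot_self (s : B) : simpleRefl a s (simpleRoot s) = -simpleRoot s := by
  rw [simpleRefl_simpleRoot, ha.diag, two_smul]; abel

theorem simpleRefl_simpleRefl (s : B) (v : B → ℝ) : simpleRefl a s (simpleRefl a s v) = v := by
  have h : simpleRefl a s v = v - (a *ᵥ v) s • simpleRoot s := rfl
  rw [← simpleReflLin_apply, h, map_sub, map_smul, simpleReflLin_apply, simpleReflLin_apply,
    ha.simpleRefl_simpleRoot_self, h, smul_neg]
  abel

end IsGeneralizedCartanMatrix

end Geometric

/-! ### The dihedral coefficients -/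

/-- `(dihedralCoeff K j).1` and `.2` are, for `K = 4 cos² θ`, the numbers
`sin ((2 j + 1) θ) / sin θ` and `sin (2 j θ) / sin (2 θ)`. -/
def dihedralCoeff (K : ℝ) : ℕ → ℝ × ℝ
  | 0 => (1, 0)
  | j + 1 =>
    let p := dihedralCoeff K j
    (K * (p.1 - p.2) - p.1, p.1 - p.2)

theorem dihedralCoeff_succ_snd (K : ℝ) (j : ℕ) :
    (dihedralCoeff K (j + 1)).2 = (dihedralCoeff K j).1 - (dihedralCoeff K j).2 := rfl

theorem dihedralCoeff_succ_fst (K : ℝ) (j : ℕ) :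
    (dihedralCoeff K (j + 1)).1 = K * (dihedralCoeff K (j + 1)).2 - (dihedralCoeff K j).1 := rfl

/-- Addition formulas for sine. Keeping the denominators on the left makes the identities valid for
every θ, also when sin 2θ = 0. -/
theorem dihedralCoeff_sin (θ : ℝ) (j : ℕ) :
    (dihedralCoeff (4 * Real.cos θ ^ 2) j).1 * Real.sin θ = Real.sin ((2 * j + 1) * θ) ∧
      (dihedralCoeff (4 * Real.cos θ ^ 2) j).2 * Real.sin (2 * θ) = Real.sin (2 * j * θ) := by
  induction j with
  | zero => simp [dihedralCoeff]
  | succ j ih =>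
    obtain ⟨h1, h2⟩ := ih
    have e : (dihedralCoeff (4 * Real.cos θ ^ 2) (j + 1)).2 * Real.sin (2 * θ) =
        Real.sin (2 * (j + 1 : ℕ) * θ) := by
      have hs : Real.sin (2 * (j + 1 : ℕ) * θ) =
          Real.sin ((2 * j + 1) * θ) * Real.cos θ + Real.cos ((2 * j + 1) * θ) * Real.sin θ := by
        rw [← Real.sin_add]; congr 1; push_cast; ring
      have hs' : Real.sin (2 * j * θ) =
          Real.sin ((2 * j + 1) * θ) * Real.cos θ - Real.cos ((2 * j + 1) * θ) * Real.sin θ := by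
        rw [← Real.sin_sub]; congr 1; ring
      rw [dihedralCoeff_succ_snd, sub_mul, h2, hs, hs', Real.sin_two_mul]
      linear_combination (2 * Real.cos θ) * h1
    refine ⟨?_, e⟩
    have hs : Real.sin ((2 * (j + 1 : ℕ) + 1) * θ) = Real.sin (2 * (j + 1 : ℕ) * θ) * Real.cos θ +
        Real.cos (2 * (j + 1 : ℕ) * θ) * Real.sin θ := by
      rw [← Real.sin_add]; congr 1; ring
    have hs' : Real.sin ((2 * j + 1) * θ) = Real.sin (2 * (j + 1 : ℕ) * θ) * Real.cos θ -
        Real.cos (2 * (j + 1 : ℕ) * θ) * Real.sin θ := by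
      rw [← Real.sin_sub]; congr 1; push_cast; ring
    rw [dihedralCoeff_succ_fst, sub_mul, h1, hs, hs', ← e, Real.sin_two_mul]
    ring

theorem dihedralCoeff_four (j : ℕ) : dihedralCoeff 4 j = (2 * (j : ℝ) + 1, (j : ℝ)) := by
  induction j with
  | zero => simp [dihedralCoeff]
  | succ j ih =>
    ext
    · rw [dihedralCoeff_succ_fst, dihedralCoeff_succ_snd, ih]; push_cast; ring
    · rw [dihedralCoeff_succ_snd, ih]; push_cast; ring

theorem sin_pi_div_pos {m : ℕ} (hm : 2 ≤ m) : 0 < Real.sin (Real.pi / m) := by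
  have : (2 : ℝ) ≤ m := by exact_mod_cast hm
  apply Real.sin_pos_of_pos_of_lt_pi
  · positivity
  · exact div_lt_self Real.pi_pos (by linarith)

theorem sin_mul_pi_div_nonneg {m k : ℕ} (hk : k ≤ m) : 0 ≤ Real.sin (k * (Real.pi / m)) := by
  rcases Nat.eq_zero_or_pos m with rfl | hm
  · simp
  apply Real.sin_nonneg_of_nonneg_of_le_pi
  · positivity
  · have h1 : (k : ℝ) ≤ m := by exact_mod_cast hk
    have h2 : (0 : ℝ) < m := by exact_mod_cast hm
    calc (k : ℝ) * (Real.pi / m) ≤ m * (Real.pi / m) := by gcongr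
      _ = Real.pi := by field_simp

theorem dihedralCoeff_fst_nonneg {m j : ℕ} (hm : m ≠ 1) (hj : m = 0 ∨ 2 * j + 1 ≤ m) :
    0 ≤ (dihedralCoeff (4 * Real.cos (Real.pi / m) ^ 2) j).1 := by
  rcases Nat.eq_zero_or_pos m with rfl | hm0
  -- `m = 0` encodes ∞; since π / 0 = 0, this is θ = 0 and K = 4, where the coefficients are
  -- polynomials in j.
  · simp only [Nat.cast_zero, div_zero, Real.cos_zero, one_pow, mul_one, dihedralCoeff_four]
    positivity
  have hj' : 2 * j + 1 ≤ m := by omega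
  have h := (dihedralCoeff_sin (Real.pi / m) j).1
  have h2 := sin_mul_pi_div_nonneg hj'
  push_cast at h2
  rw [← h] at h2
  exact nonneg_of_mul_nonneg_left h2 (sin_pi_div_pos (by omega))

theorem dihedralCoeff_snd_nonneg {m j : ℕ} (hm : m ≠ 1) (hj : m = 0 ∨ 2 * j ≤ m) :
    0 ≤ (dihedralCoeff (4 * Real.cos (Real.pi / m) ^ 2) j).2 := by
  rcases Nat.eq_zero_or_pos m with rfl | hm0
  · simp only [Nat.cast_zero, div_zero, Real.cos_zero, one_pow, mul_one, dihedralCoeff_four]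
    positivity
  have hj' : 2 * j ≤ m := by omega
  rcases Nat.lt_or_ge 2 m with h3 | h3
  · have h := (dihedralCoeff_sin (Real.pi / m) j).2
    have h2 := sin_mul_pi_div_nonneg hj'
    push_cast at h2
    rw [← h] at h2
    refine nonneg_of_mul_nonneg_left h2 ?_
    have hm' : (2 : ℝ) < m := by exact_mod_cast h3
    apply Real.sin_pos_of_pos_of_lt_pi
    · positivity
    · have : 2 * (Real.pi / m) = Real.pi * (2 / m) := by ring
      rw [this]
      have : 2 / (m : ℝ) < 1 := by rw [div_lt_one (by linarith)]; exact hm'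
      nlinarith [Real.pi_pos]
  -- For m = 2 one has sin 2θ = 0 and the sine formula carries no information, but only j = 0 and j
  -- = 1 occur.
  · have : j = 0 ∨ j = 1 := by omega
    rcases this with rfl | rfl
    · simp [dihedralCoeff]
    · simp [dihedralCoeff]

section Dihedral

open CoxeterSystem

variable {B : Type*} [Fintype B] {M : CoxeterMatrix B} {a : Matrix B B ℝ}
variable (ha : IsGeneralizedCartanMatrix M a)
include ha

/-- Each further letter changes only the coefficient of its own simple root, by the recursion of
`dihedralCoeff`. The lack of symmetry of `a` shows up only in the factor a_{ts}. -/
theorem foldr_alternatingWord_even (s t : B) (j : ℕ) :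
    (alternatingWord s t (2 * j)).foldr (simpleRefl a) (simpleRoot s) =
      (dihedralCoeff (a s t * a t s) j).1 • simpleRoot s -
        (a t s * (dihedralCoeff (a s t * a t s) j).2) • simpleRoot t ∧
    (alternatingWord s t (2 * j + 1)).foldr (simpleRefl a) (simpleRoot s) =
      (dihedralCoeff (a s t * a t s) j).1 • simpleRoot s -
        (a t s * (dihedralCoeff (a s t * a t s) (j + 1)).2) • simpleRoot t := by
  have step : ∀ j, (alternatingWord s t (2 * j)).foldr (simpleRefl a) (simpleRoot s) =
      (dihedralCoeff (a s t * a t s) j).1 • simpleRoot s -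
        (a t s * (dihedralCoeff (a s t * a t s) j).2) • simpleRoot t →
      (alternatingWord s t (2 * j + 1)).foldr (simpleRefl a) (simpleRoot s) =
      (dihedralCoeff (a s t * a t s) j).1 • simpleRoot s -
        (a t s * (dihedralCoeff (a s t * a t s) (j + 1)).2) • simpleRoot t := by
    intro j h
    rw [alternatingWord_succ', List.foldr_cons, h, if_pos (even_two_mul j), ← simpleReflLin_apply,
      map_sub, map_smul, map_smul, simpleReflLin_apply, simpleReflLin_apply,
      ha.simpleRefl_simpleRoot_self, simpleRefl_simpleRoot, dihedralCoeff_succ_snd]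
    module
  induction j with
  | zero =>
    have h0 : (alternatingWord s t (2 * 0)).foldr (simpleRefl a) (simpleRoot s) =
      (dihedralCoeff (a s t * a t s) 0).1 • simpleRoot s -
        (a t s * (dihedralCoeff (a s t * a t s) 0).2) • simpleRoot t := by
      simp [alternatingWord, dihedralCoeff]
    exact ⟨h0, step 0 h0⟩
  | succ j ih =>
    have h0 : (alternatingWord s t (2 * (j + 1))).foldr (simpleRefl a) (simpleRoot s) =
      (dihedralCoeff (a s t * a t s) (j + 1)).1 • simpleRoot s -
        (a t s * (dihedralCoeff (a s t * a t s) (j + 1)).2) • simpleRoot t := by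
      have hodd : ¬ Even (2 * j + 1) := by simp
      rw [show 2 * (j + 1) = 2 * j + 1 + 1 by ring, alternatingWord_succ', List.foldr_cons, ih.2,
        if_neg hodd, ← simpleReflLin_apply,
        map_sub, map_smul, map_smul, simpleReflLin_apply, simpleReflLin_apply,
        ha.simpleRefl_simpleRoot_self, simpleRefl_simpleRoot, dihedralCoeff_succ_fst]
      module
    exact ⟨h0, step (j + 1) h0⟩

/-- Below the braid length, alternating words send a simple root to a nonnegative combination
of the two simple roots. -/
theorem foldr_alternatingWord_nonneg {s t : B} (hst : s ≠ t) {k : ℕ}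
    (hk : M s t = 0 ∨ k < M s t) :
    ∃ x y : ℝ, 0 ≤ x ∧ 0 ≤ y ∧
      (alternatingWord s t k).foldr (simpleRefl a) (simpleRoot s) =
        x • simpleRoot s + y • simpleRoot t := by
  have hM : M s t ≠ 1 := M.off_diagonal s t hst
  have hK := ha.mul_eq s t hst
  have hn := ha.nonpos t s hst.symm
  rcases Nat.even_or_odd' k with ⟨j, rfl | rfl⟩
  · refine ⟨_, -a t s * (dihedralCoeff (a s t * a t s) j).2, ?_, ?_,
      (foldr_alternatingWord_even ha s t j).1.trans (by module)⟩
    · rw [hK]; exact dihedralCoeff_fst_nonneg hM (by omega)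
    · rw [hK]; exact mul_nonneg (by linarith) (dihedralCoeff_snd_nonneg hM (by omega))
  · refine ⟨_, -a t s * (dihedralCoeff (a s t * a t s) (j + 1)).2, ?_, ?_,
      (foldr_alternatingWord_even ha s t j).2.trans (by module)⟩
    · rw [hK]; exact dihedralCoeff_fst_nonneg hM (by omega)
    · rw [hK]; exact mul_nonneg (by linarith) (dihedralCoeff_snd_nonneg hM (by omega))

theorem simpleReflLin_mul_pow_simpleRoot (s t : B) (j : ℕ) :
    ((simpleReflLin a s * simpleReflLin a t) ^ j) (simpleRoot s) =
      (dihedralCoeff (a s t * a t s) j).1 • simpleRoot s -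
        (a t s * (dihedralCoeff (a s t * a t s) j).2) • simpleRoot t := by
  rw [← (foldr_alternatingWord_even ha s t j).1]
  induction j with
  | zero => simp [alternatingWord]
  | succ j ih =>
    have hodd : ¬ Even (2 * j + 1) := by simp
    rw [pow_succ', Module.End.mul_apply, ih, show 2 * (j + 1) = 2 * j + 1 + 1 by ring,
      alternatingWord_succ', alternatingWord_succ', if_neg hodd, if_pos (even_two_mul j),
      List.foldr_cons, List.foldr_cons]
    rfl

theorem simpleReflLin_mul_self (s : B) : simpleReflLin a s * simpleReflLin a s = 1 :=
  LinearMap.ext fun v => ha.simpleRefl_simpleRefl s v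

/-- On the plane of α_s and α_t the relation is the sine formula at j = m_{st}. On the common kernel
of the coordinates s and t of `a *ᵥ ·` both reflections are trivial. The two subspaces span V
because 4 - a_{st} a_{ts} = 4 sin² θ ≠ 0. -/
theorem simpleReflLin_isLiftable : M.IsLiftable (simpleReflLin a) := by
  intro s t
  rcases eq_or_ne s t with rfl | hst
  · rw [simpleReflLin_mul_self ha, one_pow]
  rcases Nat.eq_zero_or_pos (M s t) with h0 | hpos
  · rw [h0, pow_zero]
  have hM : M s t ≠ 1 := M.off_diagonal s t hst
  have hfix : ∀ s t : B, s ≠ t → 2 ≤ M s t →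
      ((simpleReflLin a s * simpleReflLin a t) ^ M s t) (simpleRoot s) = simpleRoot s := by
    intro s t hst h2
    have hK := ha.mul_eq s t hst
    have hm : ((M s t : ℕ) : ℝ) ≠ 0 := by
      have : M s t ≠ 0 := by omega
      exact_mod_cast this
    have hs := sin_pi_div_pos h2
    rw [simpleReflLin_mul_pow_simpleRoot ha, hK]
    obtain ⟨h1, h2'⟩ := dihedralCoeff_sin (Real.pi / M s t) (M s t)
    have e1 : (dihedralCoeff (4 * Real.cos (Real.pi / M s t) ^ 2) (M s t)).1 = 1 := by
      have : (2 * (M s t : ℝ) + 1) * (Real.pi / M s t) = Real.pi / M s t + 2 * Real.pi := by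
        field_simp; ring
      rw [this, Real.sin_add_two_pi] at h1
      exact mul_right_cancel₀ hs.ne' (h1.trans (one_mul _).symm)
    have e2 : a t s * (dihedralCoeff (4 * Real.cos (Real.pi / M s t) ^ 2) (M s t)).2 = 0 := by
      have : 2 * (M s t : ℝ) * (Real.pi / M s t) = 2 * Real.pi := by field_simp
      rw [this, Real.sin_two_pi, Real.sin_two_mul] at h2'
      -- If cos θ = 0, the sine formula is void, but then a_{ts} = 0.
      by_cases hc : Real.cos (Real.pi / M s t) = 0
      · rw [hc] at hK
        have h0 : a t s = 0 := by
          have : a s t * a t s = 0 := by rw [hK]; ring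
          rcases mul_eq_zero.1 this with h | h
          · exact (ha.zero_iff s t hst).1 h
          · exact h
        rw [h0, zero_mul]
      · have : (2 * Real.sin (Real.pi / M s t) * Real.cos (Real.pi / M s t)) ≠ 0 := by positivity
        rw [(mul_eq_zero.1 h2').resolve_right this, mul_zero]
    rw [e1, e2, one_smul, zero_smul, sub_zero]
  have hs' := hfix s t hst (by omega)
  have ht' : ((simpleReflLin a s * simpleReflLin a t) ^ M s t) (simpleRoot t) = simpleRoot t := by
    have h := hfix t s hst.symm (by rw [M.symmetric]; omega)
    rw [M.symmetric] at h
    have inv : ∀ k, (simpleReflLin a s * simpleReflLin a t) ^ k *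
        (simpleReflLin a t * simpleReflLin a s) ^ k = 1 := by
      intro k
      induction k with
      | zero => simp
      | succ k ih =>
        rw [pow_succ, pow_succ']
        calc _ = (simpleReflLin a s * simpleReflLin a t) ^ k * (simpleReflLin a s *
              ((simpleReflLin a t * simpleReflLin a t) * simpleReflLin a s)) *
              (simpleReflLin a t * simpleReflLin a s) ^ k := by simp only [mul_assoc]
          _ = 1 := by
            rw [simpleReflLin_mul_self ha, one_mul, simpleReflLin_mul_self ha, mul_one, ih]
    nth_rewrite 1 [← h]
    rw [← Module.End.mul_apply, inv, Module.End.one_apply]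
  have hcompl : ∀ v : B → ℝ, (a *ᵥ v) s = 0 → (a *ᵥ v) t = 0 →
      ((simpleReflLin a s * simpleReflLin a t) ^ M s t) v = v := by
    intro v h1 h2
    have h : (simpleReflLin a s * simpleReflLin a t) v = v := by
      rw [Module.End.mul_apply, simpleReflLin_apply, simpleReflLin_apply,
        show simpleRefl a t v = v by rw [simpleRefl, h2, zero_smul, sub_zero],
        simpleRefl, h1, zero_smul, sub_zero]
    generalize M s t = k
    induction k with
    | zero => rfl
    | succ k ih => rw [pow_succ, Module.End.mul_apply, h, ih]
  apply LinearMap.ext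
  intro v
  have hK := ha.mul_eq s t hst
  have hD : 4 - a s t * a t s ≠ 0 := by
    rw [hK]
    have h1 := Real.sin_sq_add_cos_sq (Real.pi / M s t)
    have h2 := sin_pi_div_pos (show 2 ≤ M s t by omega)
    nlinarith
  set D := 4 - a s t * a t s with hDdef
  set f := (a *ᵥ v) s with hf
  set g := (a *ᵥ v) t with hg
  -- Cramer's rule for 2x + a_{st} y = f, a_{ts} x + 2y = g: subtracting x α_s + y α_t leaves a
  -- vector on which both reflections are trivial.
  set x := (2 * f - a s t * g) / D with hx
  set y := (2 * g - a t s * f) / D with hy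
  have key : v = (v - x • simpleRoot s - y • simpleRoot t) + x • simpleRoot s +
      y • simpleRoot t := by abel
  have hc := hcompl (v - x • simpleRoot s - y • simpleRoot t)
    (by
      rw [Matrix.mulVec_sub, Matrix.mulVec_sub, Matrix.mulVec_smul, Matrix.mulVec_smul]
      simp only [Pi.sub_apply, Pi.smul_apply, mulVec_simpleRoot, ha.diag, smul_eq_mul, ← hf]
      rw [hx, hy]; field_simp; rw [hDdef]; ring)
    (by
      rw [Matrix.mulVec_sub, Matrix.mulVec_sub, Matrix.mulVec_smul, Matrix.mulVec_smul]
      simp only [Pi.sub_apply, Pi.smul_apply, mulVec_simpleRoot, ha.diag, smul_eq_mul, ← hg]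
      rw [hx, hy]; field_simp; rw [hDdef]; ring)
  rw [Module.End.one_apply]
  nth_rewrite 1 [key]
  rw [map_add, map_add, map_smul, map_smul, hs', ht', hc]
  exact key.symm

end Dihedral

/-! ### Positivity of roots -/

theorem simpleRoot_nonneg {B : Type*} (s : B) : 0 ≤ simpleRoot s := by
  classical
  exact Pi.single_nonneg.2 zero_le_one

theorem simpleRoot_ne_zero {B : Type*} (s : B) : simpleRoot s ≠ 0 := fun h => by
  have := congrFun h s
  rw [simpleRoot_self] at this
  exact one_ne_zero this

namespace CoxeterSystem

/-! ### Alternating words and right descents -/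

section Alternating

variable {B W : Type*} [Group W] {M : CoxeterMatrix B}

theorem alternatingWord_suffix (s t : B) {j k : ℕ} (h : j ≤ k) :
    ∃ X : List B, X.length = k - j ∧ alternatingWord s t k = X ++ alternatingWord s t j := by
  induction k, h using Nat.le_induction with
  | base => exact ⟨[], by simp, rfl⟩
  | succ k hk ih =>
    obtain ⟨X, hX, e⟩ := ih
    exact ⟨(if Even k then t else s) :: X, by rw [List.length_cons, hX]; omega,
      by rw [alternatingWord_succ', e]; rfl⟩

variable (cs : CoxeterSystem M W)

theorem length_wordProd_alternatingWord_le (s t : B) (k : ℕ) :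
    cs.length (cs.wordProd (alternatingWord s t k)) ≤ k :=
  (cs.length_wordProd_le _).trans (length_alternatingWord s t k).le

/-- Every element factors as `v` times an alternating word in `s` and `t` such that, if the
alternating word is nonempty, `v` is minimal in its coset of the dihedral subgroup. -/
theorem exists_eq_mul_alternatingWord (w : W) (s t : B) :
    ∃ k v, w = v * cs.wordProd (alternatingWord s t k) ∧ cs.length w = cs.length v + k ∧
      ¬ cs.IsRightDescent v (if Even k then t else s) ∧
      (k ≠ 0 → ¬ cs.IsRightDescent v (if Even k then s else t)) := by
  classical
  let P : ℕ → Prop := fun k => ∃ v, w = v * cs.wordProd (alternatingWord s t k) ∧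
    cs.length w = cs.length v + k
  have hP0 : P 0 := ⟨w, by simp [alternatingWord], by simp⟩
  have hbd : ∀ k, P k → k ≤ cs.length w := fun k ⟨v, _, h⟩ => by omega
  obtain ⟨v, hv, hl⟩ : P (Nat.findGreatest P (cs.length w)) :=
    Nat.findGreatest_spec (P := P) (Nat.zero_le _) hP0
  refine ⟨_, v, hv, hl, ?_, ?_⟩
  · intro hd
    set k := Nat.findGreatest P (cs.length w) with hk
    rw [cs.isRightDescent_iff] at hd
    have : P (k + 1) := by
      refine ⟨v * cs.simple (if Even k then t else s), ?_, by omega⟩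
      rw [alternatingWord_succ', wordProd_cons, ← mul_assoc, cs.simple_mul_simple_cancel_right]
      exact hv
    have := Nat.le_findGreatest (hbd _ this) this
    omega
  · intro h0 hd
    obtain ⟨j, hj⟩ := Nat.exists_eq_succ_of_ne_zero h0
    rw [hj] at hv hl hd
    rw [cs.isRightDescent_iff] at hd
    have e : (if Even (j + 1) then s else t) = if Even j then t else s := by
      by_cases h : Even j <;> simp [h, Nat.even_add_one]
    rw [Nat.succ_eq_add_one, alternatingWord_succ', wordProd_cons, ← e, ← mul_assoc] at hv
    have h1 := cs.length_mul_le (v * cs.simple (if Even (j + 1) then s else t))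
      (cs.wordProd (alternatingWord s t j))
    rw [← hv] at h1
    have h2 := cs.length_wordProd_alternatingWord_le s t j
    simp only [Nat.succ_eq_add_one] at hd hl
    omega

/-- The alternating word ends in t, but as soon as it contains a full braid word, the braid relation
rewrites it to end in s. -/
theorem isRightDescent_mul_of_le {v : W} {s t : B} {k : ℕ} (h0 : M s t ≠ 0) (hk : M s t ≤ k)
    (hl : cs.length (v * cs.wordProd (alternatingWord s t k)) = cs.length v + k) :
    cs.IsRightDescent (v * cs.wordProd (alternatingWord s t k)) s := by
  obtain ⟨X, hX, e⟩ := alternatingWord_suffix s t hk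
  obtain ⟨j, hj⟩ := Nat.exists_eq_succ_of_ne_zero h0
  have h1 : cs.wordProd (alternatingWord s t (M s t)) =
      cs.wordProd (alternatingWord s t j) * cs.simple s := by
    have := cs.wordProd_braidWord_eq s t
    rw [braidWord, braidWord, M.symmetric t s] at this
    rw [this, hj, Nat.succ_eq_add_one, alternatingWord_succ, wordProd_concat]
  have h2 : v * cs.wordProd (alternatingWord s t k) * cs.simple s =
      v * cs.wordProd (X ++ alternatingWord s t j) := by
    rw [e, wordProd_append, wordProd_append, h1]
    simp only [mul_assoc, cs.simple_mul_simple_self, mul_one]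
  rw [IsRightDescent, h2, hl]
  have h3 := cs.length_mul_le v (cs.wordProd (X ++ alternatingWord s t j))
  have h4 := cs.length_wordProd_le (X ++ alternatingWord s t j)
  rw [List.length_append, hX, length_alternatingWord] at h4
  omega

end Alternating

variable {B W : Type*} [Fintype B] [Group W] {M : CoxeterMatrix B} {a : Matrix B B ℝ}
variable (cs : CoxeterSystem M W) (ha : IsGeneralizedCartanMatrix M a)

/-- The geometric representation of a Coxeter group on the span of the simple roots. -/
def geomRep : W →* Module.End ℝ (B → ℝ) :=
  cs.lift ⟨simpleReflLin a, simpleReflLin_isLiftable ha⟩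

theorem geomRep_simple (s : B) : cs.geomRep ha (cs.simple s) = simpleReflLin a s :=
  cs.lift_apply_simple _ s

theorem geomRep_wordProd (Q : List B) (v : B → ℝ) :
    cs.geomRep ha (cs.wordProd Q) v = Q.foldr (simpleRefl a) v := by
  induction Q with
  | nil => simp
  | cons s Q ih =>
    rw [wordProd_cons, map_mul, Module.End.mul_apply, ih, geomRep_simple]
    rfl

theorem geomRep_inv_apply (w : W) (v : B → ℝ) :
    cs.geomRep ha w⁻¹ (cs.geomRep ha w v) = v := by
  rw [← Module.End.mul_apply, ← map_mul, inv_mul_cancel, map_one, Module.End.one_apply]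

theorem geomRep_apply_inv (w : W) (v : B → ℝ) :
    cs.geomRep ha w (cs.geomRep ha w⁻¹ v) = v := by
  rw [← Module.End.mul_apply, ← map_mul, mul_inv_cancel, map_one, Module.End.one_apply]

theorem geomRep_injective (w : W) : Function.Injective (cs.geomRep ha w) :=
  Function.LeftInverse.injective (cs.geomRep_inv_apply ha w)

include cs ha in
-- If m_{st} were infinite, the coefficient of α_s in (st)^N(α_s) would be 2N + 1, so st would have
-- infinite order.
theorem apply_ne_zero_of_finite [Finite W] (s t : B) : M s t ≠ 0 := by
  intro h0
  have hst : s ≠ t := by rintro rfl; rw [M.diagonal] at h0; exact one_ne_zero h0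
  obtain ⟨N, hN, h⟩ := (isOfFinOrder_of_finite (cs.simple s * cs.simple t)).exists_pow_eq_one
  have h1 := simpleReflLin_mul_pow_simpleRoot ha s t N
  rw [← cs.geomRep_simple ha, ← cs.geomRep_simple ha, ← map_mul, ← map_pow, h, map_one,
    Module.End.one_apply, ha.mul_eq s t hst, h0, Nat.cast_zero, div_zero, Real.cos_zero, one_pow,
    mul_one, dihedralCoeff_four] at h1
  have h2 := congrFun h1 s
  simp only [Pi.sub_apply, Pi.smul_apply, simpleRoot_self, simpleRoot_of_ne hst, smul_eq_mul,
    mul_one, mul_zero, sub_zero] at h2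
  have : (0 : ℝ) < N := by exact_mod_cast hN
  linarith

/-- Induction on ℓ(w): with t a right descent, split off the alternating right factor in s and t. It
is shorter than m_{st}, since otherwise s would be a descent, so it sends α_s to a nonnegative
combination of α_s and α_t; the remaining shorter factor keeps both positive. -/
theorem geomRep_nonneg {w : W} {s : B} (h : ¬ cs.IsRightDescent w s) :
    0 ≤ cs.geomRep ha w (simpleRoot s) := by
  induction hn : cs.length w using Nat.strong_induction_on generalizing w s with
  | _ n ih =>
    rcases eq_or_ne w 1 with rfl | hw
    · rw [map_one]; exact simpleRoot_nonneg s
    obtain ⟨t, ht⟩ := cs.exists_rightDescent_of_ne_one hw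
    have hst : s ≠ t := by rintro rfl; exact h ht
    obtain ⟨k, v, rfl, hl, h1, h2⟩ := cs.exists_eq_mul_alternatingWord w s t
    have hk : k ≠ 0 := by
      rintro rfl
      rw [if_pos Even.zero] at h1
      simp only [alternatingWord, wordProd_nil, mul_one] at ht
      exact h1 ht
    have hs : ¬ cs.IsRightDescent v s ∧ ¬ cs.IsRightDescent v t := by
      have h2 := h2 hk
      by_cases he : Even k
      · simp only [he, if_true] at h1 h2; exact ⟨h2, h1⟩
      · simp only [he, if_false] at h1 h2; exact ⟨h1, h2⟩
    have hlt : M s t = 0 ∨ k < M s t := by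
      by_contra! hc
      exact h (cs.isRightDescent_mul_of_le hc.1 hc.2 hl)
    obtain ⟨x, y, hx, hy, e⟩ := foldr_alternatingWord_nonneg ha hst hlt
    rw [map_mul, Module.End.mul_apply, geomRep_wordProd, e, map_add, map_smul, map_smul]
    exact add_nonneg (smul_nonneg hx (ih _ (by omega) hs.1 rfl))
      (smul_nonneg hy (ih _ (by omega) hs.2 rfl))

theorem geomRep_nonpos {w : W} {s : B} (h : cs.IsRightDescent w s) :
    cs.geomRep ha w (simpleRoot s) ≤ 0 := by
  rw [isRightDescent_iff_not_isRightDescent_mul] at h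
  have := cs.geomRep_nonneg ha h
  rw [map_mul, Module.End.mul_apply, geomRep_simple, simpleReflLin_apply,
    ha.simpleRefl_simpleRoot_self, map_neg] at this
  exact neg_nonneg.1 this

theorem geomRep_simpleRoot_ne_zero (w : W) (s : B) : cs.geomRep ha w (simpleRoot s) ≠ 0 := by
  rw [Ne, ← map_zero (cs.geomRep ha w)]
  exact fun h => simpleRoot_ne_zero s (cs.geomRep_injective ha w h)

theorem geomRep_nonneg_iff {w : W} {s : B} :
    0 ≤ cs.geomRep ha w (simpleRoot s) ↔ ¬ cs.IsRightDescent w s :=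
  ⟨fun h hd => cs.geomRep_simpleRoot_ne_zero ha w s (le_antisymm (cs.geomRep_nonpos ha hd) h),
    cs.geomRep_nonneg ha⟩

theorem geomRep_faithful {w : W} (h : cs.geomRep ha w = 1) : w = 1 := by
  by_contra hw
  obtain ⟨t, ht⟩ := cs.exists_rightDescent_of_ne_one hw
  refine (cs.geomRep_nonneg_iff ha).1 ?_ ht
  rw [h]
  exact simpleRoot_nonneg t

/-! ### Dihedral subgroups -/

include ha

/-- Each new letter is an ascent, because the element before it sends the letter's simple root to a
nonnegative combination of y(α_s) and y(α_t). -/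
theorem length_mul_alternatingWord {y : W} {s t : B} (hst : s ≠ t)
    (hs : ¬ cs.IsRightDescent y s) (ht : ¬ cs.IsRightDescent y t) {k : ℕ}
    (hk : M s t = 0 ∨ k ≤ M s t) :
    cs.length (y * cs.wordProd (alternatingWord s t k)) = cs.length y + k := by
  induction k generalizing s t with
  | zero => simp [alternatingWord]
  | succ k ih =>
    have hk' : M t s = 0 ∨ k < M t s := by rw [M.symmetric t s]; omega
    rw [alternatingWord_succ, wordProd_concat, ← mul_assoc,
      cs.not_isRightDescent_iff.1, ih hst.symm ht hs (by omega), add_assoc]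
    rw [← cs.geomRep_nonneg_iff ha, map_mul, Module.End.mul_apply, geomRep_wordProd]
    obtain ⟨p, q, hp, hq, e⟩ := foldr_alternatingWord_nonneg ha hst.symm hk'
    rw [e, map_add, map_smul, map_smul]
    exact add_nonneg (smul_nonneg hp (cs.geomRep_nonneg ha ht))
      (smul_nonneg hq (cs.geomRep_nonneg ha hs))

theorem isReduced_braidWord {s t : B} (hst : s ≠ t) : cs.IsReduced (braidWord M s t) := by
  have := cs.length_mul_alternatingWord ha hst (cs.not_isRightDescent_one s)
    (cs.not_isRightDescent_one t) (k := M s t) (Or.inr le_rfl)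
  rw [one_mul, length_one, zero_add] at this
  rw [IsReduced, this, length_alternatingWord]

/-- If the alternating right factor were shorter than m_{st}, positivity would prevent s from being
a descent. -/
theorem exists_eq_mul_braidWord {w : W} {s t : B} (hst : s ≠ t)
    (hs : cs.IsRightDescent w s) (ht : cs.IsRightDescent w t) :
    ∃ v, w = v * cs.wordProd (braidWord M s t) ∧ cs.length w = cs.length v + M s t := by
  obtain ⟨k, v, rfl, hl, h1, h2⟩ := cs.exists_eq_mul_alternatingWord w s t
  have hk : k ≠ 0 := by
    rintro rfl
    rw [if_pos Even.zero] at h1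
    simp only [alternatingWord, wordProd_nil, mul_one] at ht
    exact h1 ht
  have hs' : ¬ cs.IsRightDescent v s ∧ ¬ cs.IsRightDescent v t := by
    have h2 := h2 hk
    by_cases he : Even k
    · simp only [he, if_true] at h1 h2; exact ⟨h2, h1⟩
    · simp only [he, if_false] at h1 h2; exact ⟨h1, h2⟩
  rcases Nat.lt_or_ge k (M s t) with hlt | hge
  · obtain ⟨x, y, hx, hy, e⟩ := foldr_alternatingWord_nonneg ha hst (Or.inr hlt)
    refine absurd hs ((cs.geomRep_nonneg_iff ha).1 ?_)
    rw [map_mul, Module.End.mul_apply, geomRep_wordProd, e, map_add, map_smul, map_smul]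
    exact add_nonneg (smul_nonneg hx (cs.geomRep_nonneg ha hs'.1))
      (smul_nonneg hy (cs.geomRep_nonneg ha hs'.2))
  · obtain ⟨X, hX, e⟩ := alternatingWord_suffix s t hge
    refine ⟨v * cs.wordProd X, by rw [e, wordProd_append, mul_assoc], ?_⟩
    have h3 := cs.length_mul_le v (cs.wordProd X)
    have h4 := cs.length_wordProd_le X
    have h5 := cs.length_mul_le (v * cs.wordProd X) (cs.wordProd (alternatingWord s t (M s t)))
    rw [mul_assoc, ← wordProd_append, ← e] at h5
    have h6 := cs.length_wordProd_alternatingWord_le s t (M s t)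
    omega

omit ha [Fintype B] in
theorem wordProd_braidWord_inv (s t : B) :
    (cs.wordProd (braidWord M s t))⁻¹ = cs.wordProd (braidWord M s t) := by
  have key : ∀ k, (alternatingWord s t k).reverse =
      if Even k then alternatingWord t s k else alternatingWord s t k := by
    intro k
    induction k generalizing s t with
    | zero => simp [alternatingWord]
    | succ k ih =>
      nth_rewrite 1 [alternatingWord_succ]
      rw [List.concat_eq_append, List.reverse_append, ih]
      by_cases h : Even k <;> simp [h, Nat.even_add_one, alternatingWord_succ']
  rw [← wordProd_reverse, braidWord, key]
  split_ifs
  · have := cs.wordProd_braidWord_eq s t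
    rw [braidWord, braidWord, M.symmetric t s] at this
    exact this.symm
  · rfl

theorem exists_eq_braidWord_mul {w : W} {s t : B} (hst : s ≠ t)
    (hs : cs.IsLeftDescent w s) (ht : cs.IsLeftDescent w t) :
    ∃ v, w = cs.wordProd (braidWord M s t) * v ∧ cs.length w = M s t + cs.length v := by
  rw [← isRightDescent_inv_iff] at hs ht
  obtain ⟨v, hv, hl⟩ := cs.exists_eq_mul_braidWord ha hst hs ht
  refine ⟨v⁻¹, ?_, ?_⟩
  · rw [← inv_inv w, hv, mul_inv_rev, wordProd_braidWord_inv]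
  · rw [length_inv] at hl ⊢; omega

end CoxeterSystem

/-! ### Matsumoto's theorem -/

namespace ArtinMonoid

variable {B : Type*} {M : CoxeterMatrix B}

/-- The generator of `B⁺` given by a simple reflection. -/
def gen (M : CoxeterMatrix B) (s : B) : ArtinMonoid M := ofWord M [s]

theorem ofWord_cons (s : B) (Q : List B) : ofWord M (s :: Q) = gen M s * ofWord M Q :=
  ofWord_append [s] Q

theorem ofWord_concat (Q : List B) (s : B) : ofWord M (Q ++ [s]) = ofWord M Q * gen M s :=
  ofWord_append Q [s]

theorem ofWord_braidWord (s t : B) :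
    ofWord M (CoxeterSystem.braidWord M s t) = ofWord M (CoxeterSystem.braidWord M t s) :=
  PresentedMonoid.mk_eq_mk_of_rel ⟨s, t, rfl, rfl⟩

theorem exists_braid_cons {s t : B} (h0 : M s t ≠ 0) :
    ∃ X Y : List B, ofWord M (s :: X) = ofWord M (CoxeterSystem.braidWord M s t) ∧
      ofWord M (t :: Y) = ofWord M (CoxeterSystem.braidWord M s t) := by
  obtain ⟨j, hj⟩ := Nat.exists_eq_succ_of_ne_zero h0
  have h1 : CoxeterSystem.braidWord M s t = (if Even j then t else s) ::
      CoxeterSystem.alternatingWord s t j := by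
    rw [CoxeterSystem.braidWord, hj, Nat.succ_eq_add_one, CoxeterSystem.alternatingWord_succ']
  have h2 : CoxeterSystem.braidWord M t s = (if Even j then s else t) ::
      CoxeterSystem.alternatingWord t s j := by
    rw [CoxeterSystem.braidWord, M.symmetric t s, hj, Nat.succ_eq_add_one,
      CoxeterSystem.alternatingWord_succ']
  by_cases h : Even j
  · rw [if_pos h] at h1 h2
    exact ⟨_, _, by rw [ofWord_braidWord, h2], by rw [h1]⟩
  · rw [if_neg h] at h1 h2
    exact ⟨_, _, by rw [h1], by rw [ofWord_braidWord, h2]⟩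

theorem le_iff {u w : ArtinMonoid M} : u ≤ w ↔ ∃ v, u * v = w :=
  ⟨fun ⟨v, hv, _⟩ => ⟨v, hv⟩, fun ⟨v, hv⟩ => ⟨v, hv, by rw [← length_mul, hv]⟩⟩

theorem le_mul_right (u v : ArtinMonoid M) : u ≤ u * v := le_iff.2 ⟨v, rfl⟩

theorem one_le (u : ArtinMonoid M) : 1 ≤ u := le_iff.2 ⟨u, one_mul u⟩

theorem mul_le_mul_left {u v : ArtinMonoid M} (h : u ≤ v) (x : ArtinMonoid M) :
    x * u ≤ x * v := by
  obtain ⟨y, rfl⟩ := le_iff.1 h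
  rw [← mul_assoc]
  exact le_mul_right _ _

theorem length_gen (s : B) : length (gen M s) = 1 := length_ofWord [s]

theorem exists_eq_gen_mul {u : ArtinMonoid M} (h : u ≠ 1) : ∃ s v, u = gen M s * v := by
  obtain ⟨Q, rfl⟩ := ofWord_surjective u
  cases Q with
  | nil => exact absurd ofWord_nil h
  | cons s Q => exact ⟨s, ofWord M Q, ofWord_cons s Q⟩

end ArtinMonoid

namespace CoxeterSystem

open ArtinMonoid

variable {B W : Type*} [Group W] {M : CoxeterMatrix B} (cs : CoxeterSystem M W)

/-- The projection of the positive Artin monoid onto the Coxeter group. -/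
def ofArtin : ArtinMonoid M →* W :=
  PresentedMonoid.lift cs.simple (by
    rintro _ _ ⟨s, t, rfl, rfl⟩
    simpa [FreeMonoid.lift_apply, wordProd] using cs.wordProd_braidWord_eq s t)

theorem ofArtin_ofWord (Q : List B) : cs.ofArtin (ofWord M Q) = cs.wordProd Q := by
  change FreeMonoid.lift cs.simple (FreeMonoid.ofList Q) = _
  simp [FreeMonoid.lift_apply, wordProd]

theorem wordProd_eq_of_ofWord_eq {Q R : List B} (h : ofWord M Q = ofWord M R) :
    cs.wordProd Q = cs.wordProd R := by
  rw [← ofArtin_ofWord, h, ofArtin_ofWord]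

theorem isReduced_of_ofWord_eq {Q R : List B} (h : ofWord M Q = ofWord M R)
    (hQ : cs.IsReduced Q) : cs.IsReduced R := by
  rw [IsReduced, ← cs.wordProd_eq_of_ofWord_eq h, hQ.eq, length_eq_of_ofWord_eq h]

theorem IsReduced.of_cons {cs : CoxeterSystem M W} {s : B} {Q : List B}
    (h : cs.IsReduced (s :: Q)) : cs.IsReduced Q := h.drop 1

theorem IsReduced.isLeftDescent_cons {cs : CoxeterSystem M W} {s : B} {Q : List B}
    (h : cs.IsReduced (s :: Q)) : cs.IsLeftDescent (cs.wordProd (s :: Q)) s := by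
  rw [IsLeftDescent, h.eq, wordProd_cons, cs.simple_mul_simple_cancel_left, h.of_cons.eq]
  simp

theorem isReduced_append {Q R : List B} :
    cs.IsReduced (Q ++ R) ↔ cs.IsReduced Q ∧ cs.IsReduced R ∧
      cs.length (cs.wordProd Q * cs.wordProd R) =
        cs.length (cs.wordProd Q) + cs.length (cs.wordProd R) := by
  constructor
  · intro h
    have h1 : cs.IsReduced Q := by simpa using h.take Q.length
    have h2 : cs.IsReduced R := by simpa using h.drop Q.length
    refine ⟨h1, h2, ?_⟩
    rw [← wordProd_append, h.eq, h1.eq, h2.eq, List.length_append]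
  · rintro ⟨h1, h2, h3⟩
    rw [IsReduced, wordProd_append, h3, h1.eq, h2.eq, List.length_append]

section

variable [Fintype B] {a : Matrix B B ℝ} (ha : IsGeneralizedCartanMatrix M a) [Finite W]
include ha

/-- If the words start with different letters s and t, both are left descents, so the element has a
reduced word starting with the braid word of s and t. This word can be rewritten to start with
either letter, and induction compares it with both given words. -/
theorem ofWord_eq_of_wordProd_eq {Q R : List B} (hQ : cs.IsReduced Q) (hR : cs.IsReduced R)
    (h : cs.wordProd Q = cs.wordProd R) : ofWord M Q = ofWord M R := by
  induction hn : Q.length using Nat.strong_induction_on generalizing Q R with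
  | _ n ih =>
    have hlen : Q.length = R.length := by rw [← hQ.eq, h, hR.eq]
    rcases Q with _ | ⟨s, Q⟩
    · rw [List.length_nil] at hlen
      rw [List.length_eq_zero_iff.1 hlen.symm]
    rcases R with _ | ⟨t, R⟩
    · simp at hlen
    have cancel : ∀ {s : B} {Q R : List B}, Q.length < n → cs.IsReduced (s :: Q) →
        cs.IsReduced (s :: R) → cs.wordProd (s :: Q) = cs.wordProd (s :: R) →
        ofWord M (s :: Q) = ofWord M (s :: R) := by
      intro s Q R hlt hQ hR h
      rw [wordProd_cons, wordProd_cons] at h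
      rw [ofWord_cons, ofWord_cons, ih _ hlt hQ.of_cons hR.of_cons (mul_left_cancel h) rfl]
    rw [List.length_cons] at hn
    rcases eq_or_ne s t with rfl | hst
    · exact cancel (by omega) hQ hR h
    have h0 := cs.apply_ne_zero_of_finite ha s t
    obtain ⟨v, hv, hl⟩ := cs.exists_eq_braidWord_mul ha hst hQ.isLeftDescent_cons
      (h ▸ hR.isLeftDescent_cons)
    obtain ⟨V, hV, rfl⟩ := cs.exists_isReduced v
    obtain ⟨X, Y, hX, hY⟩ := exists_braid_cons h0
    have hred : cs.IsReduced (braidWord M s t ++ V) := by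
      rw [IsReduced, wordProd_append, ← hv, hl, List.length_append, length_alternatingWord, hV.eq]
    have hX' : ofWord M (braidWord M s t ++ V) = ofWord M (s :: (X ++ V)) := by
      rw [ofWord_append, ← hX, ← ofWord_append]; rfl
    have hY' : ofWord M (braidWord M s t ++ V) = ofWord M (t :: (Y ++ V)) := by
      rw [ofWord_append, ← hY, ← ofWord_append]; rfl
    have e1 : ofWord M (s :: Q) = ofWord M (s :: (X ++ V)) :=
      cancel (by omega) hQ (cs.isReduced_of_ofWord_eq hX' hred)
        (by rw [← cs.wordProd_eq_of_ofWord_eq hX', hv, wordProd_append])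
    have e2 : ofWord M (t :: R) = ofWord M (t :: (Y ++ V)) :=
      cancel (by simp only [List.length_cons] at hlen; omega) hR
        (cs.isReduced_of_ofWord_eq hY' hred)
        (by rw [← cs.wordProd_eq_of_ofWord_eq hY', ← h, hv, wordProd_append])
    rw [e1, e2, ← hX', ← hY']

theorem toArtin_wordProd {Q : List B} (hQ : cs.IsReduced Q) :
    cs.toArtin (cs.wordProd Q) = ofWord M Q := by
  obtain ⟨h1, h2⟩ := Classical.choose_spec (cs.exists_isReduced (cs.wordProd Q))
  exact cs.ofWord_eq_of_wordProd_eq ha h1 hQ h2.symm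

theorem toArtin_mul {x y : W} (h : cs.length (x * y) = cs.length x + cs.length y) :
    cs.toArtin (x * y) = cs.toArtin x * cs.toArtin y := by
  obtain ⟨X, hX, rfl⟩ := cs.exists_isReduced x
  obtain ⟨Y, hY, rfl⟩ := cs.exists_isReduced y
  have := (cs.isReduced_append).2 ⟨hX, hY, h⟩
  rw [← wordProd_append, cs.toArtin_wordProd ha this, cs.toArtin_wordProd ha hX,
    cs.toArtin_wordProd ha hY, ofWord_append]

theorem toArtin_one : cs.toArtin 1 = 1 := by
  have := cs.toArtin_wordProd ha (Q := []) (by simp [IsReduced])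
  rwa [wordProd_nil, ofWord_nil] at this

theorem toArtin_simple (s : B) : cs.toArtin (cs.simple s) = gen M s := by
  have := cs.toArtin_wordProd ha (Q := [s]) (by simp [IsReduced])
  rwa [wordProd_singleton] at this

end

end CoxeterSystem

/-! ### Meets in Coxeter groups and in Artin monoids -/

/-- A graded set with a locally confluent step relation has, above each of its elements, a
largest element. -/
theorem exists_max_of_confluent {X : Type*} {le : X → X → Prop} (hrefl : ∀ x, le x x)
    (htrans : ∀ {x y z}, le x y → le y z → le x z) {S : Set X} {step : X → X → Prop} {r : X → ℕ}
    {N : ℕ} (hN : ∀ z ∈ S, r z ≤ N) (hr : ∀ {z z'}, step z z' → r z < r z')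
    (hle : ∀ {z z'}, step z z' → le z z')
    (hcover : ∀ z ∈ S, ∀ y ∈ S, le z y → z = y ∨ ∃ z' ∈ S, step z z' ∧ le z' y)
    (hconf : ∀ z ∈ S, ∀ z₁ ∈ S, ∀ z₂ ∈ S, step z z₁ → step z z₂ → ∃ u ∈ S, le z₁ u ∧ le z₂ u)
    (z : X) (hz : z ∈ S) : ∃ m ∈ S, le z m ∧ ∀ y ∈ S, le z y → le y m := by
  induction hn : N - r z using Nat.strong_induction_on generalizing z with
  | _ n ih =>
    have ih' : ∀ z' ∈ S, step z z' → ∃ m ∈ S, le z' m ∧ ∀ y ∈ S, le z' y → le y m := by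
      intro z' hz' hs
      have h1 := hr hs
      have h2 := hN z' hz'
      exact ih _ (by omega) z' hz' rfl
    by_cases hex : ∃ z₁ ∈ S, step z z₁
    · obtain ⟨z₁, hz₁, hs₁⟩ := hex
      obtain ⟨m, hm, hzm, hmax⟩ := ih' z₁ hz₁ hs₁
      refine ⟨m, hm, htrans (hle hs₁) hzm, fun y hy hzy => ?_⟩
      rcases hcover z hz y hy hzy with rfl | ⟨z₂, hz₂, hs₂, hle₂⟩
      · exact htrans (hle hs₁) hzm
      · obtain ⟨m', hm', hzm', hmax'⟩ := ih' z₂ hz₂ hs₂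
        -- As in Newman's lemma: y ≤ m', while z₁ ≤ u ≤ m' forces m' ≤ m.
        obtain ⟨u, hu, h1, h2⟩ := hconf z hz z₁ hz₁ z₂ hz₂ hs₁ hs₂
        exact htrans (hmax' y hy hle₂) (hmax m' hm' (htrans h1 (hmax' u hu h2)))
    · refine ⟨z, hz, hrefl z, fun y hy hzy => ?_⟩
      rcases hcover z hz y hy hzy with rfl | ⟨z₂, hz₂, hs₂, _⟩
      · exact hrefl z
      · exact absurd ⟨z₂, hz₂, hs₂⟩ hex

namespace CoxeterSystem

open ArtinMonoid

variable {B W : Type*} [Group W] {M : CoxeterMatrix B} (cs : CoxeterSystem M W)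

/-- The right weak order on a Coxeter group. -/
def WeakLE (z w : W) : Prop := cs.length z + cs.length (z⁻¹ * w) = cs.length w

theorem length_le_add (z w : W) : cs.length w ≤ cs.length z + cs.length (z⁻¹ * w) := by
  simpa using cs.length_mul_le z (z⁻¹ * w)

theorem weakLE_refl (w : W) : cs.WeakLE w w := by simp [WeakLE]

variable {cs} in
theorem WeakLE.length_add {x y z : W} (h1 : cs.WeakLE x y) (h2 : cs.WeakLE y z) :
    cs.length (x⁻¹ * z) = cs.length (x⁻¹ * y) + cs.length (y⁻¹ * z) := by
  have h3 := cs.length_le_add x z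
  have h4 := cs.length_mul_le (x⁻¹ * y) (y⁻¹ * z)
  rw [show x⁻¹ * y * (y⁻¹ * z) = x⁻¹ * z by group] at h4
  simp only [WeakLE] at h1 h2
  omega

variable {cs} in
theorem WeakLE.trans {x y z : W} (h1 : cs.WeakLE x y) (h2 : cs.WeakLE y z) : cs.WeakLE x z := by
  have := h1.length_add h2
  simp only [WeakLE] at h1 h2 ⊢
  omega

variable {cs} in
theorem WeakLE.antisymm {x y : W} (h1 : cs.WeakLE x y) (h2 : cs.WeakLE y x) : x = y := by
  simp only [WeakLE] at h1 h2
  have : cs.length (x⁻¹ * y) = 0 := by omega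
  rw [length_eq_zero_iff] at this
  exact (inv_mul_eq_one.1 this)

variable {cs} in
theorem WeakLE.length_mul {x z y : W} (h1 : cs.WeakLE z y)
    (h2 : cs.length (x * y) = cs.length x + cs.length y) :
    cs.length (x * z) = cs.length x + cs.length z := by
  have h3 := cs.length_mul_le x z
  have h4 := cs.length_mul_le (x * z) (z⁻¹ * y)
  rw [show x * z * (z⁻¹ * y) = x * y by group] at h4
  simp only [WeakLE] at h1
  omega

theorem weakLE_mul_left_iff {y z v : W} (hz : cs.length (y * z) = cs.length y + cs.length z)
    (hv : cs.length (y * v) = cs.length y + cs.length v) :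
    cs.WeakLE (y * z) (y * v) ↔ cs.WeakLE z v := by
  rw [WeakLE, WeakLE, show (y * z)⁻¹ * (y * v) = z⁻¹ * v by group]
  omega

/-! ### The largest left factor of w with a reduced product with x -/

section

variable [Fintype B] {a : Matrix B B ℝ} (ha : IsGeneralizedCartanMatrix M a) [Finite W]
include ha

/-- The admissible elements are closed under joins of two covers: if zs and zt are admissible, so is
z times the braid element of s and t, which is a left factor of z⁻¹w because s and t are both left
descents of it. -/
theorem exists_garsideMax (x w : W) : ∃ v, cs.WeakLE v w ∧
    cs.length (x * v) = cs.length x + cs.length v ∧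
    ∀ y, cs.WeakLE y w → cs.length (x * y) = cs.length x + cs.length y → cs.WeakLE y v := by
  have key := exists_max_of_confluent (le := cs.WeakLE) cs.weakLE_refl WeakLE.trans
    (S := {z | cs.WeakLE z w ∧ cs.length (x * z) = cs.length x + cs.length z})
    (step := fun z z' => (∃ s, z' = z * cs.simple s) ∧ cs.length z' = cs.length z + 1)
    (r := cs.length) (N := cs.length w)
    (by rintro z ⟨h, -⟩; rw [WeakLE] at h; omega)
    (by rintro z z' ⟨-, h⟩; omega)
    (by
      rintro z _ ⟨⟨s, rfl⟩, h⟩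
      rw [WeakLE, inv_mul_cancel_left, length_simple, h])
    (by
      rintro z ⟨hz1, hz2⟩ y ⟨hy1, hy2⟩ hzy
      by_cases hne : z⁻¹ * y = 1
      · exact Or.inl (inv_mul_eq_one.1 hne)
      · right
        obtain ⟨s, hs⟩ := cs.exists_leftDescent_of_ne_one hne
        rw [isLeftDescent_iff] at hs
        have h1 := cs.length_le_add (z * cs.simple s) y
        rw [show (z * cs.simple s)⁻¹ * y = cs.simple s * (z⁻¹ * y) by simp [mul_assoc]] at h1
        have h2 := cs.length_mul_le z (cs.simple s)
        rw [length_simple] at h2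
        have hzy' := hzy
        rw [WeakLE] at hzy'
        have h3 : cs.WeakLE (z * cs.simple s) y := by
          rw [WeakLE, show (z * cs.simple s)⁻¹ * y = cs.simple s * (z⁻¹ * y) by simp [mul_assoc]]
          omega
        exact ⟨z * cs.simple s, ⟨h3.trans hy1, h3.length_mul hy2⟩, ⟨⟨s, rfl⟩, by omega⟩, h3⟩)
    (by
      rintro z ⟨hz1, hz2⟩ _ ⟨h11, h12⟩ _ ⟨h21, h22⟩ ⟨⟨s, rfl⟩, hs⟩ ⟨⟨t, rfl⟩, ht⟩
      rcases eq_or_ne s t with rfl | hst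
      · exact ⟨_, ⟨h11, h12⟩, cs.weakLE_refl _, cs.weakLE_refl _⟩
      have desc : ∀ s, cs.length (z * cs.simple s) = cs.length z + 1 →
          cs.WeakLE (z * cs.simple s) w → cs.IsLeftDescent (z⁻¹ * w) s := by
        intro s hs hw
        rw [WeakLE] at hw hz1
        rw [show (z * cs.simple s)⁻¹ * w = cs.simple s * (z⁻¹ * w) by simp [mul_assoc]] at hw
        rw [isLeftDescent_iff]
        omega
      obtain ⟨v, hv, hl⟩ := cs.exists_eq_braidWord_mul ha hst (desc s hs h11) (desc t ht h21)
      have hzΔ : cs.length (z * cs.wordProd (braidWord M s t)) = cs.length z + M s t :=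
        cs.length_mul_alternatingWord ha hst (cs.not_isRightDescent_iff.2 hs)
          (cs.not_isRightDescent_iff.2 ht) (Or.inr le_rfl)
      have hxzΔ : cs.length (x * z * cs.wordProd (braidWord M s t)) =
          cs.length (x * z) + M s t :=
        cs.length_mul_alternatingWord ha hst
          (cs.not_isRightDescent_iff.2 (by rw [mul_assoc]; omega))
          (cs.not_isRightDescent_iff.2 (by rw [mul_assoc]; omega)) (Or.inr le_rfl)
      have below : ∀ (r : B) (X : List B), ofWord M (r :: X) = ofWord M (braidWord M s t) →
          cs.length (z * cs.simple r) = cs.length z + 1 →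
          cs.WeakLE (z * cs.simple r) (z * cs.wordProd (braidWord M s t)) := by
        intro r X hX hr
        have h1 := cs.wordProd_eq_of_ofWord_eq hX
        have h2 := length_eq_of_ofWord_eq hX
        rw [length_alternatingWord, List.length_cons] at h2
        have h3 := cs.length_le_add (z * cs.simple r) (z * cs.wordProd (braidWord M s t))
        have h4 : (z * cs.simple r)⁻¹ * (z * cs.wordProd (braidWord M s t)) = cs.wordProd X := by
          rw [← h1, wordProd_cons]; simp [mul_assoc]
        have h5 := cs.length_wordProd_le X
        rw [WeakLE]
        rw [h4] at h3 ⊢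
        omega
      obtain ⟨X, Y, hX, hY⟩ := exists_braid_cons (cs.apply_ne_zero_of_finite ha s t)
      refine ⟨z * cs.wordProd (braidWord M s t), ⟨?_, ?_⟩, below s X hX hs, below t Y hY ht⟩
      · rw [WeakLE] at hz1 ⊢
        rw [show (z * cs.wordProd (braidWord M s t))⁻¹ * w =
          (cs.wordProd (braidWord M s t))⁻¹ * (z⁻¹ * w) by group]
        rw [hv, inv_mul_cancel_left, hzΔ]
        omega
      · rw [← mul_assoc]; omega)
  obtain ⟨v, ⟨hv1, hv2⟩, -, hv3⟩ := key 1 ⟨by simp [WeakLE], by simp⟩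
  exact ⟨v, hv1, hv2, fun y hy1 hy2 => hv3 y ⟨hy1, hy2⟩ (by simp [WeakLE])⟩

end

variable [Fintype B] {a : Matrix B B ℝ} (ha : IsGeneralizedCartanMatrix M a) [Finite W]

/-- The largest `v ≤ w` such that the product of `x` and `v` is reduced. -/
def garsideMax (x w : W) : W := Classical.choose (cs.exists_garsideMax ha x w)

theorem garsideMax_le (x w : W) : cs.WeakLE (cs.garsideMax ha x w) w :=
  (Classical.choose_spec (cs.exists_garsideMax ha x w)).1

theorem length_mul_garsideMax (x w : W) : cs.length (x * cs.garsideMax ha x w) =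
    cs.length x + cs.length (cs.garsideMax ha x w) :=
  (Classical.choose_spec (cs.exists_garsideMax ha x w)).2.1

theorem le_garsideMax {x w y : W} (h1 : cs.WeakLE y w)
    (h2 : cs.length (x * y) = cs.length x + cs.length y) : cs.WeakLE y (cs.garsideMax ha x w) :=
  (Classical.choose_spec (cs.exists_garsideMax ha x w)).2.2 y h1 h2

theorem garsideMax_one (w : W) : cs.garsideMax ha 1 w = w :=
  (cs.garsideMax_le ha 1 w).antisymm (cs.le_garsideMax ha (cs.weakLE_refl w) (by simp))

/-- The left side has y as a left factor, by maximality; cancelling y turns its condition into the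
one that defines the maximum for xy. This is what makes `garsideAct` compatible with products. -/
theorem garsideMax_mul {x y : W} (w : W) (h : cs.length (x * y) = cs.length x + cs.length y) :
    cs.garsideMax ha x (y * cs.garsideMax ha y w) = y * cs.garsideMax ha (x * y) w := by
  set v := cs.garsideMax ha y w with hv
  set v' := cs.garsideMax ha x (y * v) with hv'
  set u := cs.garsideMax ha (x * y) w with hu
  have hyv := cs.length_mul_garsideMax ha y w
  rw [← hv] at hyv
  have hxyu := cs.length_mul_garsideMax ha (x * y) w
  rw [← hu] at hxyu
  have hyu : cs.length (y * u) = cs.length y + cs.length u := by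
    have h1 := cs.length_mul_le y u
    have h2 := cs.length_mul_le x (y * u)
    rw [← mul_assoc] at h2
    omega
  have huv : cs.WeakLE u v := cs.le_garsideMax ha (cs.garsideMax_le ha _ w) hyu
  have h1 : cs.WeakLE (y * u) v' := cs.le_garsideMax ha ((cs.weakLE_mul_left_iff hyu hyv).2 huv)
    (by rw [← mul_assoc]; omega)
  have hyv' : cs.WeakLE y v' := cs.le_garsideMax ha
    (by rw [WeakLE, inv_mul_cancel_left, hyv]) h
  obtain ⟨z, hz⟩ : ∃ z, v' = y * z := ⟨y⁻¹ * v', by group⟩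
  have hyz : cs.length (y * z) = cs.length y + cs.length z := by
    rw [WeakLE, hz, inv_mul_cancel_left] at hyv'
    exact hyv'.symm
  have hzv : cs.WeakLE z v := by
    rw [← cs.weakLE_mul_left_iff hyz hyv, ← hz]
    exact cs.garsideMax_le ha _ _
  have hxv' := cs.length_mul_garsideMax ha x (y * v)
  rw [← hv', hz, ← mul_assoc] at hxv'
  have hzu : cs.WeakLE z u := cs.le_garsideMax ha (hzv.trans (cs.garsideMax_le ha _ w)) (by omega)
  refine WeakLE.antisymm ?_ h1
  rw [hz]
  exact (cs.weakLE_mul_left_iff hyz hyu).2 hzu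

/-- Left multiplication by the lift of `x`, on elements of `B⁺` split as the product of the lift
of an element of `W` and a remainder; the first factor is enlarged as far as possible. -/
def garsideAct (x : W) (p : W × ArtinMonoid M) : W × ArtinMonoid M :=
  (x * cs.garsideMax ha x p.1, cs.toArtin ((cs.garsideMax ha x p.1)⁻¹ * p.1) * p.2)

theorem garsideAct_one (p : W × ArtinMonoid M) : cs.garsideAct ha 1 p = p := by
  rw [garsideAct, garsideMax_one, one_mul, inv_mul_cancel, cs.toArtin_one ha, one_mul]

/-- Reduced products suffice: both sides of a braid relation are reduced words for one element of W,
so the relation holds for the maps `garsideAct`. -/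
theorem garsideAct_garsideAct {x y : W} (h : cs.length (x * y) = cs.length x + cs.length y)
    (p : W × ArtinMonoid M) :
    cs.garsideAct ha x (cs.garsideAct ha y p) = cs.garsideAct ha (x * y) p := by
  simp only [garsideAct, cs.garsideMax_mul ha _ h]
  have hu : cs.WeakLE (cs.garsideMax ha (x * y) p.1) (cs.garsideMax ha y p.1) := by
    refine cs.le_garsideMax ha (cs.garsideMax_le ha _ _) ?_
    have h1 := cs.length_mul_le y (cs.garsideMax ha (x * y) p.1)
    have h2 := cs.length_mul_le x (y * cs.garsideMax ha (x * y) p.1)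
    have h3 := cs.length_mul_garsideMax ha (x * y) p.1
    rw [← mul_assoc] at h2
    omega
  have h4 := hu.length_add (cs.garsideMax_le ha y p.1)
  ext1
  · simp only [mul_assoc]
  · simp only
    rw [← mul_assoc, show (y * cs.garsideMax ha (x * y) p.1)⁻¹ * (y * cs.garsideMax ha y p.1) =
      (cs.garsideMax ha (x * y) p.1)⁻¹ * cs.garsideMax ha y p.1 by group,
      ← cs.toArtin_mul ha]
    · congr 2; group
    · rw [← h4]; congr 1; group

/-- The map `garsideAct` as an element of the monoid of self-maps. -/
def garsideEnd (x : W) : Function.End (W × ArtinMonoid M) := cs.garsideAct ha x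

theorem prod_garsideEnd {Q : List B} (hQ : cs.IsReduced Q) :
    (Q.map fun s => cs.garsideEnd ha (cs.simple s)).prod = cs.garsideEnd ha (cs.wordProd Q) := by
  induction Q with
  | nil =>
    rw [wordProd_nil, List.map_nil, List.prod_nil]
    exact funext fun p => (cs.garsideAct_one ha p).symm
  | cons s Q ih =>
    rw [List.map_cons, List.prod_cons, ih hQ.of_cons, wordProd_cons]
    refine funext fun p => cs.garsideAct_garsideAct ha ?_ p
    have := hQ.eq
    rw [wordProd_cons] at this
    rw [this, length_simple, hQ.of_cons.eq, List.length_cons, add_comm]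

/-- The action of `B⁺` on pairs of an element of `W` and a remainder. -/
def garsideHom : ArtinMonoid M →* Function.End (W × ArtinMonoid M) :=
  PresentedMonoid.lift (fun s => cs.garsideEnd ha (cs.simple s)) (by
    rintro _ _ ⟨s, t, rfl, rfl⟩
    rcases eq_or_ne s t with rfl | hst
    · rfl
    simp only [FreeMonoid.lift_apply, FreeMonoid.toList_ofList]
    rw [prod_garsideEnd cs ha (cs.isReduced_braidWord ha hst),
      prod_garsideEnd cs ha (cs.isReduced_braidWord ha hst.symm), wordProd_braidWord_eq])

/-- The pair of the largest element of `W` below `b ∈ B⁺` and the remainder. -/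
def garsideSplit (b : ArtinMonoid M) : W × ArtinMonoid M := cs.garsideHom ha b (1, 1)

theorem garsideSplit_gen_mul (s : B) (b : ArtinMonoid M) :
    cs.garsideSplit ha (gen M s * b) = cs.garsideAct ha (cs.simple s) (cs.garsideSplit ha b) := by
  rw [garsideSplit, map_mul]
  rfl

theorem toArtin_mul_garsideMax (x w : W) :
    cs.toArtin (cs.garsideMax ha x w) * cs.toArtin ((cs.garsideMax ha x w)⁻¹ * w) =
      cs.toArtin w := by
  rw [← cs.toArtin_mul ha]
  · congr 1; group
  · rw [mul_inv_cancel_left, (cs.garsideMax_le ha x w)]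

theorem garsideSplit_mul (b : ArtinMonoid M) :
    cs.toArtin (cs.garsideSplit ha b).1 * (cs.garsideSplit ha b).2 = b := by
  obtain ⟨Q, rfl⟩ := ofWord_surjective b
  induction Q with
  | nil =>
    rw [ofWord_nil, garsideSplit, map_one]
    change cs.toArtin 1 * 1 = 1
    rw [cs.toArtin_one ha, one_mul]
  | cons s Q ih =>
    rw [ofWord_cons, garsideSplit_gen_mul, garsideAct,
      cs.toArtin_mul ha (cs.length_mul_garsideMax ha _ _), cs.toArtin_simple ha, mul_assoc,
      ← mul_assoc (cs.toArtin _) (cs.toArtin _), toArtin_mul_garsideMax, ih]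

/-! ### Left cancellation and meets in the Artin monoid -/

include cs ha

/-- The pair of s·b remembers b: its first component determines the maximal factor moved across s,
and multiplying this factor back onto the second component gives b. -/
theorem gen_mul_left_cancel {s : B} {b b' : ArtinMonoid M} (h : gen M s * b = gen M s * b') :
    b = b' := by
  have h1 := congrArg (cs.garsideSplit ha) h
  rw [garsideSplit_gen_mul, garsideSplit_gen_mul] at h1
  simp only [garsideAct, Prod.mk.injEq, mul_right_inj] at h1
  obtain ⟨h2, h3⟩ := h1
  rw [← cs.garsideSplit_mul ha b, ← cs.garsideSplit_mul ha b',
    ← cs.toArtin_mul_garsideMax ha (cs.simple s) (cs.garsideSplit ha b).1, mul_assoc, h3, h2,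
    ← mul_assoc, toArtin_mul_garsideMax]

theorem artin_mul_left_cancel {x b b' : ArtinMonoid M} (h : x * b = x * b') : b = b' := by
  obtain ⟨Q, rfl⟩ := ofWord_surjective x
  induction Q with
  | nil => rwa [ofWord_nil, one_mul, one_mul] at h
  | cons s Q ih =>
    rw [ofWord_cons, mul_assoc, mul_assoc] at h
    exact ih (cs.gen_mul_left_cancel ha h)

theorem artin_le_of_mul_le_mul {x b b' : ArtinMonoid M} (h : x * b ≤ x * b') : b ≤ b' := by
  obtain ⟨y, hy⟩ := le_iff.1 h
  rw [mul_assoc] at hy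
  exact le_iff.2 ⟨y, cs.artin_mul_left_cancel ha hy⟩

theorem isLeftDescent_garsideSplit {s : B} {b : ArtinMonoid M} (h : gen M s ≤ b) :
    cs.IsLeftDescent (cs.garsideSplit ha b).1 s := by
  obtain ⟨b', rfl⟩ := le_iff.1 h
  rw [garsideSplit_gen_mul, garsideAct, IsLeftDescent, cs.simple_mul_simple_cancel_left,
    length_mul_garsideMax, length_simple]
  omega

/-- Both s and t are left descents of the W-part of b, so the braid element already divides that
part. -/
theorem braidWord_le {s t : B} {b : ArtinMonoid M} (hst : s ≠ t) (hs : gen M s ≤ b)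
    (ht : gen M t ≤ b) : ofWord M (braidWord M s t) ≤ b := by
  obtain ⟨v, hv, hl⟩ := cs.exists_eq_braidWord_mul ha hst (cs.isLeftDescent_garsideSplit ha hs)
    (cs.isLeftDescent_garsideSplit ha ht)
  have hred := cs.isReduced_braidWord ha hst
  rw [← cs.garsideSplit_mul ha b, hv, cs.toArtin_mul ha, cs.toArtin_wordProd ha hred, mul_assoc]
  · exact le_mul_right _ _
  · rw [← hv, hl, hred.eq, length_alternatingWord]

/-- Common lower bounds grow by single generators, and by `braidWord_le` two such steps are
completed by the braid element; cancellation moves the argument above any z. -/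
theorem exists_isGLB (x y : ArtinMonoid M) : ∃ g, IsGLB {x, y} g := by
  obtain ⟨g, ⟨hgx, hgy⟩, -, hg⟩ := exists_max_of_confluent (le := fun u v : ArtinMonoid M => u ≤ v)
    (fun _ => le_rfl) le_trans (S := {z | z ≤ x ∧ z ≤ y}) (step := fun z z' => ∃ s, z' = z * gen M s)
    (r := ArtinMonoid.length) (N := ArtinMonoid.length x)
    (by
      rintro z ⟨h, -⟩
      obtain ⟨v, rfl⟩ := le_iff.1 h
      rw [ArtinMonoid.length_mul]; omega)
    (by rintro z _ ⟨s, rfl⟩; rw [ArtinMonoid.length_mul, length_gen]; omega)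
    (by rintro z _ ⟨s, rfl⟩; exact le_mul_right _ _)
    (by
      rintro z - y' ⟨h1, h2⟩ h
      obtain ⟨v, rfl⟩ := le_iff.1 h
      by_cases hv : v = 1
      · left; rw [hv, mul_one]
      · right
        obtain ⟨s, v, rfl⟩ := exists_eq_gen_mul hv
        have : z * gen M s ≤ z * (gen M s * v) := mul_le_mul_left (le_mul_right _ _) z
        exact ⟨z * gen M s, ⟨this.trans h1, this.trans h2⟩, ⟨s, rfl⟩, this⟩)
    (by
      rintro z ⟨hzx, hzy⟩ _ ⟨h1x, h1y⟩ _ ⟨h2x, h2y⟩ ⟨s, rfl⟩ ⟨t, rfl⟩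
      rcases eq_or_ne s t with rfl | hst
      · exact ⟨_, ⟨h1x, h1y⟩, le_rfl, le_rfl⟩
      have low : ∀ {x}, z ≤ x → z * gen M s ≤ x → z * gen M t ≤ x →
          z * ofWord M (braidWord M s t) ≤ x := by
        intro x hx h1 h2
        obtain ⟨v, rfl⟩ := le_iff.1 hx
        exact mul_le_mul_left (cs.braidWord_le ha hst (cs.artin_le_of_mul_le_mul ha h1)
          (cs.artin_le_of_mul_le_mul ha h2)) z
      obtain ⟨X, Y, hX, hY⟩ := exists_braid_cons (cs.apply_ne_zero_of_finite ha s t)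
      refine ⟨z * ofWord M (braidWord M s t), ⟨low hzx h1x h2x, low hzy h1y h2y⟩,
        mul_le_mul_left ?_ z, mul_le_mul_left ?_ z⟩
      · rw [← hX, ofWord_cons]; exact le_mul_right _ _
      · rw [← hY, ofWord_cons]; exact le_mul_right _ _)
    1 ⟨one_le x, one_le y⟩
  refine ⟨g, ?_, ?_⟩
  · rintro _ (rfl | rfl)
    · exact hgx
    · exact hgy
  · intro z hz
    exact hg z ⟨hz (by simp), hz (by simp)⟩ (one_le z)

end CoxeterSystem

/-! ### Colored positive roots -/

theorem eq_zero_of_nonneg_of_nonpos {B : Type*} {v : B → ℝ} (h : 0 ≤ v) (h' : v ≤ 0) : v = 0 :=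
  le_antisymm h' h

section Colored

variable {B : Type*} [Fintype B] {M : CoxeterMatrix B}

/-- The positive roots. -/
def IsPosRoot (a : Matrix B B ℝ) (β : B → ℝ) : Prop := β ∈ roots a ∧ 0 ≤ β

/-- The action of a word on colored roots. -/
def coloredAct (a : Matrix B B ℝ) (Q : List B) (b : (B → ℝ) × ℕ) : (B → ℝ) × ℕ :=
  Q.foldr (coloredRefl a) b

variable {a : Matrix B B ℝ}

theorem isPosRoot_simpleRoot (s : B) : IsPosRoot a (simpleRoot s) :=
  ⟨⟨[], s, rfl⟩, simpleRoot_nonneg s⟩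

theorem simpleRefl_mem_roots {β : B → ℝ} (h : β ∈ roots a) (s : B) : simpleRefl a s β ∈ roots a := by
  obtain ⟨Q, t, rfl⟩ := h
  exact ⟨s :: Q, t, rfl⟩

theorem coloredAct_cons (s : B) (Q : List B) (b : (B → ℝ) × ℕ) :
    coloredAct a (s :: Q) b = coloredRefl a s (coloredAct a Q b) := rfl

theorem coloredAct_nil (b : (B → ℝ) × ℕ) : coloredAct a [] b = b := rfl

theorem coloredAct_append (Q R : List B) (b : (B → ℝ) × ℕ) :
    coloredAct a (Q ++ R) b = coloredAct a Q (coloredAct a R b) :=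
  List.foldr_append

theorem coloredRefl_of_eq (s : B) (k : ℕ) :
    coloredRefl a s (simpleRoot s, k) = (simpleRoot s, k + 1) := by
  simp [coloredRefl]

theorem coloredRefl_of_ne {s : B} {b : (B → ℝ) × ℕ} (h : b.1 ≠ simpleRoot s) :
    coloredRefl a s b = (simpleRefl a s b.1, b.2) := by
  simp [coloredRefl, h]

theorem coloredInvSeq_append (Q R : List B) : coloredInvSeq a (Q ++ R) =
    coloredInvSeq a Q ++ (coloredInvSeq a R).map (coloredAct a Q) := by
  induction Q with
  | nil => exact (List.map_id _).symm
  | cons s Q ih =>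
    rw [List.cons_append, coloredInvSeq, ih, coloredInvSeq, List.map_append, List.map_map]
    rfl

theorem coloredInvSeq_singleton (s : B) : coloredInvSeq a [s] = [(simpleRoot s, 0)] := rfl

theorem mem_coloredInvSeq_append {Q R : List B} {b : (B → ℝ) × ℕ} :
    b ∈ coloredInvSeq a (Q ++ R) ↔
      b ∈ coloredInvSeq a Q ∨ ∃ b' ∈ coloredInvSeq a R, coloredAct a Q b' = b := by
  rw [coloredInvSeq_append, List.mem_append, List.mem_map]

theorem mem_coloredInvSeq_cons {s : B} {Q : List B} {b : (B → ℝ) × ℕ} :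
    b ∈ coloredInvSeq a (s :: Q) ↔
      b = (simpleRoot s, 0) ∨ ∃ b' ∈ coloredInvSeq a Q, coloredRefl a s b' = b := by
  rw [coloredInvSeq, List.mem_cons, List.mem_map]

theorem mem_coloredInvSeq_concat {Q : List B} {x : B} {b : (B → ℝ) × ℕ} :
    b ∈ coloredInvSeq a (Q ++ [x]) ↔
      b ∈ coloredInvSeq a Q ∨ b = coloredAct a Q (simpleRoot x, 0) := by
  rw [mem_coloredInvSeq_append, coloredInvSeq_singleton]
  simp [eq_comm]

theorem length_coloredInvSeq (Q : List B) : (coloredInvSeq a Q).length = Q.length := by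
  induction Q with
  | nil => rfl
  | cons s Q ih => rw [coloredInvSeq, List.length_cons, List.length_map, ih, List.length_cons]

theorem coloredRefl_add (s : B) (b : (B → ℝ) × ℕ) (j : ℕ) : coloredRefl a s (b.1, b.2 + j) =
    ((coloredRefl a s b).1, (coloredRefl a s b).2 + j) := by
  simp only [coloredRefl]
  split_ifs
  · simp only [Prod.mk.injEq, true_and]; omega
  · rfl

theorem coloredAct_add (Q : List B) (b : (B → ℝ) × ℕ) (j : ℕ) : coloredAct a Q (b.1, b.2 + j) =
    ((coloredAct a Q b).1, (coloredAct a Q b).2 + j) := by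
  induction Q with
  | nil => rfl
  | cons s Q ih => rw [coloredAct_cons, ih, coloredRefl_add, coloredAct_cons]

theorem color_le_coloredRefl (s : B) (b : (B → ℝ) × ℕ) : b.2 ≤ (coloredRefl a s b).2 := by
  simp only [coloredRefl]
  split_ifs <;> simp

theorem color_le_coloredAct (Q : List B) (b : (B → ℝ) × ℕ) : b.2 ≤ (coloredAct a Q b).2 := by
  induction Q with
  | nil => exact le_rfl
  | cons s Q ih => exact ih.trans (color_le_coloredRefl s _)

/-- Colors rise by one at a time and only when the current root is α_s; that letter s creates the
same root with color 0, and the lower colors follow by induction along the word. -/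
theorem mem_coloredInvSeq_of_color_succ {Q : List B} {x : B} {β : B → ℝ} {k : ℕ}
    (h : coloredAct a Q (simpleRoot x, 0) = (β, k + 1)) : (β, k) ∈ coloredInvSeq a Q := by
  induction Q generalizing β k with
  | nil => exact absurd (congrArg Prod.snd h) (by simp [coloredAct_nil])
  | cons s Q ih =>
    rw [coloredAct_cons] at h
    rw [mem_coloredInvSeq_cons]
    rcases hb : coloredAct a Q (simpleRoot x, 0) with ⟨β', k'⟩
    rw [hb] at h
    by_cases hs : β' = simpleRoot s
    · subst hs
      rw [coloredRefl_of_eq, Prod.mk.injEq, Nat.add_right_cancel_iff] at h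
      obtain ⟨rfl, rfl⟩ := h
      rcases k' with _ | k
      · exact Or.inl rfl
      · exact Or.inr ⟨_, ih hb, coloredRefl_of_eq s k⟩
    · rw [coloredRefl_of_ne hs, Prod.mk.injEq] at h
      obtain ⟨rfl, rfl⟩ := h
      exact Or.inr ⟨_, ih hb, coloredRefl_of_ne hs⟩

/-- Colors never decrease, so an unchanged color means that no letter met its own simple root and
every step was linear. -/
theorem coloredAct_fst_of_color_eq {Q : List B} {b : (B → ℝ) × ℕ}
    (h : (coloredAct a Q b).2 = b.2) : (coloredAct a Q b).1 = Q.foldr (simpleRefl a) b.1 := by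
  induction Q with
  | nil => rfl
  | cons s Q ih =>
    rw [coloredAct_cons] at h ⊢
    have h1 := color_le_coloredAct (a := a) Q b
    by_cases hs : (coloredAct a Q b).1 = simpleRoot s
    · simp only [coloredRefl, hs, if_true] at h
      omega
    · rw [coloredRefl_of_ne hs] at h ⊢
      rw [List.foldr_cons, ih h]

section Cartan

variable (ha : IsGeneralizedCartanMatrix M a)
include ha

theorem coloredAct_fst (Q : List B) (b : (B → ℝ) × ℕ) :
    (coloredAct a Q b).1 = Q.foldr (simpleRefl a) b.1 ∨
      (coloredAct a Q b).1 = -Q.foldr (simpleRefl a) b.1 := by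
  induction Q with
  | nil => exact Or.inl rfl
  | cons s Q ih =>
    rw [coloredAct_cons, List.foldr_cons]
    have hneg : ∀ v, simpleRefl a s (-v) = -simpleRefl a s v := map_neg (simpleReflLin a s)
    by_cases hs : (coloredAct a Q b).1 = simpleRoot s
    · rw [show coloredRefl a s (coloredAct a Q b) = (simpleRoot s, (coloredAct a Q b).2 + 1) by
        simp [coloredRefl, hs]]
      rw [hs] at ih
      rcases ih with ih | ih
      · right; rw [← ih, ha.simpleRefl_simpleRoot_self, neg_neg]
      · left
        rw [← neg_eq_iff_eq_neg] at ih
        rw [← ih, hneg, ha.simpleRefl_simpleRoot_self, neg_neg]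
    · rw [coloredRefl_of_ne hs]
      rcases ih with ih | ih
      · left; rw [ih]
      · right; rw [ih, hneg]

end Cartan

variable {W : Type*} [Group W] (cs : CoxeterSystem M W) (ha : IsGeneralizedCartanMatrix M a)

theorem mem_roots_iff {β : B → ℝ} :
    β ∈ roots a ↔ ∃ w s, β = cs.geomRep ha w (simpleRoot s) := by
  constructor
  · rintro ⟨Q, s, rfl⟩
    exact ⟨cs.wordProd Q, s, (cs.geomRep_wordProd ha Q _).symm⟩
  · rintro ⟨w, s, rfl⟩
    obtain ⟨Q, rfl⟩ := cs.wordProd_surjective w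
    exact ⟨Q, s, cs.geomRep_wordProd ha Q _⟩

theorem geomRep_mem_roots {β : B → ℝ} (h : β ∈ roots a) (w : W) : cs.geomRep ha w β ∈ roots a := by
  obtain ⟨u, s, rfl⟩ := (mem_roots_iff cs ha).1 h
  exact (mem_roots_iff cs ha).2 ⟨w * u, s, by rw [map_mul, Module.End.mul_apply]⟩

/-! ### Positive roots under reflections and colored reflections -/

section

include cs ha

theorem nonneg_or_nonpos_of_mem_roots {β : B → ℝ} (h : β ∈ roots a) : 0 ≤ β ∨ β ≤ 0 := by
  obtain ⟨w, s, rfl⟩ := (mem_roots_iff cs ha).1 h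
  by_cases hd : cs.IsRightDescent w s
  · exact Or.inr (cs.geomRep_nonpos ha hd)
  · exact Or.inl (cs.geomRep_nonneg ha hd)

theorem ne_zero_of_mem_roots {β : B → ℝ} (h : β ∈ roots a) : β ≠ 0 := by
  obtain ⟨w, s, rfl⟩ := (mem_roots_iff cs ha).1 h
  exact cs.geomRep_simpleRoot_ne_zero ha w s

theorem neg_mem_roots {β : B → ℝ} (h : β ∈ roots a) : -β ∈ roots a := by
  obtain ⟨w, s, rfl⟩ := (mem_roots_iff cs ha).1 h
  refine (mem_roots_iff cs ha).2 ⟨w * cs.simple s, s, ?_⟩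
  rw [map_mul, Module.End.mul_apply, cs.geomRep_simple, simpleReflLin_apply,
    ha.simpleRefl_simpleRoot_self, map_neg]

variable (hr : IsReducedRoots a)
include hr

omit cs ha in
-- Here reducedness of the root system enters: a positive root on the line of α_s is α_s itself.
theorem eq_simpleRoot_of_forall_ne {β : B → ℝ} (h : IsPosRoot a β) {s : B}
    (h0 : ∀ t, t ≠ s → β t = 0) : β = simpleRoot s := by
  have e : β = β s • simpleRoot s := by
    ext t
    rcases eq_or_ne t s with rfl | ht
    · simp [simpleRoot_self]
    · simp [simpleRoot_of_ne ht, h0 t ht]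
  have h2 : β s = 1 ∨ β s = -1 :=
    hr _ (isPosRoot_simpleRoot s).1 _ (e ▸ h.1)
  have h3 := h.2 s
  rw [Pi.zero_apply] at h3
  rcases h2 with h2 | h2
  · rw [e, h2, one_smul]
  · linarith

/-- The reflection s changes only the coordinate at s, so a positive root that becomes negative is
supported at s. -/
theorem IsPosRoot.simpleRefl {β : B → ℝ} (h : IsPosRoot a β) {s : B} (hs : β ≠ simpleRoot s) :
    IsPosRoot a (simpleRefl a s β) := by
  have h1 := simpleRefl_mem_roots h.1 s
  refine ⟨h1, (nonneg_or_nonpos_of_mem_roots cs ha h1).resolve_right fun h2 => hs ?_⟩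
  refine eq_simpleRoot_of_forall_ne hr h fun t ht => le_antisymm ?_ (h.2 t)
  have := h2 t
  rwa [simpleRefl_apply_ne a ht] at this

omit cs hr in
theorem IsPosRoot.simpleRefl_ne {β : B → ℝ} (h : IsPosRoot a β) (s : B) :
    _root_.simpleRefl a s β ≠ simpleRoot s := by
  intro e
  have h1 := ha.simpleRefl_simpleRefl s β
  rw [e, ha.simpleRefl_simpleRoot_self] at h1
  have h2 := h.2 s
  rw [← h1, Pi.neg_apply, simpleRoot_self, Pi.zero_apply] at h2
  linarith

theorem IsPosRoot.coloredRefl {b : (B → ℝ) × ℕ} (h : IsPosRoot a b.1) (s : B) :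
    IsPosRoot a (coloredRefl a s b).1 := by
  by_cases hs : b.1 = simpleRoot s
  · simp only [_root_.coloredRefl, hs, if_true]
    exact isPosRoot_simpleRoot s
  · rw [coloredRefl_of_ne hs]
    exact h.simpleRefl cs ha hr hs

theorem IsPosRoot.coloredAct {b : (B → ℝ) × ℕ} (h : IsPosRoot a b.1) (Q : List B) :
    IsPosRoot a (coloredAct a Q b).1 := by
  induction Q with
  | nil => exact h
  | cons s Q ih => exact ih.coloredRefl cs ha hr s

omit cs hr in
theorem coloredRefl_ne {b : (B → ℝ) × ℕ} (h : IsPosRoot a b.1) (s : B) :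
    coloredRefl a s b ≠ (simpleRoot s, 0) := by
  intro e
  by_cases hs : b.1 = simpleRoot s
  · simp [coloredRefl, hs] at e
  · rw [coloredRefl_of_ne hs, Prod.mk.injEq] at e
    exact h.simpleRefl_ne ha s e.1

omit cs hr in
theorem coloredRefl_injOn {b b' : (B → ℝ) × ℕ} (h : IsPosRoot a b.1) (h' : IsPosRoot a b'.1)
    {s : B} (e : coloredRefl a s b = coloredRefl a s b') : b = b' := by
  obtain ⟨β, k⟩ := b
  obtain ⟨β', k'⟩ := b'
  by_cases hs : β = simpleRoot s
  · subst hs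
    by_cases hs' : β' = simpleRoot s
    · subst hs'
      rw [coloredRefl_of_eq, coloredRefl_of_eq, Prod.mk.injEq, Nat.add_right_cancel_iff] at e
      rw [e.2]
    · rw [coloredRefl_of_eq, coloredRefl_of_ne (b := (β', k')) hs', Prod.mk.injEq] at e
      exact absurd e.1.symm (h'.simpleRefl_ne ha s)
  · by_cases hs' : β' = simpleRoot s
    · subst hs'
      rw [coloredRefl_of_eq, coloredRefl_of_ne (b := (β, k)) hs, Prod.mk.injEq] at e
      exact absurd e.1 (h.simpleRefl_ne ha s)
    · rw [coloredRefl_of_ne (b := (β, k)) hs, coloredRefl_of_ne (b := (β', k')) hs',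
        Prod.mk.injEq] at e
      obtain ⟨e1, e2⟩ := e
      simp only at e1 e2
      rw [← ha.simpleRefl_simpleRefl s β, e1, ha.simpleRefl_simpleRefl, e2]

theorem coloredAct_injOn {b b' : (B → ℝ) × ℕ} (h : IsPosRoot a b.1) (h' : IsPosRoot a b'.1)
    {Q : List B} (e : coloredAct a Q b = coloredAct a Q b') : b = b' := by
  induction Q with
  | nil => exact e
  | cons s Q ih =>
    exact ih (coloredRefl_injOn ha (h.coloredAct cs ha hr Q) (h'.coloredAct cs ha hr Q) e)

theorem isPosRoot_of_mem_coloredInvSeq {Q : List B} {b : (B → ℝ) × ℕ}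
    (h : b ∈ coloredInvSeq a Q) : IsPosRoot a b.1 := by
  induction Q generalizing b with
  | nil => simp [coloredInvSeq] at h
  | cons s Q ih =>
    rcases mem_coloredInvSeq_cons.1 h with rfl | ⟨b', hb', rfl⟩
    · exact isPosRoot_simpleRoot s
    · exact (ih hb').coloredRefl cs ha hr s

/-- The colored action of s is injective on positive roots and never takes the value α_s⁽⁰⁾. -/
theorem nodup_coloredInvSeq (Q : List B) : (coloredInvSeq a Q).Nodup := by
  induction Q with
  | nil => exact List.nodup_nil
  | cons s Q ih =>
    rw [coloredInvSeq, List.nodup_cons]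
    constructor
    · rw [List.mem_map]
      rintro ⟨b, hb, e⟩
      exact coloredRefl_ne ha (isPosRoot_of_mem_coloredInvSeq cs ha hr hb) s e
    · refine ih.map_on fun b hb b' hb' e => ?_
      exact coloredRefl_injOn ha (isPosRoot_of_mem_coloredInvSeq cs ha hr hb)
        (isPosRoot_of_mem_coloredInvSeq cs ha hr hb') e

theorem notMem_coloredInvSeq_of_append {Q R : List B} {b : (B → ℝ) × ℕ}
    (h : b ∈ coloredInvSeq a R) : coloredAct a Q b ∉ coloredInvSeq a Q := by
  have := nodup_coloredInvSeq cs ha hr (Q ++ R)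
  rw [coloredInvSeq_append, List.nodup_append] at this
  intro h'
  exact this.2.2 _ h' _ (List.mem_map_of_mem h) rfl

theorem notMem_coloredInvSeq_last (Q : List B) (x : B) :
    coloredAct a Q (simpleRoot x, 0) ∉ coloredInvSeq a Q :=
  notMem_coloredInvSeq_of_append cs ha hr (R := [x]) (by simp [coloredInvSeq_singleton])

end

/-! ### Reduced words act on colored roots -/

section

variable (hr : IsReducedRoots a)
include hr

/-- Along a reduced word a root changes sign at most once, so the color rises by at most one. The
resulting description involves only the element of W, hence both sides of a braid relation act
alike. -/
theorem coloredAct_of_isReduced {Q : List B} (hQ : cs.IsReduced Q) {b : (B → ℝ) × ℕ}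
    (hb : IsPosRoot a b.1) :
    (0 ≤ cs.geomRep ha (cs.wordProd Q) b.1 ∧
      coloredAct a Q b = (cs.geomRep ha (cs.wordProd Q) b.1, b.2)) ∨
    (cs.geomRep ha (cs.wordProd Q) b.1 ≤ 0 ∧
      coloredAct a Q b = (-cs.geomRep ha (cs.wordProd Q) b.1, b.2 + 1)) := by
  induction Q with
  | nil => left; simp [coloredAct_nil, hb.2]
  | cons s Q ih =>
    have hmem : ∀ w, cs.geomRep ha w b.1 ∈ roots a := fun w => geomRep_mem_roots cs ha hb.1 w
    have e : cs.geomRep ha (cs.wordProd (s :: Q)) b.1 =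
        simpleRefl a s (cs.geomRep ha (cs.wordProd Q) b.1) := by
      rw [cs.wordProd_cons, map_mul, Module.End.mul_apply, cs.geomRep_simple]; rfl
    rw [e, coloredAct_cons]
    rcases ih hQ.of_cons with ⟨h1, h2⟩ | ⟨h1, h2⟩
    · rw [h2]
      by_cases hs : cs.geomRep ha (cs.wordProd Q) b.1 = simpleRoot s
      · right
        rw [hs, coloredRefl_of_eq, ha.simpleRefl_simpleRoot_self, neg_neg]
        exact ⟨neg_nonpos.2 (simpleRoot_nonneg s), rfl⟩
      · left
        rw [coloredRefl_of_ne hs]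
        exact ⟨(IsPosRoot.simpleRefl cs ha hr ⟨hmem _, h1⟩ hs).2, rfl⟩
    · have hneg : IsPosRoot a (-cs.geomRep ha (cs.wordProd Q) b.1) :=
        ⟨neg_mem_roots cs ha (hmem _), neg_nonneg.2 h1⟩
      have hs : -cs.geomRep ha (cs.wordProd Q) b.1 ≠ simpleRoot s := by
        intro hs
        have hd : ¬ cs.IsRightDescent (cs.wordProd Q)⁻¹ s := by
          rw [cs.isRightDescent_inv_iff, CoxeterSystem.IsLeftDescent, ← cs.wordProd_cons, hQ.eq,
            hQ.of_cons.eq]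
          simp
        have h3 := cs.geomRep_nonneg ha hd
        rw [← hs, map_neg, cs.geomRep_inv_apply] at h3
        exact ne_zero_of_mem_roots cs ha hb.1
          (eq_zero_of_nonneg_of_nonpos hb.2 (neg_nonneg.1 h3))
      right
      rw [h2, coloredRefl_of_ne hs]
      have h4 := hneg.simpleRefl cs ha hr hs
      rw [show simpleRefl a s (-cs.geomRep ha (cs.wordProd Q) b.1) =
        -simpleRefl a s (cs.geomRep ha (cs.wordProd Q) b.1) from
          map_neg (simpleReflLin a s) _] at h4 ⊢
      exact ⟨neg_nonneg.1 h4.2, rfl⟩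

/-- For a reduced word these are the classical inversions, all of color 0. -/
theorem mem_coloredInvSeq_of_isReduced {Q : List B} (hQ : cs.IsReduced Q) {b : (B → ℝ) × ℕ} :
    b ∈ coloredInvSeq a Q ↔
      b.2 = 0 ∧ IsPosRoot a b.1 ∧ cs.geomRep ha (cs.wordProd Q)⁻¹ b.1 ≤ 0 := by
  induction Q generalizing b with
  | nil =>
    simp only [coloredInvSeq, List.not_mem_nil, cs.wordProd_nil, inv_one, map_one,
      Module.End.one_apply, false_iff]
    rintro ⟨-, h1, h2⟩
    exact ne_zero_of_mem_roots cs ha h1.1 (eq_zero_of_nonneg_of_nonpos h1.2 h2)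
  | cons s Q ih =>
    have hd : ¬ cs.IsRightDescent (cs.wordProd Q)⁻¹ s := by
      rw [cs.isRightDescent_inv_iff, CoxeterSystem.IsLeftDescent, ← cs.wordProd_cons, hQ.eq,
        hQ.of_cons.eq]
      simp
    have h3 := cs.geomRep_nonneg ha hd
    have e : ∀ v, cs.geomRep ha (cs.wordProd (s :: Q))⁻¹ v =
        cs.geomRep ha (cs.wordProd Q)⁻¹ (simpleRefl a s v) := by
      intro v
      rw [cs.wordProd_cons, mul_inv_rev, cs.inv_simple, map_mul, Module.End.mul_apply,
        cs.geomRep_simple]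
      rfl
    have ih' := fun b => ih hQ.of_cons (b := b)
    rw [mem_coloredInvSeq_cons, e]
    obtain ⟨β, k⟩ := b
    constructor
    · rintro (h | ⟨⟨β', k'⟩, hb', h⟩)
      · rw [Prod.mk.injEq] at h
        obtain ⟨rfl, rfl⟩ := h
        refine ⟨rfl, isPosRoot_simpleRoot s, ?_⟩
        rw [ha.simpleRefl_simpleRoot_self, map_neg]
        exact neg_nonpos.2 h3
      · obtain ⟨hk, hp, hn⟩ := (ih' _).1 hb'
        have hs : β' ≠ simpleRoot s := by
          intro hs
          simp only [hs] at hn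
          exact cs.geomRep_simpleRoot_ne_zero ha _ s (eq_zero_of_nonneg_of_nonpos h3 hn)
        rw [coloredRefl_of_ne hs, Prod.mk.injEq] at h
        obtain ⟨rfl, rfl⟩ := h
        refine ⟨hk, hp.simpleRefl cs ha hr hs, ?_⟩
        simp only [ha.simpleRefl_simpleRefl]
        exact hn
    · rintro ⟨hk, hp, hn⟩
      simp only at hk hp hn
      subst hk
      by_cases hs : β = simpleRoot s
      · left; rw [hs]
      · refine Or.inr ⟨(simpleRefl a s β, 0), (ih' _).2
          ⟨rfl, hp.simpleRefl cs ha hr hs, hn⟩, ?_⟩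
        rw [coloredRefl_of_ne (hp.simpleRefl_ne ha s)]
        simp only [ha.simpleRefl_simpleRefl]

include ha in
-- A letter that shortens a reduced word creates an inversion of color 1.
theorem isReduced_of_color_eq_zero {Q : List B} (h : ∀ b ∈ coloredInvSeq a Q, b.2 = 0) :
    cs.IsReduced Q := by
  induction Q using List.reverseRecOn with
  | nil => simp [CoxeterSystem.IsReduced]
  | append_singleton Q x ih =>
    have hQ := ih fun b hb => h b (mem_coloredInvSeq_concat.2 (Or.inl hb))
    have hx := h _ (mem_coloredInvSeq_concat.2 (Or.inr rfl))
    rcases coloredAct_of_isReduced cs ha hr hQ (b := (simpleRoot x, 0))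
      (isPosRoot_simpleRoot x) with ⟨h1, _⟩ | ⟨_, h2⟩
    · have hd := (cs.geomRep_nonneg_iff ha).1 h1
      rw [cs.not_isRightDescent_iff] at hd
      rw [CoxeterSystem.IsReduced, cs.wordProd_append, cs.wordProd_singleton, hd, hQ.eq,
        List.length_append, List.length_singleton]
    · rw [h2] at hx
      simp at hx

/-- Words with the same action on colored positive roots and the same colored inversions. -/
def coloredCon : Con (FreeMonoid B) where
  r x y := (∀ b : (B → ℝ) × ℕ, IsPosRoot a b.1 →
      coloredAct a x.toList b = coloredAct a y.toList b) ∧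
    ∀ b, b ∈ coloredInvSeq a x.toList ↔ b ∈ coloredInvSeq a y.toList
  iseqv := ⟨fun _ => ⟨fun _ _ => rfl, fun _ => Iff.rfl⟩,
    fun h => ⟨fun b hb => (h.1 b hb).symm, fun b => (h.2 b).symm⟩,
    fun h h' => ⟨fun b hb => (h.1 b hb).trans (h'.1 b hb), fun b => (h.2 b).trans (h'.2 b)⟩⟩
  mul' := by
    rintro x y z t ⟨h1, h2⟩ ⟨h3, h4⟩
    simp only [FreeMonoid.toList_mul]
    refine ⟨fun b hb => ?_, fun b => ?_⟩
    · rw [coloredAct_append, coloredAct_append, h3 b hb, h1 _ (hb.coloredAct cs ha hr _)]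
    · rw [mem_coloredInvSeq_append, mem_coloredInvSeq_append, h2]
      refine or_congr Iff.rfl (exists_congr fun b' => ?_)
      rw [h4]
      refine and_congr_right fun hb' => ?_
      rw [h1 _ (isPosRoot_of_mem_coloredInvSeq cs ha hr hb')]

/-- It is enough to compare two braid words; both are reduced words of one element of W, which
determines action and inversions. -/
theorem coloredCon_of_ofWord_eq {Q R : List B}
    (h : ArtinMonoid.ofWord M Q = ArtinMonoid.ofWord M R) :
    coloredCon cs ha hr (FreeMonoid.ofList Q) (FreeMonoid.ofList R) := by
  have h1 : conGen (braidRel M) (FreeMonoid.ofList Q) (FreeMonoid.ofList R) :=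
    PresentedMonoid.mk_eq_mk_iff.1 h
  refine (Con.conGen_le.2 ?_ : conGen (braidRel M) ≤ coloredCon cs ha hr) h1
  rintro _ _ ⟨s, t, rfl, rfl⟩
  rcases eq_or_ne s t with rfl | hst
  · exact (coloredCon cs ha hr).refl _
  have h1 := cs.isReduced_braidWord ha hst
  have h2 := cs.isReduced_braidWord ha hst.symm
  have e := cs.wordProd_braidWord_eq s t
  refine ⟨fun b hb => ?_, fun b => ?_⟩
  · have h3 := coloredAct_of_isReduced cs ha hr h1 hb
    have h4 := coloredAct_of_isReduced cs ha hr h2 hb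
    rw [← e] at h4
    simp only [FreeMonoid.toList_ofList]
    have hne : cs.geomRep ha (cs.wordProd (CoxeterSystem.braidWord M s t)) b.1 ≠ 0 :=
      ne_zero_of_mem_roots cs ha (geomRep_mem_roots cs ha hb.1 _)
    rcases h3 with ⟨p3, e3⟩ | ⟨p3, e3⟩ <;> rcases h4 with ⟨p4, e4⟩ | ⟨p4, e4⟩
    · rw [e3, e4]
    · exact absurd (eq_zero_of_nonneg_of_nonpos p3 p4) hne
    · exact absurd (eq_zero_of_nonneg_of_nonpos p4 p3) hne
    · rw [e3, e4]
  · simp only [FreeMonoid.toList_ofList]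
    rw [mem_coloredInvSeq_of_isReduced cs ha hr h1, mem_coloredInvSeq_of_isReduced cs ha hr h2, e]

include cs ha

theorem coloredAct_eq_of_ofWord_eq {Q R : List B}
    (h : ArtinMonoid.ofWord M Q = ArtinMonoid.ofWord M R) {b : (B → ℝ) × ℕ}
    (hb : IsPosRoot a b.1) : coloredAct a Q b = coloredAct a R b :=
  (coloredCon_of_ofWord_eq cs ha hr h).1 b hb

theorem mem_coloredInvSeq_iff_of_ofWord_eq {Q R : List B}
    (h : ArtinMonoid.ofWord M Q = ArtinMonoid.ofWord M R) (b : (B → ℝ) × ℕ) :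
    b ∈ coloredInvSeq a Q ↔ b ∈ coloredInvSeq a R :=
  (coloredCon_of_ofWord_eq cs ha hr h).2 b

theorem coloredInv_ofWord (Q : List B) :
    coloredInv a (ArtinMonoid.ofWord M Q) = {b | b ∈ coloredInvSeq a Q} := by
  ext b
  constructor
  · rintro ⟨R, hR, hb⟩
    exact (mem_coloredInvSeq_iff_of_ofWord_eq cs ha hr hR b).1 hb
  · exact fun hb => ⟨Q, rfl, hb⟩

theorem ncard_coloredInv (u : ArtinMonoid M) : (coloredInv a u).ncard = ArtinMonoid.length u := by
  classical
  obtain ⟨Q, rfl⟩ := ArtinMonoid.ofWord_surjective u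
  rw [coloredInv_ofWord cs ha hr, ArtinMonoid.length_ofWord, ← length_coloredInvSeq (a := a) Q,
    ← List.toFinset_card_of_nodup (nodup_coloredInvSeq cs ha hr Q), ← Set.ncard_coe_finset]
  congr 1
  ext b
  simp

end

theorem coloredInv_mono {u v : ArtinMonoid M} (h : u ≤ v) : coloredInv a u ⊆ coloredInv a v := by
  obtain ⟨x, rfl⟩ := ArtinMonoid.le_iff.1 h
  rintro b ⟨Q, rfl, hb⟩
  obtain ⟨R, rfl⟩ := ArtinMonoid.ofWord_surjective x
  exact ⟨Q ++ R, ArtinMonoid.ofWord_append Q R, mem_coloredInvSeq_append.2 (Or.inl hb)⟩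

end Colored

/-! ### Invariant forms -/

section InvariantForm

variable {B : Type*} [Fintype B] {M : CoxeterMatrix B} {a : Matrix B B ℝ}

/-- A symmetric positive definite bilinear form that is invariant under the simple reflections. -/
structure IsInvariantForm (a : Matrix B B ℝ) (F : LinearMap.BilinForm ℝ (B → ℝ)) : Prop where
  symm : ∀ x y, F x y = F y x
  pos : ∀ x, x ≠ 0 → 0 < F x x
  simpleRefl : ∀ s x y, F (simpleRefl a s x) (simpleRefl a s y) = F x y

/-- Average the standard dot product over the finite group W. -/
theorem CoxeterSystem.exists_isInvariantForm {W : Type*} [Group W] [Finite W]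
    (cs : CoxeterSystem M W) (ha : IsGeneralizedCartanMatrix M a) :
    ∃ F, IsInvariantForm a F := by
  let _ := Fintype.ofFinite W
  refine ⟨LinearMap.mk₂ ℝ (fun x y => ∑ w, cs.geomRep ha w x ⬝ᵥ cs.geomRep ha w y) ?_ ?_ ?_ ?_,
    ?_, ?_, ?_⟩
  · intro x x' y; simp [Finset.sum_add_distrib]
  · intro r x y; simp [Finset.mul_sum]
  · intro x y y'; simp [Finset.sum_add_distrib]
  · intro r x y; simp [Finset.mul_sum]
  · intro x y
    simp only [LinearMap.mk₂_apply]
    exact Finset.sum_congr rfl fun w _ => dotProduct_comm _ _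
  · intro x hx
    simp only [LinearMap.mk₂_apply]
    have hnn : ∀ v : B → ℝ, 0 ≤ v ⬝ᵥ v := fun v =>
      Finset.sum_nonneg fun i _ => mul_self_nonneg (v i)
    refine Finset.sum_pos (fun w _ => lt_of_le_of_ne (hnn _) fun h => hx ?_) ⟨1, Finset.mem_univ _⟩
    rw [eq_comm, dotProduct_self_eq_zero] at h
    exact cs.geomRep_injective ha w (h.trans (map_zero _).symm)
  · intro s x y
    simp only [LinearMap.mk₂_apply]
    refine Fintype.sum_equiv (Equiv.mulRight (cs.simple s)) _ _ fun w => ?_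
    simp only [Equiv.coe_mulRight, map_mul, Module.End.mul_apply, cs.geomRep_simple,
      simpleReflLin_apply]

variable {F : LinearMap.BilinForm ℝ (B → ℝ)} (ha : IsGeneralizedCartanMatrix M a)
  (hF : IsInvariantForm a F)

theorem eq_sum_smul_simpleRoot (x : B → ℝ) : x = ∑ t, x t • simpleRoot t := by
  classical
  ext u
  simp only [Finset.sum_apply, Pi.smul_apply, smul_eq_mul]
  rw [Finset.sum_eq_single u]
  · rw [simpleRoot_self, mul_one]
  · intro t _ h
    rw [simpleRoot_of_ne h.symm, mul_zero]
  · exact fun h => absurd (Finset.mem_univ u) h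

namespace IsInvariantForm

include hF

theorem foldr (Q : List B) (x y : B → ℝ) :
    F (Q.foldr (_root_.simpleRefl a) x) (Q.foldr (_root_.simpleRefl a) y) = F x y := by
  induction Q with
  | nil => rfl
  | cons s Q ih => rw [List.foldr_cons, List.foldr_cons, hF.simpleRefl, ih]

theorem simpleRoot_pos (s : B) : 0 < F (simpleRoot s) (simpleRoot s) :=
  hF.pos _ (simpleRoot_ne_zero s)

include ha

/-- Invariance under s, applied to the pair (α_s, v). It says that simple reflections are orthogonal
for F although `a` need not be symmetric. -/
theorem two_mul_simpleRoot (s : B) (v : B → ℝ) :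
    2 * F (simpleRoot s) v = F (simpleRoot s) (simpleRoot s) * (a *ᵥ v) s := by
  have h := hF.simpleRefl s (simpleRoot s) v
  rw [ha.simpleRefl_simpleRoot_self, _root_.simpleRefl, map_neg, LinearMap.neg_apply, map_sub,
    map_smul, smul_eq_mul] at h
  linarith

theorem simpleRoot_eq_zero_iff (s : B) (v : B → ℝ) : F (simpleRoot s) v = 0 ↔ (a *ᵥ v) s = 0 := by
  have h := hF.two_mul_simpleRoot ha s v
  have := hF.simpleRoot_pos s
  constructor
  · intro h0
    rw [h0, mul_zero, eq_comm, mul_eq_zero] at h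
    exact h.resolve_left this.ne'
  · intro h0
    rw [h0, mul_zero] at h
    linarith

theorem simpleRoot_nonpos {s t : B} (h : s ≠ t) : F (simpleRoot s) (simpleRoot t) ≤ 0 := by
  have h1 := hF.two_mul_simpleRoot ha s (simpleRoot t)
  rw [mulVec_simpleRoot] at h1
  have := mul_nonpos_of_nonneg_of_nonpos (hF.simpleRoot_pos s).le (ha.nonpos s t h)
  linarith

theorem simpleRefl_eq (s : B) (v : B → ℝ) : _root_.simpleRefl a s v =
    v - (2 * F (simpleRoot s) v / F (simpleRoot s) (simpleRoot s)) • simpleRoot s := by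
  rw [hF.two_mul_simpleRoot ha, mul_div_cancel_left₀ _ (hF.simpleRoot_pos s).ne',
    _root_.simpleRefl]

/-- Conjugation of simple reflections. -/
theorem mul_simple_eq {W : Type*} [Group W] (cs : CoxeterSystem M W) {w : W} {s t : B}
    (h : cs.geomRep ha w (simpleRoot s) = simpleRoot t) :
    w * cs.simple s = cs.simple t * w := by
  have hw : ∀ x y, F (cs.geomRep ha w x) (cs.geomRep ha w y) = F x y := by
    obtain ⟨Q, rfl⟩ := cs.wordProd_surjective w
    intro x y
    rw [cs.geomRep_wordProd, cs.geomRep_wordProd, hF.foldr]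
  rw [← mul_inv_eq_one]
  refine cs.geomRep_faithful ha (LinearMap.ext fun v => ?_)
  have key : ∀ v, cs.geomRep ha w (_root_.simpleRefl a s v) =
      _root_.simpleRefl a t (cs.geomRep ha w v) := by
    intro v
    rw [hF.simpleRefl_eq ha, hF.simpleRefl_eq ha, map_sub, map_smul, h, ← h, hw, hw]
  rw [mul_inv_rev, cs.inv_simple, map_mul, map_mul, map_mul, Module.End.mul_apply,
    Module.End.mul_apply, Module.End.mul_apply, cs.geomRep_simple, cs.geomRep_simple,
    simpleReflLin_apply, simpleReflLin_apply, key, cs.geomRep_apply_inv,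
    ha.simpleRefl_simpleRefl, Module.End.one_apply]

end IsInvariantForm

end InvariantForm

/-! ### The skew-symmetric form of a Coxeter element -/

section Skew

variable {B : Type*} (F : LinearMap.BilinForm ℝ (B → ℝ))

/-- The pairing of `α_s` with the part of `y` supported on `l`. -/
def partialForm (l : List B) (s : B) (y : B → ℝ) : ℝ :=
  (l.map fun t => F (simpleRoot s) (simpleRoot t) * y t).sum

theorem partialForm_cons (t : B) (l : List B) (s : B) (y : B → ℝ) : partialForm F (t :: l) s y =
    F (simpleRoot s) (simpleRoot t) * y t + partialForm F l s y := by
  simp [partialForm]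

theorem partialForm_append (l l' : List B) (s : B) (y : B → ℝ) :
    partialForm F (l ++ l') s y = partialForm F l s y + partialForm F l' s y := by
  simp [partialForm]

theorem partialForm_congr {l : List B} (s : B) {y y' : B → ℝ} (h : ∀ t ∈ l, y t = y' t) :
    partialForm F l s y = partialForm F l s y' := by
  induction l with
  | nil => rfl
  | cons t l ih =>
    rw [partialForm_cons, partialForm_cons, h t List.mem_cons_self,
      ih fun u hu => h u (List.mem_cons_of_mem _ hu)]

theorem partialForm_zero (l : List B) (s : B) : partialForm F l s 0 = 0 := by
  induction l with
  | nil => rfl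
  | cons t l ih => rw [partialForm_cons, ih]; simp

theorem partialForm_lin (l : List B) (s : B) (p q : ℝ) (y z : B → ℝ) :
    partialForm F l s (p • y + q • z) = p * partialForm F l s y + q * partialForm F l s z := by
  induction l with
  | nil => simp [partialForm]
  | cons t l ih =>
    rw [partialForm_cons, partialForm_cons, partialForm_cons, ih]
    simp only [Pi.add_apply, Pi.smul_apply, smul_eq_mul]
    ring

/-- The skew-symmetric form `ω_c` attached to an ordering of the simple roots. -/
def omega : List B → (B → ℝ) → (B → ℝ) → ℝ
  | [], _, _ => 0
  | s :: l, x, y => x s * partialForm F l s y - y s * partialForm F l s x + omega l x y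

theorem omega_cons (s : B) (l : List B) (x y : B → ℝ) : omega F (s :: l) x y =
    x s * partialForm F l s y - y s * partialForm F l s x + omega F l x y := rfl

theorem omega_antisymm (l : List B) (x y : B → ℝ) : omega F l x y = -omega F l y x := by
  induction l with
  | nil => simp [omega]
  | cons s l ih => rw [omega_cons, omega_cons, ih]; ring

theorem omega_lin (l : List B) (x y z : B → ℝ) (p q : ℝ) :
    omega F l x (p • y + q • z) = p * omega F l x y + q * omega F l x z := by
  induction l with
  | nil => simp [omega]
  | cons s l ih =>
    rw [omega_cons, omega_cons, omega_cons, ih, partialForm_lin]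
    simp only [Pi.add_apply, Pi.smul_apply, smul_eq_mul]
    ring

theorem omega_self (l : List B) (x : B → ℝ) : omega F l x x = 0 := by
  have := omega_antisymm F l x x
  linarith

theorem omega_congr {l : List B} {x x' y y' : B → ℝ} (hx : ∀ t ∈ l, x t = x' t)
    (hy : ∀ t ∈ l, y t = y' t) : omega F l x y = omega F l x' y' := by
  induction l with
  | nil => rfl
  | cons s l ih =>
    have hx' : ∀ t ∈ l, x t = x' t := fun t ht => hx t (List.mem_cons_of_mem _ ht)
    have hy' : ∀ t ∈ l, y t = y' t := fun t ht => hy t (List.mem_cons_of_mem _ ht)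
    rw [omega_cons, omega_cons, ih hx' hy', partialForm_congr F s hx', partialForm_congr F s hy',
      hx s List.mem_cons_self, hy s List.mem_cons_self]

theorem omega_zero_left (l : List B) (y : B → ℝ) : omega F l 0 y = 0 := by
  induction l with
  | nil => rfl
  | cons s l ih => rw [omega_cons, ih, partialForm_zero]; simp

theorem omega_cons_of_eq_zero {s : B} (l : List B) {x y : B → ℝ} (hx : x s = 0) (hy : y s = 0) :
    omega F (s :: l) x y = omega F l x y := by
  rw [omega_cons, hx, hy]; ring

theorem omega_cons_simpleRoot {s : B} {l : List B} (hs : s ∉ l) (y : B → ℝ) :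
    omega F (s :: l) (simpleRoot s) y = partialForm F l s y := by
  have h : ∀ t ∈ l, simpleRoot s t = (0 : B → ℝ) t := fun t ht =>
    simpleRoot_of_ne fun e => hs (e ▸ ht)
  rw [omega_cons, partialForm_congr F s h, partialForm_zero, omega_congr F h fun _ _ => rfl,
    omega_zero_left, simpleRoot_self]
  ring

variable {F} [Fintype B] {M : CoxeterMatrix B} {a : Matrix B B ℝ}
  (ha : IsGeneralizedCartanMatrix M a) (hF : IsInvariantForm a F)

include hF in
theorem omega_concat (l : List B) (s : B) (x y : B → ℝ) : omega F (l ++ [s]) x y =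
    omega F l x y + y s * partialForm F l s x - x s * partialForm F l s y := by
  induction l with
  | nil => simp [omega, partialForm]
  | cons t l ih =>
    rw [List.cons_append, omega_cons, ih, omega_cons, partialForm_append, partialForm_append,
      partialForm_cons, partialForm_cons]
    simp only [partialForm, List.map_cons, List.map_nil, List.sum_cons, List.sum_nil]
    rw [hF.symm (simpleRoot t) (simpleRoot s)]
    ring

/-- A vector all of whose coordinates outside `l` vanish. -/
def SupportedIn (l : List B) (x : B → ℝ) : Prop := ∀ t, t ∉ l → x t = 0

omit [Fintype B] in
theorem supportedIn_simpleRoot {l : List B} {s : B} (h : s ∈ l) : SupportedIn l (simpleRoot s) :=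
  fun _ ht => simpleRoot_of_ne fun e => ht (e ▸ h)

theorem SupportedIn.simpleRefl {l : List B} {x : B → ℝ} (hx : SupportedIn l x) {s : B}
    (h : s ∈ l) : SupportedIn l (simpleRefl a s x) := fun t ht => by
  rw [simpleRefl_apply_ne a (s := s) (t := t) fun e => ht (e ▸ h), hx t ht]

theorem form_simpleRoot_eq {s : B} {l : List B} (hl : (s :: l).Nodup) {x : B → ℝ}
    (hx : SupportedIn (s :: l) x) :
    F (simpleRoot s) x = F (simpleRoot s) (simpleRoot s) * x s + partialForm F l s x := by
  classical
  rw [← partialForm_cons, partialForm, ← List.sum_toFinset _ hl]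
  conv_lhs => rw [eq_sum_smul_simpleRoot x, map_sum]
  rw [eq_comm]
  refine Finset.sum_subset_zero_on_sdiff (Finset.subset_univ _) (fun t ht => ?_) fun t _ => ?_
  · rw [Finset.mem_sdiff, List.mem_toFinset] at ht
    rw [hx t ht.2, zero_smul, map_zero]
  · rw [map_smul, smul_eq_mul, mul_comm]

include ha hF

theorem form_mul_simpleRefl_apply_self {s : B} {l : List B} (hl : (s :: l).Nodup) {x : B → ℝ}
    (hx : SupportedIn (s :: l) x) :
    F (simpleRoot s) (simpleRoot s) * simpleRefl a s x s =
      -(F (simpleRoot s) (simpleRoot s) * x s) - 2 * partialForm F l s x := by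
  have h1 := form_simpleRoot_eq (F := F) hl hx
  have h2 := hF.two_mul_simpleRoot ha s x
  rw [simpleRefl_apply_self]
  linarith

theorem partialForm_nonpos {s : B} {l : List B} (hs : s ∉ l) {y : B → ℝ} (hy : 0 ≤ y) :
    partialForm F l s y ≤ 0 := by
  induction l with
  | nil => simp [partialForm]
  | cons t l ih =>
    rw [partialForm_cons]
    rw [List.mem_cons, not_or] at hs
    have := mul_nonpos_of_nonpos_of_nonneg (hF.simpleRoot_nonpos ha hs.1) (hy t)
    have := ih hs.2
    linarith

/-- The change of the s-coordinate under s compensates for moving s from the front to the end of the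
word. Vectors supported on the word suffice, so the identity survives when letters are discarded. -/
theorem omega_simpleRefl {s : B} {l : List B} (hl : (s :: l).Nodup) {x y : B → ℝ}
    (hx : SupportedIn (s :: l) x) (hy : SupportedIn (s :: l) y) :
    omega F (l ++ [s]) (simpleRefl a s x) (simpleRefl a s y) = omega F (s :: l) x y := by
  have hs : s ∉ l := (List.nodup_cons.1 hl).1
  have hc : ∀ v : B → ℝ, ∀ t ∈ l, simpleRefl a s v t = v t := fun v t ht =>
    simpleRefl_apply_ne a (s := s) (t := t) (fun e => hs (e ▸ ht)) v
  rw [omega_concat hF, omega_congr F (hc x) (hc y), partialForm_congr F s (hc x),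
    partialForm_congr F s (hc y), omega_cons]
  have h1 := form_mul_simpleRefl_apply_self ha hF hl hx
  have h2 := form_mul_simpleRefl_apply_self ha hF hl hy
  have h3 := hF.simpleRoot_pos s
  refine mul_left_cancel₀ h3.ne' ?_
  linear_combination partialForm F l s x * h2 - partialForm F l s y * h1

end Skew

/-! ### Sorting sequences -/

section Sorting

variable {B : Type*}

/-- `IsSortingSeq c Q`: the word `Q` is obtained by reading the word `c` cyclically and, at each step,
either using the current letter and keeping it for the next round, or discarding it for good. -/
inductive IsSortingSeq : List B → List B → Prop
  | nil : IsSortingSeq [] []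
  | use {s : B} {d Q : List B} : IsSortingSeq (d ++ [s]) Q → IsSortingSeq (s :: d) (s :: Q)
  | skip {s : B} {d Q : List B} : IsSortingSeq d Q → IsSortingSeq (s :: d) Q

namespace IsSortingSeq

theorem empty (c : List B) : IsSortingSeq c [] := by
  induction c with
  | nil => exact nil
  | cons s c ih => exact skip ih

theorem mem {c Q : List B} (h : IsSortingSeq c Q) {x : B} (hx : x ∈ Q) : x ∈ c := by
  induction h with
  | nil => exact hx
  | @use s d Q h ih =>
    rcases List.mem_cons.1 hx with rfl | hx
    · exact List.mem_cons_self
    · have := ih hx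
      rw [List.mem_append, List.mem_singleton] at this
      rw [List.mem_cons]
      exact this.symm
  | skip h ih => exact List.mem_cons_of_mem _ (ih hx)

theorem left {c Q R : List B} (h : IsSortingSeq c (Q ++ R)) : IsSortingSeq c Q := by
  generalize hS : Q ++ R = S at h
  induction h generalizing Q with
  | nil =>
    rw [List.append_eq_nil_iff] at hS
    rw [hS.1]
    exact nil
  | @use s d S h ih =>
    rcases Q with _ | ⟨t, Q⟩
    · exact empty _
    · rw [List.cons_append, List.cons.injEq] at hS
      obtain ⟨rfl, hS⟩ := hS
      exact use (ih hS)
  | skip h ih => exact skip (ih hS)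

theorem nodup_concat {s : B} {d : List B} (h : (s :: d).Nodup) : (d ++ [s]).Nodup :=
  (List.perm_append_singleton s d).nodup_iff.2 h

/-- A suffix is read from the state of the cyclic word after the prefix, that is, after rotations
and deletions. -/
theorem right {c Q R : List B} (h : IsSortingSeq c (Q ++ R)) :
    ∃ c', IsSortingSeq c' R ∧ (c.Nodup → c'.Nodup) := by
  generalize hS : Q ++ R = S at h
  induction h generalizing Q with
  | nil =>
    rw [List.append_eq_nil_iff] at hS
    rw [hS.2]
    exact ⟨[], nil, id⟩
  | @use s d S h ih =>
    rcases Q with _ | ⟨t, Q⟩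
    · rw [List.nil_append] at hS
      exact ⟨s :: d, hS ▸ use h, id⟩
    · rw [List.cons_append, List.cons.injEq] at hS
      obtain ⟨c', h1, h2⟩ := ih hS.2
      exact ⟨c', h1, fun hc => h2 (nodup_concat hc)⟩
  | skip h ih =>
    obtain ⟨c', h1, h2⟩ := ih hS
    exact ⟨c', h1, fun hc => h2 (List.nodup_cons.1 hc).2⟩

end IsSortingSeq

variable [Fintype B] {M : CoxeterMatrix B} {a : Matrix B B ℝ}

theorem SupportedIn.coloredRefl {c : List B} {b : (B → ℝ) × ℕ} (hb : SupportedIn c b.1) {s : B}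
    (hs : s ∈ c) : SupportedIn c (coloredRefl a s b).1 := by
  by_cases h : b.1 = simpleRoot s
  · simp only [_root_.coloredRefl, h, if_true]
    exact supportedIn_simpleRoot hs
  · rw [coloredRefl_of_ne h]
    exact hb.simpleRefl hs

theorem SupportedIn.coloredAct {c Q : List B} (hQ : ∀ s ∈ Q, s ∈ c) {b : (B → ℝ) × ℕ}
    (hb : SupportedIn c b.1) : SupportedIn c (coloredAct a Q b).1 := by
  induction Q with
  | nil => exact hb
  | cons s Q ih =>
    exact (ih fun t ht => hQ t (List.mem_cons_of_mem _ ht)).coloredRefl (hQ s List.mem_cons_self)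

theorem supportedIn_of_mem_coloredInvSeq {c Q : List B} (hQ : ∀ s ∈ Q, s ∈ c)
    {b : (B → ℝ) × ℕ} (hb : b ∈ coloredInvSeq a Q) : SupportedIn c b.1 := by
  induction Q generalizing b with
  | nil => simp [coloredInvSeq] at hb
  | cons s Q ih =>
    rcases mem_coloredInvSeq_cons.1 hb with rfl | ⟨b', hb', rfl⟩
    · exact supportedIn_simpleRoot (hQ s List.mem_cons_self)
    · exact (ih (fun t ht => hQ t (List.mem_cons_of_mem _ ht)) hb').coloredRefl
        (hQ s List.mem_cons_self)

/-- If `s` maps a colored root to one of color `0`, then it acts linearly on it. -/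
theorem eq_of_coloredRefl_eq_zero {s : B} {b : (B → ℝ) × ℕ} {γ : B → ℝ}
    (h : coloredRefl a s b = (γ, 0)) :
    b.1 ≠ simpleRoot s ∧ b.2 = 0 ∧ γ = simpleRefl a s b.1 := by
  by_cases hs : b.1 = simpleRoot s
  · simp [coloredRefl, hs] at h
  · rw [coloredRefl_of_ne hs, Prod.mk.injEq] at h
    exact ⟨hs, h.2, h.1.symm⟩

variable {W : Type*} [Group W] (cs : CoxeterSystem M W) (ha : IsGeneralizedCartanMatrix M a)
  (hr : IsReducedRoots a) {F : LinearMap.BilinForm ℝ (B → ℝ)} (hF : IsInvariantForm a F)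
include cs ha hr hF

/-- Conjugating by used letters preserves ω, and discarded letters do not occur in the supports, so
one arrives at ρ = α_s with s the first letter. There ω_c(α_s, γ) is a sum of terms F(α_s, α_t) γ_t
≤ 0. -/
theorem IsSortingSeq.omega_nonpos {c Q : List B} (h : IsSortingSeq c Q) (hc : c.Nodup)
    {V : List B} {x : B} (hQ : Q = V ++ [x]) {γ ρ : B → ℝ}
    (hγ : coloredAct a V (simpleRoot x, 0) = (γ, 0)) (hρ : (ρ, 0) ∈ coloredInvSeq a V) :
    omega F c ρ γ ≤ 0 ∧ ∀ (σ : B → ℝ) (p q : ℝ), IsPosRoot a σ → (σ, 0) ∉ coloredInvSeq a V →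
      0 < p → 0 < q → γ = p • ρ + q • σ → omega F c ρ γ < 0 := by
  induction h generalizing V γ ρ with
  | nil => simp at hQ
  | @skip s d Q h ih =>
    have hV : ∀ t ∈ V, t ∈ d := fun t ht => h.mem (hQ ▸ List.mem_append_left _ ht)
    have hx : x ∈ d := h.mem (hQ ▸ List.mem_append_right _ (List.mem_singleton_self x))
    have hs := (List.nodup_cons.1 hc).1
    have h1 : ρ s = 0 := supportedIn_of_mem_coloredInvSeq hV hρ s hs
    have h2 : γ s = 0 := by
      have := SupportedIn.coloredAct (a := a) hV (b := (simpleRoot x, 0))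
        (supportedIn_simpleRoot hx) s hs
      rwa [hγ] at this
    rw [omega_cons_of_eq_zero F d h1 h2]
    exact ih (List.nodup_cons.1 hc).2 hQ hγ hρ
  | @use s d Q h ih =>
    rcases V with _ | ⟨t, V⟩
    · simp [coloredInvSeq] at hρ
    rw [List.cons_append, List.cons.injEq] at hQ
    obtain ⟨rfl, hQ⟩ := hQ
    have hcs := IsSortingSeq.nodup_concat hc
    have hs : s ∉ d := (List.nodup_cons.1 hc).1
    have hsub : ∀ t, t ∈ d ++ [s] → t ∈ s :: d := fun t ht =>
      (List.perm_append_singleton s d).mem_iff.1 ht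
    have hV : ∀ t ∈ V, t ∈ s :: d := fun t ht => hsub t (h.mem (hQ ▸ List.mem_append_left _ ht))
    have hx : x ∈ s :: d :=
      hsub x (h.mem (hQ ▸ List.mem_append_right _ (List.mem_singleton_self x)))
    rw [coloredAct_cons] at hγ
    have hpos := IsPosRoot.coloredAct cs ha hr (b := (simpleRoot x, 0)) (isPosRoot_simpleRoot x) V
    have hsupp := SupportedIn.coloredAct (a := a) hV (b := (simpleRoot x, 0))
        (supportedIn_simpleRoot hx)
    rcases hγ' : coloredAct a V (simpleRoot x, 0) with ⟨γ', k⟩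
    rw [hγ'] at hγ hpos hsupp
    obtain ⟨hne, hk, rfl⟩ := eq_of_coloredRefl_eq_zero hγ
    simp only at hne hk hpos hsupp
    subst hk
    have hpos' := hpos.simpleRefl cs ha hr hne
    rcases mem_coloredInvSeq_cons.1 hρ with hρ | ⟨⟨ρ', k⟩, hρ', hρ⟩
    · rw [Prod.mk.injEq] at hρ
      obtain ⟨rfl, -⟩ := hρ
      rw [omega_cons_simpleRoot F hs]
      have hle := partialForm_nonpos ha hF hs hpos'.2
      refine ⟨hle, fun σ p q hσ _ hp hq e => lt_of_le_of_ne hle fun h0 => ?_⟩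
      -- If the sum vanished, the s-coordinate of sγ would be -γ_s ≤ -p < 0, although sγ is a
      -- positive root.
      have h1 := form_mul_simpleRefl_apply_self ha hF hc (hsupp.simpleRefl (a := a)
        (List.mem_cons_self (a := s) (l := d)))
      rw [h0, ha.simpleRefl_simpleRefl, e] at h1
      have h2 := hF.simpleRoot_pos s
      have h3 := hpos.2 s
      have h4 := hσ.2 s
      simp only [Pi.add_apply, Pi.smul_apply, smul_eq_mul, simpleRoot_self, Pi.zero_apply] at h1 h3 h4
      have := mul_nonneg h2.le h3
      have := mul_pos h2 (add_pos_of_pos_of_nonneg (mul_pos hp one_pos) (mul_nonneg hq.le h4))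
      linarith
    · obtain ⟨hne', hk, rfl⟩ := eq_of_coloredRefl_eq_zero hρ
      simp only at hne' hk
      subst hk
      have hsupp' := supportedIn_of_mem_coloredInvSeq hV hρ'
      have e := omega_simpleRefl ha hF hc (hsupp'.simpleRefl (a := a)
        (List.mem_cons_self (a := s) (l := d))) (hsupp.simpleRefl (a := a)
        (List.mem_cons_self (a := s) (l := d)))
      rw [ha.simpleRefl_simpleRefl, ha.simpleRefl_simpleRefl] at e
      rw [← e]
      obtain ⟨h1, h2⟩ := ih hcs hQ hγ' hρ'
      refine ⟨h1, fun σ p q hσ hσ' hp hq e' => ?_⟩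
      have hσs : σ ≠ simpleRoot s := by
        rintro rfl
        exact hσ' (mem_coloredInvSeq_cons.2 (Or.inl rfl))
      refine h2 (simpleRefl a s σ) p q (hσ.simpleRefl cs ha hr hσs) (fun hm => hσ' ?_) hp hq ?_
      · refine mem_coloredInvSeq_cons.2 (Or.inr ⟨_, hm, ?_⟩)
        rw [coloredRefl_of_ne (hσ.simpleRefl_ne ha s)]
        simp only [ha.simpleRefl_simpleRefl]
      · have := congrArg (simpleReflLin a s) e'
        simpa only [map_add, map_smul, simpleReflLin_apply, ha.simpleRefl_simpleRefl] using this

/-- F is invariant, so the first letters can be removed until the moment when ρ rises from color 0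
to color 1. There ρ = α_s is also an inversion of the rest of the word, and
`IsSortingSeq.omega_nonpos` bounds ω from the other side. -/
theorem IsSortingSeq.form_eq_zero {c Q : List B} (h : IsSortingSeq c Q) (hc : c.Nodup)
    {V : List B} {x : B} (hQ : Q = V ++ [x]) {γ ρ : B → ℝ} {l : ℕ}
    (hγ : coloredAct a V (simpleRoot x, 0) = (γ, 0)) (hρ : (ρ, l + 1) ∈ coloredInvSeq a V) :
    F ρ γ = 0 := by
  induction h generalizing V γ ρ l with
  | nil => simp at hQ
  | @skip s d Q h ih => exact ih (List.nodup_cons.1 hc).2 hQ hγ hρ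
  | @use s d Q h ih =>
    rcases V with _ | ⟨t, V⟩
    · simp [coloredInvSeq] at hρ
    rw [List.cons_append, List.cons.injEq] at hQ
    obtain ⟨rfl, hQ⟩ := hQ
    have hcs := IsSortingSeq.nodup_concat hc
    have hs : s ∉ d := (List.nodup_cons.1 hc).1
    have hsub : ∀ t, t ∈ d ++ [s] → t ∈ s :: d := fun t ht =>
      (List.perm_append_singleton s d).mem_iff.1 ht
    have hV : ∀ t ∈ V, t ∈ s :: d := fun t ht => hsub t (h.mem (hQ ▸ List.mem_append_left _ ht))
    have hx : x ∈ s :: d :=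
      hsub x (h.mem (hQ ▸ List.mem_append_right _ (List.mem_singleton_self x)))
    rw [coloredAct_cons] at hγ
    have hpos := IsPosRoot.coloredAct cs ha hr (b := (simpleRoot x, 0)) (isPosRoot_simpleRoot x) V
    have hsupp := SupportedIn.coloredAct (a := a) hV (b := (simpleRoot x, 0))
        (supportedIn_simpleRoot hx)
    rcases hγ' : coloredAct a V (simpleRoot x, 0) with ⟨γ', k⟩
    rw [hγ'] at hγ hpos hsupp
    obtain ⟨hne, hk, rfl⟩ := eq_of_coloredRefl_eq_zero hγ
    simp only at hne hk hpos hsupp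
    subst hk
    rcases mem_coloredInvSeq_cons.1 hρ with hρ | ⟨⟨ρ', k⟩, hρ', hρ⟩
    · simp at hρ
    by_cases hρs : ρ' = simpleRoot s
    · subst hρs
      rw [coloredRefl_of_eq, Prod.mk.injEq, Nat.add_right_cancel_iff] at hρ
      obtain ⟨rfl, rfl⟩ := hρ
      suffices h0 : F (simpleRoot s) γ' = 0 by
        rw [← hF.simpleRefl s, ha.simpleRefl_simpleRefl, ha.simpleRefl_simpleRoot_self, map_neg,
          LinearMap.neg_apply, h0, neg_zero]
      rcases k with _ | k
      -- Transporting ω_{ds}(α_s, γ') ≤ 0 to the word sd reverses the sign, since s(α_s) = -α_s. So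
      -- the nonpositive partial sum is 0, and then γ' and sγ' have opposite nonnegative
      -- s-coordinates, both 0.
      · have h1 := (h.omega_nonpos cs ha hr hF hcs hQ hγ' hρ').1
        have e := omega_simpleRefl ha hF hc (supportedIn_simpleRoot
          (List.mem_cons_self (a := s) (l := d))) (hsupp.simpleRefl (a := a)
          (List.mem_cons_self (a := s) (l := d)))
        have hlin : ∀ y, omega F (d ++ [s]) (-simpleRoot s) y =
            -omega F (d ++ [s]) (simpleRoot s) y := by
          intro y
          have := omega_lin F (d ++ [s]) y (simpleRoot s) 0 (-1) 0
          rw [zero_smul, add_zero, neg_one_smul] at this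
          rw [omega_antisymm, this, omega_antisymm F _ (simpleRoot s) y]
          ring
        have hc' : ∀ t ∈ d, simpleRefl a s γ' t = γ' t := fun t ht =>
          simpleRefl_apply_ne a (s := s) (t := t) (fun e => hs (e ▸ ht)) γ'
        rw [ha.simpleRefl_simpleRefl, ha.simpleRefl_simpleRoot_self, omega_cons_simpleRoot F hs,
          hlin, partialForm_congr F s hc'] at e
        have h2 := partialForm_nonpos ha hF hs hpos.2
        have h3 : partialForm F d s γ' = 0 := by linarith
        have h4 := form_mul_simpleRefl_apply_self ha hF hc hsupp
        have h5 : 0 ≤ F (simpleRoot s) (simpleRoot s) * simpleRefl a s γ' s :=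
          mul_nonneg (hF.simpleRoot_pos s).le ((hpos.simpleRefl cs ha hr hne).2 s)
        have h6 : 0 ≤ F (simpleRoot s) (simpleRoot s) * γ' s :=
          mul_nonneg (hF.simpleRoot_pos s).le (hpos.2 s)
        rw [form_simpleRoot_eq hc hsupp, h3]
        linarith
      · exact ih hcs hQ hγ' hρ'
    · rw [coloredRefl_of_ne (b := (ρ', k)) hρs, Prod.mk.injEq] at hρ
      obtain ⟨rfl, rfl⟩ := hρ
      rw [hF.simpleRefl]
      exact ih hcs hQ hγ' hρ'

end Sorting

/-! ### Separating the colors -/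

section Split

open ArtinMonoid

variable {B : Type*} [Fintype B] {M : CoxeterMatrix B} {a : Matrix B B ℝ}

/-- The properties of the prefix `V x` of a sorting word that determine the position of its last
colored inversion, when this has color `0`, with respect to the earlier ones. -/
def IsAlignedAt (a : Matrix B B ℝ) (F : LinearMap.BilinForm ℝ (B → ℝ)) (c V : List B) (x : B) :
    Prop :=
  ∀ γ : B → ℝ, coloredAct a V (simpleRoot x, 0) = (γ, 0) →
    (∀ (ρ σ : B → ℝ) (p q : ℝ), (ρ, 0) ∈ coloredInvSeq a V → IsPosRoot a σ →
      (σ, 0) ∉ coloredInvSeq a V → 0 < p → 0 < q → γ = p • ρ + q • σ → omega F c ρ γ < 0) ∧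
    ∀ (ρ : B → ℝ) (l : ℕ), (ρ, l + 1) ∈ coloredInvSeq a V → F ρ γ = 0

/-- All prefixes of the word `Z` are aligned. -/
def IsAligned (a : Matrix B B ℝ) (F : LinearMap.BilinForm ℝ (B → ℝ)) (c Z : List B) : Prop :=
  ∀ V x R, Z = V ++ x :: R → IsAlignedAt a F c V x

variable {F : LinearMap.BilinForm ℝ (B → ℝ)} {c : List B}

theorem IsAligned.left {Z R : List B} (h : IsAligned a F c (Z ++ R)) : IsAligned a F c Z :=
  fun V x S e => h V x (S ++ R) (by rw [e, List.append_assoc, List.cons_append])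

theorem isAligned_concat {V : List B} {x : B} :
    IsAligned a F c (V ++ [x]) ↔ IsAligned a F c V ∧ IsAlignedAt a F c V x := by
  refine ⟨fun h => ⟨h.left, h V x [] rfl⟩, fun h V' x' R e => ?_⟩
  induction R using List.reverseRecOn with
  | nil =>
    obtain ⟨rfl, e2⟩ := List.append_inj' e rfl
    rw [List.cons.injEq] at e2
    exact e2.1 ▸ h.2
  | append_singleton R y _ =>
    rw [← List.cons_append, ← List.append_assoc] at e
    exact h.1 V' x' R (List.append_inj' e rfl).1

theorem isAligned_nil : IsAligned a F c [] := fun V x R e => by simp at e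

variable {W : Type*} [Group W] (cs : CoxeterSystem M W) (ha : IsGeneralizedCartanMatrix M a)

section

variable [Finite W] (hF : IsInvariantForm a F)
include cs ha hF

/-- Orthogonality gives cos(π/m_{rx}) = 0, hence m_{rx} = 2, because the cosine is positive for
m_{rx} ≥ 3. -/
theorem gen_mul_gen_comm {r x : B} (h : F (simpleRoot r) (simpleRoot x) = 0) :
    gen M r * gen M x = gen M x * gen M r := by
  have hne : r ≠ x := by
    rintro rfl
    exact (hF.simpleRoot_pos r).ne' h
  have h0 : a r x = 0 := by
    rw [hF.simpleRoot_eq_zero_iff ha, mulVec_simpleRoot] at h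
    exact h
  have h1 := ha.mul_eq r x hne
  rw [h0, zero_mul] at h1
  have hM : M r x = 2 := by
    by_contra hM
    have hM0 := cs.apply_ne_zero_of_finite ha r x
    have hM1 : M r x ≠ 1 := M.off_diagonal r x hne
    have hM3 : (3 : ℝ) ≤ M r x := by
      have : 3 ≤ M r x := by omega
      exact_mod_cast this
    have hc : 0 < Real.cos (Real.pi / M r x) := by
      apply Real.cos_pos_of_mem_Ioo
      constructor
      · have : 0 < Real.pi / M r x := by positivity
        linarith [Real.pi_pos]
      · exact div_lt_div_of_pos_left Real.pi_pos two_pos (by linarith)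
    have := pow_pos hc 2
    linarith
  have := ofWord_braidWord (M := M) r x
  rw [CoxeterSystem.braidWord, CoxeterSystem.braidWord, M.symmetric x r, hM] at this
  simpa [CoxeterSystem.alternatingWord, ofWord_cons, ofWord_nil] using this

variable (hr : IsReducedRoots a)
include hr

omit [Group W] cs [Finite W] hr in
-- The last letter r of U comes first: invariance reduces its condition to F(α_r, α_x) = 0, so r
-- fixes α_x and can be removed.
theorem form_eq_zero_of_foldr {U : List B} {x : B}
    (h : ∀ U₁ r U₂, U = U₁ ++ r :: U₂ →
      F (U₁.foldr (simpleRefl a) (simpleRoot r)) (U.foldr (simpleRefl a) (simpleRoot x)) = 0) :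
    (∀ r ∈ U, F (simpleRoot r) (simpleRoot x) = 0) ∧
      U.foldr (simpleRefl a) (simpleRoot x) = simpleRoot x := by
  induction U using List.reverseRecOn with
  | nil => simp
  | append_singleton U r ih =>
    have h1 := h U r [] rfl
    rw [List.foldr_append, hF.foldr, List.foldr_cons, List.foldr_nil, ← hF.simpleRefl r,
      ha.simpleRefl_simpleRefl, ha.simpleRefl_simpleRoot_self, map_neg, LinearMap.neg_apply,
      neg_eq_zero] at h1
    have h2 : simpleRefl a r (simpleRoot x) = simpleRoot x := by
      rw [hF.simpleRefl_eq ha, h1]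
      simp
    have e : (U ++ [r]).foldr (simpleRefl a) (simpleRoot x) =
        U.foldr (simpleRefl a) (simpleRoot x) := by
      rw [List.foldr_append, List.foldr_cons, List.foldr_nil, h2]
    rw [e] at h ⊢
    obtain ⟨h3, h4⟩ := ih fun U₁ t U₂ hU =>
      h U₁ t (U₂ ++ [r]) (by rw [hU, List.append_assoc, List.cons_append])
    refine ⟨fun t ht => ?_, h4⟩
    rcases List.mem_append.1 ht with ht | ht
    · exact h3 t ht
    · rw [List.mem_singleton.1 ht]
      exact h1

/-- The letters of U create the inversions of positive color, which are orthogonal to γ. Pulling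
this back along V₀U shows that each letter of U is orthogonal to α_x, hence commutes with x and does
not affect the root created by x. -/
theorem IsAlignedAt.commute {V V₀ U : List B} {x : B} {γ : B → ℝ} (hV : IsAlignedAt a F c V x)
    (e : ofWord M V = ofWord M (V₀ ++ U)) (h0 : ∀ b ∈ coloredInvSeq a V, b.2 = 0 →
      b ∈ coloredInvSeq a V₀) (hγ : coloredAct a V (simpleRoot x, 0) = (γ, 0)) :
    ofWord M U * gen M x = gen M x * ofWord M U ∧
      coloredAct a V₀ (simpleRoot x, 0) = (γ, 0) ∧ IsAlignedAt a F c V₀ x := by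
  have hmem := mem_coloredInvSeq_iff_of_ofWord_eq cs ha hr e
  have hact := coloredAct_eq_of_ofWord_eq cs ha hr e (b := (simpleRoot x, 0))
    (isPosRoot_simpleRoot x)
  rw [hγ] at hact
  have hfold : γ = (V₀ ++ U).foldr (simpleRefl a) (simpleRoot x) := by
    have := coloredAct_fst_of_color_eq (a := a) (Q := V₀ ++ U) (b := (simpleRoot x, 0))
      (by rw [← hact])
    rw [← hact] at this
    exact this
  obtain ⟨h1, h2⟩ := form_eq_zero_of_foldr ha hF (U := U) (x := x) (by
    rintro U₁ r U₂ rfl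
    have hb : coloredAct a (V₀ ++ U₁) (simpleRoot r, 0) ∈ coloredInvSeq a V := by
      rw [hmem, ← List.append_assoc, mem_coloredInvSeq_append]
      exact Or.inr ⟨_, mem_coloredInvSeq_cons.2 (Or.inl rfl), rfl⟩
    have hb' : coloredAct a (V₀ ++ U₁) (simpleRoot r, 0) ∉ coloredInvSeq a V₀ := by
      rw [coloredAct_append]
      refine notMem_coloredInvSeq_of_append cs ha hr (R := U₁ ++ r :: U₂) ?_
      rw [mem_coloredInvSeq_append]
      exact Or.inr ⟨_, mem_coloredInvSeq_cons.2 (Or.inl rfl), rfl⟩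
    -- This inversion comes from U, so it is not one of V₀ and has positive color.
    have hl := fun h => hb' (h0 _ hb h)
    have hor := coloredAct_fst ha (V₀ ++ U₁) (simpleRoot r, 0)
    rcases hβ : coloredAct a (V₀ ++ U₁) (simpleRoot r, 0) with ⟨β, l⟩
    rw [hβ] at hb hl hor
    obtain ⟨l, rfl⟩ := Nat.exists_eq_succ_of_ne_zero hl
    have h3 := (hV γ hγ).2 β l hb
    rw [hfold, List.foldr_append] at h3
    rw [List.foldr_append] at hor
    rcases hor with rfl | rfl
    · rwa [hF.foldr] at h3
    · rwa [map_neg, LinearMap.neg_apply, hF.foldr, neg_eq_zero] at h3)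
  have hcol : coloredAct a V₀ (simpleRoot x, 0) = (γ, 0) := by
    have hU : coloredAct a U (simpleRoot x, 0) = (simpleRoot x, 0) := by
      clear hfold h2 hact e hmem
      induction U with
      | nil => rfl
      | cons r U ih =>
        have h3 := h1 r List.mem_cons_self
        rw [coloredAct_cons, ih fun t ht => h1 t (List.mem_cons_of_mem _ ht),
          coloredRefl_of_ne, hF.simpleRefl_eq ha, h3]
        · simp
        · intro h4
          simp only at h4
          rw [← h4] at h3
          exact (hF.simpleRoot_pos x).ne' h3
    rw [hact, coloredAct_append, hU]
  refine ⟨?_, hcol, fun γ' hγ' => ?_⟩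
  · clear hfold h2 hact e hmem
    induction U with
    | nil => rw [ofWord_nil, one_mul, mul_one]
    | cons r U ih =>
      rw [ofWord_cons, mul_assoc, ih fun t ht => h1 t (List.mem_cons_of_mem _ ht), ← mul_assoc,
        gen_mul_gen_comm cs ha hF (h1 r List.mem_cons_self), mul_assoc]
  · rw [hcol, Prod.mk.injEq] at hγ'
    obtain ⟨rfl, -⟩ := hγ'
    obtain ⟨h3, h4⟩ := hV γ hγ
    have hsub : ∀ b ∈ coloredInvSeq a V₀, b ∈ coloredInvSeq a V := fun b hb => by
      rw [hmem, mem_coloredInvSeq_append]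
      exact Or.inl hb
    exact ⟨fun ρ σ p q hρ hσ hσ' => h3 ρ σ p q (hsub _ hρ) hσ fun h => hσ' (h0 _ h rfl),
      fun ρ l hρ => h4 ρ l (hsub _ hρ)⟩

/-- V₀ collects the letters of color 0 and U those of positive color; a new letter of color 0 passes
through U by commutation. -/
theorem IsAligned.exists_split {Z : List B} (hZ : IsAligned a F c Z) :
    ∃ V₀ U, ofWord M Z = ofWord M (V₀ ++ U) ∧ IsAligned a F c V₀ ∧
      (∀ b ∈ coloredInvSeq a V₀, b.2 = 0) ∧
      ∀ b ∈ coloredInvSeq a Z, b.2 = 0 → b ∈ coloredInvSeq a V₀ := by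
  induction Z using List.reverseRecOn with
  | nil => exact ⟨[], [], rfl, isAligned_nil, by simp [coloredInvSeq], fun b hb _ => hb⟩
  | append_singleton V x ih =>
    obtain ⟨hV, hx⟩ := isAligned_concat.1 hZ
    obtain ⟨V₀, U, e, h1, h2, h3⟩ := ih hV
    rcases hγ : coloredAct a V (simpleRoot x, 0) with ⟨γ, k⟩
    rcases k with _ | k
    · obtain ⟨h4, h5, h6⟩ := hx.commute cs ha hF hr e h3 hγ
      refine ⟨V₀ ++ [x], U, ?_, isAligned_concat.2 ⟨h1, h6⟩, fun b hb => ?_, fun b hb hb0 => ?_⟩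
      · rw [ofWord_concat, e, ofWord_append, ofWord_append, ofWord_concat, mul_assoc, h4, mul_assoc]
      · rcases mem_coloredInvSeq_concat.1 hb with hb | rfl
        · exact h2 b hb
        · rw [h5]
      · rcases mem_coloredInvSeq_concat.1 hb with hb | rfl
        · exact mem_coloredInvSeq_concat.2 (Or.inl (h3 b hb hb0))
        · exact mem_coloredInvSeq_concat.2 (Or.inr (by rw [hγ, h5]))
    · refine ⟨V₀, U ++ [x], ?_, h1, h2, fun b hb hb0 => ?_⟩
      · rw [ofWord_concat, e, ← List.append_assoc, ofWord_concat]
      · rcases mem_coloredInvSeq_concat.1 hb with hb | rfl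
        · exact h3 b hb hb0
        · rw [hγ] at hb0
          simp at hb0

/-- The letters that create inversions of nonzero color can be moved behind a letter that creates
an inversion of color `0`. -/
theorem IsAligned.exists_split_concat {V : List B} {x : B} (hV : IsAligned a F c (V ++ [x]))
    {γ : B → ℝ} (hγ : coloredAct a V (simpleRoot x, 0) = (γ, 0)) :
    ∃ V₀ U, ofWord M V = ofWord M V₀ * ofWord M U ∧
      ofWord M U * gen M x = gen M x * ofWord M U ∧
      coloredAct a V₀ (simpleRoot x, 0) = (γ, 0) ∧ IsAligned a F c (V₀ ++ [x]) ∧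
      ∀ b ∈ coloredInvSeq a (V₀ ++ [x]), b.2 = 0 := by
  obtain ⟨hV', hx⟩ := isAligned_concat.1 hV
  obtain ⟨V₀, U, e, h1, h2, h3⟩ := hV'.exists_split cs ha hF hr
  obtain ⟨h4, h5, h6⟩ := hx.commute cs ha hF hr e h3 hγ
  refine ⟨V₀, U, by rw [e, ofWord_append], h4, h5, isAligned_concat.2 ⟨h1, h6⟩, fun b hb => ?_⟩
  rcases mem_coloredInvSeq_concat.1 hb with hb | rfl
  · exact h2 b hb
  · rw [h5]

omit [Finite W] in
theorem IsSortingSeq.isAligned {Q : List B} (h : IsSortingSeq c Q) (hc : c.Nodup) :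
    IsAligned a F c Q := by
  rintro V x R rfl γ hγ
  have h' : IsSortingSeq c (V ++ [x]) :=
    IsSortingSeq.left (R := R) (by rwa [List.append_assoc, List.singleton_append])
  exact ⟨fun ρ σ p q hρ hσ hσ' hp hq e =>
    (h'.omega_nonpos cs ha hr hF hc rfl hγ hρ).2 σ p q hσ hσ' hp hq e,
    fun ρ l hρ => h'.form_eq_zero cs ha hr hF hc rfl hγ hρ⟩

omit hr in
-- The conjugation identity in W equates two reduced words, so it lifts to B⁺ by Matsumoto's
-- theorem.
theorem ofWord_mul_gen_eq {P : List B} {x e : B} (hP : cs.IsReduced (P ++ [x]))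
    (h : cs.geomRep ha (cs.wordProd P) (simpleRoot x) = simpleRoot e) :
    ofWord M P * gen M x = gen M e * ofWord M P := by
  have h1 := hF.mul_simple_eq ha cs h
  have h2 : cs.wordProd (P ++ [x]) = cs.wordProd (e :: P) := by
    rw [cs.wordProd_append, cs.wordProd_singleton, h1, cs.wordProd_cons]
  rw [← ofWord_concat, ← ofWord_cons]
  refine cs.ofWord_eq_of_wordProd_eq ha hP ?_ h2
  rw [CoxeterSystem.IsReduced, ← h2, hP.eq]
  simp

end

theorem exists_append_of_mem_coloredInvSeq {Q : List B} {b : (B → ℝ) × ℕ}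
    (h : b ∈ coloredInvSeq a Q) :
    ∃ V x R, Q = V ++ x :: R ∧ coloredAct a V (simpleRoot x, 0) = b := by
  induction Q using List.reverseRecOn with
  | nil => simp [coloredInvSeq] at h
  | append_singleton Q x ih =>
    rcases mem_coloredInvSeq_concat.1 h with h | rfl
    · obtain ⟨V, y, R, rfl, e⟩ := ih h
      exact ⟨V, y, R ++ [x], by rw [List.append_assoc, List.cons_append], e⟩
    · exact ⟨Q, x, [], rfl, rfl⟩

include cs ha in
/-- If a letter of a sorting word creates an inversion of positive color, then it is conjugate to
an earlier letter that creates the inversion with the same root and color `0`. -/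
theorem IsSortingSeq.exists_chain [Finite W] (hF : IsInvariantForm a F) (hr : IsReducedRoots a)
    (hc : c.Nodup) {V : List B} {x : B} {β : B → ℝ} {k : ℕ} (h : IsSortingSeq c (V ++ [x]))
    (hβ : coloredAct a V (simpleRoot x, 0) = (β, k)) :
    ∃ V₀ x₀ P, IsSortingSeq c (V₀ ++ [x₀]) ∧ coloredAct a V₀ (simpleRoot x₀, 0) = (β, 0) ∧
      ofWord M V = ofWord M V₀ * P ∧ P * gen M x = gen M x₀ * P := by
  induction k generalizing V x with
  | zero => exact ⟨V, x, 1, h, hβ, (mul_one _).symm, by rw [one_mul, mul_one]⟩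
  | succ k ih =>
    -- The same root with color one less was created by an earlier letter y; it remains to conjugate
    -- x to y across yR.
    obtain ⟨V₁, y, R, rfl, hy⟩ :=
      exists_append_of_mem_coloredInvSeq (mem_coloredInvSeq_of_color_succ hβ)
    have h1 : IsSortingSeq c (V₁ ++ [y]) := by
      refine IsSortingSeq.left (R := R ++ [x]) ?_
      rwa [List.append_assoc, List.cons_append] at h ⊢
    obtain ⟨V₀, x₀, P, h2, h3, h4, h5⟩ := ih h1 hy
    refine ⟨V₀, x₀, P * (gen M y * ofWord M R), h2, h3, ?_, ?_⟩
    · rw [ofWord_append, h4, ofWord_cons, mul_assoc]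
    -- Cancelling V₁ and then y from the two colored roots, which differ by one color, leaves
    -- R(α_x⁽⁰⁾) = α_y⁽⁰⁾.
    have hR : coloredAct a R (simpleRoot x, 0) = (simpleRoot y, 0) := by
      have hpx := isPosRoot_simpleRoot (a := a) x
      have hpy := isPosRoot_simpleRoot (a := a) y
      rw [coloredAct_append] at hβ
      have e1 := coloredAct_add (a := a) V₁ (simpleRoot y, 0) 1
      rw [hy, ← hβ] at e1
      have e2 := coloredAct_injOn cs ha hr (b := (simpleRoot y, 0 + 1))
        hpy (IsPosRoot.coloredAct cs ha hr (b := (simpleRoot x, 0)) hpx (y :: R)) e1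
      rw [coloredAct_cons, ← coloredRefl_of_eq] at e2
      exact (coloredRefl_injOn ha (b := (simpleRoot y, 0)) hpy
        (IsPosRoot.coloredAct cs ha hr (b := (simpleRoot x, 0)) hpx R) e2).symm
    obtain ⟨c', h6, h7⟩ : ∃ c', IsSortingSeq c' (R ++ [x]) ∧ (c.Nodup → c'.Nodup) := by
      refine IsSortingSeq.right (c := c) (Q := V₁ ++ [y]) ?_
      rw [List.append_assoc, List.cons_append] at h
      rwa [List.append_assoc, List.singleton_append]
    -- Rx is itself a sorting sequence whose last inversion has color 0: its part U commutes with x,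
    -- and its reduced part Z conjugates x to y.
    obtain ⟨Z, U, h8, h9, h10, -, h12⟩ :=
      (h6.isAligned cs ha hF hr (h7 hc)).exists_split_concat cs ha hF hr hR
    have hred := isReduced_of_color_eq_zero cs ha hr h12
    have h13 : ofWord M Z * gen M x = gen M y * ofWord M Z := by
      refine ofWord_mul_gen_eq cs ha hF hred ?_
      have := coloredAct_fst_of_color_eq (a := a) (Q := Z) (b := (simpleRoot x, 0)) (by rw [h10])
      rw [h10] at this
      rw [cs.geomRep_wordProd]
      exact this.symm
    calc P * (gen M y * ofWord M R) * gen M x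
        = P * gen M y * (ofWord M Z * (ofWord M U * gen M x)) := by rw [h8]; simp only [mul_assoc]
      _ = P * gen M y * ((ofWord M Z * gen M x) * ofWord M U) := by rw [h9, mul_assoc (ofWord M Z)]
      _ = gen M x₀ * (P * (gen M y * ofWord M R)) := by
        rw [h13, h5, h8]
        simp only [mul_assoc]

end Split

/-! ### Colored inversions of meets -/

section Meet

open ArtinMonoid

variable {B : Type*} {M : CoxeterMatrix B}

/-- The elements `X x` and `Y y` have a common left factor `h` such that the remaining factors of
`X` and `Y` conjugate `x` and `y` to one simple generator. -/
def HaveCommonBase (X Y : ArtinMonoid M) (x y : B) : Prop :=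
  ∃ h p q e, X = h * p ∧ Y = h * q ∧ p * gen M x = gen M e * p ∧ q * gen M y = gen M e * q

theorem exists_eq_gen_of_length_eq_one {z : ArtinMonoid M} (h : ArtinMonoid.length z = 1) :
    ∃ e, z = gen M e := by
  obtain ⟨Q, rfl⟩ := ofWord_surjective z
  rw [length_ofWord, List.length_eq_one_iff] at h
  obtain ⟨e, rfl⟩ := h
  exact ⟨e, rfl⟩

variable [Fintype B] {a : Matrix B B ℝ} {W : Type*} [Group W] [Finite W] (cs : CoxeterSystem M W)
  (ha : IsGeneralizedCartanMatrix M a)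

include cs ha in
-- After cancelling h, let g = p ∧ q and em = ep ∧ eq. Then m ≤ g, and g ≤ em because g ≤ p ≤ px =
-- ep and likewise for q. So g ≤ eg, and comparing lengths gives eg = ge' for a generator e'.
theorem HaveCommonBase.exists_mul_gen_le {X Y g : ArtinMonoid M} {x y : B}
    (h : HaveCommonBase X Y x y) (hg : IsGLB {X, Y} g) :
    ∃ e, g * gen M e ≤ X * gen M x ∧ g * gen M e ≤ Y * gen M y := by
  obtain ⟨h, p, q, e, rfl, rfl, hp, hq⟩ := h
  have hlb : ∀ {u v z : ArtinMonoid M}, z ∈ lowerBounds {u, v} ↔ z ≤ u ∧ z ≤ v := by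
    intro u v z
    simp [lowerBounds]
  obtain ⟨hgp, hgq⟩ := hlb.1 hg.1
  obtain ⟨g, rfl⟩ := le_iff.1 (hg.2 (hlb.2 ⟨le_mul_right h p, le_mul_right h q⟩))
  have hgp' := cs.artin_le_of_mul_le_mul ha hgp
  have hgq' := cs.artin_le_of_mul_le_mul ha hgq
  obtain ⟨m, hm⟩ := cs.exists_isGLB ha (gen M e * p) (gen M e * q)
  obtain ⟨m, rfl⟩ := le_iff.1 (hm.2 (hlb.2 ⟨le_mul_right (gen M e) p, le_mul_right (gen M e) q⟩))
  obtain ⟨hmp, hmq⟩ := hlb.1 hm.1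
  have h1 : m ≤ g := by
    refine cs.artin_le_of_mul_le_mul ha (hg.2 (hlb.2 ⟨?_, ?_⟩))
    · exact mul_le_mul_left (cs.artin_le_of_mul_le_mul ha hmp) h
    · exact mul_le_mul_left (cs.artin_le_of_mul_le_mul ha hmq) h
  have h2 : g ≤ gen M e * m := by
    refine hm.2 (hlb.2 ⟨?_, ?_⟩)
    · rw [← hp]; exact hgp'.trans (le_mul_right _ _)
    · rw [← hq]; exact hgq'.trans (le_mul_right _ _)
  obtain ⟨z, hz⟩ := le_iff.1 (h2.trans (mul_le_mul_left h1 _))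
  have hl := congrArg ArtinMonoid.length hz
  rw [ArtinMonoid.length_mul, ArtinMonoid.length_mul, length_gen] at hl
  obtain ⟨e', rfl⟩ := exists_eq_gen_of_length_eq_one (z := z) (by omega)
  refine ⟨e', ?_, ?_⟩
  · rw [mul_assoc, hz, mul_assoc, hp]
    exact mul_le_mul_left (mul_le_mul_left hgp' _) _
  · rw [mul_assoc, hz, mul_assoc, hq]
    exact mul_le_mul_left (mul_le_mul_left hgq' _) _

variable (hr : IsReducedRoots a)
include cs ha hr

omit [Finite W] in
theorem coloredInv_concat (Q : List B) (x : B) : coloredInv a (ofWord M Q * gen M x) =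
    coloredInv a (ofWord M Q) ∪ {coloredAct a Q (simpleRoot x, 0)} := by
  rw [← ofWord_concat, coloredInv_ofWord cs ha hr, coloredInv_ofWord cs ha hr]
  ext b
  exact mem_coloredInvSeq_concat

/-- The inversion set of a meet is the intersection of the inversion sets if prefixes that create
the same colored inversion have a common base. -/
theorem coloredInv_eq_inter_of_haveCommonBase {Q₁ Q₂ : List B}
    (hB : ∀ V₁ x₁ R₁ V₂ x₂ R₂, Q₁ = V₁ ++ x₁ :: R₁ → Q₂ = V₂ ++ x₂ :: R₂ →
      coloredAct a V₁ (simpleRoot x₁, 0) = coloredAct a V₂ (simpleRoot x₂, 0) →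
      (∀ g, IsGLB {ofWord M V₁, ofWord M V₂} g →
        coloredInv a g = coloredInv a (ofWord M V₁) ∩ coloredInv a (ofWord M V₂)) →
      HaveCommonBase (ofWord M V₁) (ofWord M V₂) x₁ x₂) {g : ArtinMonoid M}
    (hg : IsGLB {ofWord M Q₁, ofWord M Q₂} g) :
    coloredInv a g = coloredInv a (ofWord M Q₁) ∩ coloredInv a (ofWord M Q₂) := by
  have hlb : ∀ {u v z : ArtinMonoid M}, z ∈ lowerBounds {u, v} ↔ z ≤ u ∧ z ≤ v := by
    intro u v z
    simp [lowerBounds]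
  induction hn : Q₁.length + Q₂.length using Nat.strong_induction_on generalizing Q₁ Q₂ g with
  | _ n ih =>
    subst hn
    obtain ⟨hg1, hg2⟩ := hlb.1 hg.1
    refine Set.Subset.antisymm
      (Set.subset_inter (coloredInv_mono hg1) (coloredInv_mono hg2)) ?_
    rcases List.eq_nil_or_concat' Q₁ with rfl | ⟨V₁, x₁, rfl⟩
    · rintro b ⟨hb, -⟩
      rw [coloredInv_ofWord cs ha hr] at hb
      simp [coloredInvSeq] at hb
    rcases List.eq_nil_or_concat' Q₂ with rfl | ⟨V₂, x₂, rfl⟩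
    · rintro b ⟨-, hb⟩
      rw [coloredInv_ofWord cs ha hr] at hb
      simp [coloredInvSeq] at hb
    simp only [ofWord_concat] at hg hg1 hg2 ⊢
    have ih1 : ∀ g', IsGLB {ofWord M V₁, ofWord M V₂ * gen M x₂} g' → coloredInv a g' =
        coloredInv a (ofWord M V₁) ∩ coloredInv a (ofWord M V₂ * gen M x₂) := by
      intro g' hg'
      rw [← ofWord_concat] at hg' ⊢
      refine ih _ (by simp) (fun W₁ y₁ S₁ W₂ y₂ S₂ e1 e2 =>
        hB W₁ y₁ (S₁ ++ [x₁]) W₂ y₂ S₂ ?_ e2) hg' rfl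
      rw [e1, List.append_assoc, List.cons_append]
    have ih2 : ∀ g', IsGLB {ofWord M V₁ * gen M x₁, ofWord M V₂} g' → coloredInv a g' =
        coloredInv a (ofWord M V₁ * gen M x₁) ∩ coloredInv a (ofWord M V₂) := by
      intro g' hg'
      rw [← ofWord_concat] at hg' ⊢
      refine ih _ (by simp) (fun W₁ y₁ S₁ W₂ y₂ S₂ e1 e2 =>
        hB W₁ y₁ S₁ W₂ y₂ (S₂ ++ [x₂]) e1 ?_) hg' rfl
      rw [e2, List.append_assoc, List.cons_append]
    have ih3 : ∀ g', IsGLB {ofWord M V₁, ofWord M V₂} g' → coloredInv a g' =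
        coloredInv a (ofWord M V₁) ∩ coloredInv a (ofWord M V₂) := by
      intro g' hg'
      refine ih _ (by simp; omega) (fun W₁ y₁ S₁ W₂ y₂ S₂ e1 e2 =>
        hB W₁ y₁ (S₁ ++ [x₁]) W₂ y₂ (S₂ ++ [x₂]) ?_ ?_) hg' rfl
      · rw [e1, List.append_assoc, List.cons_append]
      · rw [e2, List.append_assoc, List.cons_append]
    rintro b ⟨hb1, hb2⟩
    have hb1' := hb1
    have hb2' := hb2
    rw [coloredInv_concat cs ha hr] at hb1' hb2'
    rcases hb1' with hb1' | hb1'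
    · obtain ⟨g', hg'⟩ := cs.exists_isGLB ha (ofWord M V₁) (ofWord M V₂ * gen M x₂)
      obtain ⟨h1, h2⟩ := hlb.1 hg'.1
      refine coloredInv_mono (hg.2 (hlb.2 ⟨h1.trans (le_mul_right _ _), h2⟩)) ?_
      rw [ih1 g' hg']
      exact ⟨hb1', hb2⟩
    rcases hb2' with hb2' | hb2'
    · obtain ⟨g', hg'⟩ := cs.exists_isGLB ha (ofWord M V₁ * gen M x₁) (ofWord M V₂)
      obtain ⟨h1, h2⟩ := hlb.1 hg'.1
      refine coloredInv_mono (hg.2 (hlb.2 ⟨h1, h2.trans (le_mul_right _ _)⟩)) ?_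
      rw [ih2 g' hg']
      exact ⟨hb1, hb2'⟩
    rw [Set.mem_singleton_iff] at hb1' hb2'
    have hbase := hB V₁ x₁ [] V₂ x₂ [] (by simp) (by simp) (hb1'.symm.trans hb2') ih3
    obtain ⟨g₀, hg₀⟩ := cs.exists_isGLB ha (ofWord M V₁) (ofWord M V₂)
    obtain ⟨e, he1, he2⟩ := hbase.exists_mul_gen_le cs ha hg₀
    obtain ⟨G, rfl⟩ := ofWord_surjective g₀
    have h1 := coloredInv_concat cs ha hr G e
    -- The inversion created by e lies in both larger sets but not in both smaller ones, so it is
    -- the one created by x₁ or by x₂; these are equal.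
    have hz : coloredAct a G (simpleRoot e, 0) = b := by
      have hm : coloredAct a G (simpleRoot e, 0) ∈ coloredInv a (ofWord M G * gen M e) := by
        rw [h1]; exact Or.inr rfl
      have hn : coloredAct a G (simpleRoot e, 0) ∉
          coloredInv a (ofWord M V₁) ∩ coloredInv a (ofWord M V₂) := by
        rw [← ih3 _ hg₀, coloredInv_ofWord cs ha hr]
        exact notMem_coloredInvSeq_last cs ha hr G e
      have hm1 := coloredInv_mono he1 hm
      have hm2 := coloredInv_mono he2 hm
      rw [coloredInv_concat cs ha hr] at hm1 hm2
      rcases hm1 with hm1 | hm1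
      · rcases hm2 with hm2 | hm2
        · exact absurd ⟨hm1, hm2⟩ hn
        · rw [hb2']; exact hm2
      · rw [hb1']; exact hm1
    refine coloredInv_mono (hg.2 (hlb.2 ⟨he1, he2⟩)) ?_
    rw [h1]
    exact Or.inr hz.symm

end Meet

/-! ### Reduced sorting words -/

section Base

open ArtinMonoid

variable {B : Type*} [Fintype B] {M : CoxeterMatrix B} {a : Matrix B B ℝ} {W : Type*} [Group W]
  (cs : CoxeterSystem M W) (ha : IsGeneralizedCartanMatrix M a) (hr : IsReducedRoots a)
  {F : LinearMap.BilinForm ℝ (B → ℝ)} (hF : IsInvariantForm a F)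

include ha hF in
-- Otherwise F(γ, γ) = ∑ γ_t F(α_t, γ) ≤ 0, against positive definiteness.
theorem exists_mulVec_pos {γ : B → ℝ} (h0 : 0 ≤ γ) (hne : γ ≠ 0) :
    ∃ r, 0 < (a *ᵥ γ) r := by
  by_contra! hcon
  have h1 := hF.pos γ hne
  have h2 : F γ γ = ∑ t, γ t * F (simpleRoot t) γ := by
    conv_lhs => enter [2]; rw [eq_sum_smul_simpleRoot γ]
    rw [map_sum]
    refine Finset.sum_congr rfl fun t _ => ?_
    rw [map_smul, smul_eq_mul, hF.symm]
  have h3 : F γ γ ≤ 0 := by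
    rw [h2]
    refine Finset.sum_nonpos fun t _ => mul_nonpos_of_nonneg_of_nonpos (h0 t) ?_
    have h4 := hF.two_mul_simpleRoot ha t γ
    have := mul_nonpos_of_nonneg_of_nonpos (hF.simpleRoot_pos t).le (hcon t)
    linarith
  linarith

include cs ha hr

/-- If the last inversion of a reduced word is a positive combination of two positive roots, then
exactly one of these is an inversion of the word without its last letter. -/
theorem mem_coloredInvSeq_iff_not_of_eq_add {P : List B} {x : B} {γ σ τ : B → ℝ} {p q : ℝ}
    (hP : cs.IsReduced P) (hγ : cs.geomRep ha (cs.wordProd P) (simpleRoot x) = γ)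
    (hσ : IsPosRoot a σ) (hτ : IsPosRoot a τ) (hne : σ ≠ τ) (hp : 0 < p) (hq : 0 < q)
    (e : γ = p • σ + q • τ) :
    (σ, 0) ∈ coloredInvSeq a P ↔ (τ, 0) ∉ coloredInvSeq a P := by
  rw [mem_coloredInvSeq_of_isReduced cs ha hr hP, mem_coloredInvSeq_of_isReduced cs ha hr hP]
  simp only [true_and, hσ, hτ]
  set π := cs.geomRep ha (cs.wordProd P)⁻¹ with hπ
  have h1 : simpleRoot x = p • π σ + q • π τ := by
    rw [← map_smul, ← map_smul, ← map_add, ← e, ← hγ, hπ, cs.geomRep_inv_apply]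
  have hrσ := geomRep_mem_roots cs ha hσ.1 (cs.wordProd P)⁻¹
  have hrτ := geomRep_mem_roots cs ha hτ.1 (cs.wordProd P)⁻¹
  have hc : ∀ t, simpleRoot x t = p * π σ t + q * π τ t := fun t => congrFun h1 t
  constructor
  · intro hs ht
    have h2 := hc x
    rw [simpleRoot_self] at h2
    have := mul_nonpos_of_nonneg_of_nonpos hp.le (hs x)
    have := mul_nonpos_of_nonneg_of_nonpos hq.le (ht x)
    linarith
  -- If neither root became negative under P⁻¹, all their coordinates except that at x would vanish;
  -- both images would be α_x, so σ = τ.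
  · intro ht
    refine (nonneg_or_nonpos_of_mem_roots cs ha hrσ).resolve_left fun hs => hne ?_
    have ht' := (nonneg_or_nonpos_of_mem_roots cs ha hrτ).resolve_right ht
    have hz : ∀ t, t ≠ x → π σ t = 0 ∧ π τ t = 0 := by
      intro t htx
      have h2 := hc t
      rw [simpleRoot_of_ne htx] at h2
      have h3 := mul_nonneg hp.le (hs t)
      have h4 := mul_nonneg hq.le (ht' t)
      constructor
      · have : p * π σ t = 0 := by linarith
        exact (mul_eq_zero.1 this).resolve_left hp.ne'
      · have : q * π τ t = 0 := by linarith
        exact (mul_eq_zero.1 this).resolve_left hq.ne'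
    have e1 := eq_simpleRoot_of_forall_ne hr ⟨hrσ, hs⟩ fun t h => (hz t h).1
    have e2 := eq_simpleRoot_of_forall_ne hr ⟨hrτ, ht'⟩ fun t h => (hz t h).2
    exact cs.geomRep_injective ha _ (e1.trans e2.symm)

/-- Alignment compares Hρ with β = p·Hρ + q·Hσ; the term in Hρ drops out by skew-symmetry, leaving
q·ω(Hρ, Hσ) < 0. -/
theorem IsAlignedAt.omega_neg {c V H P : List B} {x : B} (hV : IsAlignedAt a F c V x)
    (e : ofWord M V = ofWord M (H ++ P)) {β γ ρ σ : B → ℝ} {p q : ℝ}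
    (hβ : coloredAct a V (simpleRoot x, 0) = (β, 0))
    (hβγ : β = cs.geomRep ha (cs.wordProd H) γ)
    (hρH : coloredAct a H (ρ, 0) = (cs.geomRep ha (cs.wordProd H) ρ, 0))
    (hσH : coloredAct a H (σ, 0) = (cs.geomRep ha (cs.wordProd H) σ, 0))
    (hρ : (ρ, 0) ∈ coloredInvSeq a P) (hσ : (σ, 0) ∉ coloredInvSeq a P) (hσ' : IsPosRoot a σ)
    (hσn : coloredAct a H (σ, 0) ∉ coloredInvSeq a H)
    (hp : 0 < p) (hq : 0 < q) (eγ : γ = p • ρ + q • σ) :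
    omega F c (cs.geomRep ha (cs.wordProd H) ρ) (cs.geomRep ha (cs.wordProd H) σ) < 0 := by
  have hmem := mem_coloredInvSeq_iff_of_ofWord_eq cs ha hr e
  have hρV : (cs.geomRep ha (cs.wordProd H) ρ, 0) ∈ coloredInvSeq a V := by
    rw [← hρH, hmem, mem_coloredInvSeq_append]
    exact Or.inr ⟨_, hρ, rfl⟩
  have hσV : (cs.geomRep ha (cs.wordProd H) σ, 0) ∉ coloredInvSeq a V := by
    rw [← hσH, hmem, mem_coloredInvSeq_append]
    rintro (h | ⟨b, hb, hb'⟩)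
    · exact hσn h
    · have := coloredAct_injOn cs ha hr (isPosRoot_of_mem_coloredInvSeq cs ha hr hb)
        (b' := (σ, 0)) hσ' hb'
      exact hσ (this ▸ hb)
  have hσp := IsPosRoot.coloredAct cs ha hr (b := (σ, 0)) hσ' H
  rw [hσH] at hσp
  rw [eγ, map_add, map_smul, map_smul] at hβγ
  have h := (hV β hβ).1 _ _ p q hρV hσp hσV hp hq hβγ
  rw [hβγ, omega_lin, omega_self, mul_zero, zero_add] at h
  exact (pos_iff_neg_of_mul_neg h).1 hq

include hF

/-- The base is the meet of the two prefixes. It works once the common last root γ of the quotients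
is simple; a decomposition γ = (aγ)_r α_r + s_r γ with (aγ)_r > 0 would be ordered by ω in opposite
ways by the two words. -/
theorem IsAligned.haveCommonBase [Finite W] {c V₁ V₂ : List B} {x y : B}
    (h₁ : IsAligned a F c (V₁ ++ [x])) (h₂ : IsAligned a F c (V₂ ++ [y]))
    (h0₁ : ∀ b ∈ coloredInvSeq a (V₁ ++ [x]), b.2 = 0)
    (h0₂ : ∀ b ∈ coloredInvSeq a (V₂ ++ [y]), b.2 = 0)
    (he : coloredAct a V₁ (simpleRoot x, 0) = coloredAct a V₂ (simpleRoot y, 0))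
    (hI : ∀ g, IsGLB {ofWord M V₁, ofWord M V₂} g →
      coloredInv a g = coloredInv a (ofWord M V₁) ∩ coloredInv a (ofWord M V₂)) :
    HaveCommonBase (ofWord M V₁) (ofWord M V₂) x y := by
  obtain ⟨g, hg⟩ := cs.exists_isGLB ha (ofWord M V₁) (ofWord M V₂)
  specialize hI g hg
  obtain ⟨hg₁, hg₂⟩ : g ≤ ofWord M V₁ ∧ g ≤ ofWord M V₂ := by simpa [lowerBounds] using hg.1
  obtain ⟨p₁, e₁⟩ := le_iff.1 hg₁
  obtain ⟨p₂, e₂⟩ := le_iff.1 hg₂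
  obtain ⟨H, rfl⟩ := ofWord_surjective g
  obtain ⟨P₁, rfl⟩ := ofWord_surjective p₁
  obtain ⟨P₂, rfl⟩ := ofWord_surjective p₂
  rw [← ofWord_append, eq_comm] at e₁ e₂
  have hmem₁ := mem_coloredInvSeq_iff_of_ofWord_eq cs ha hr e₁
  have hmem₂ := mem_coloredInvSeq_iff_of_ofWord_eq cs ha hr e₂
  simp only [coloredInv_ofWord cs ha hr] at hI
  -- A common inversion of both quotients would give an element of the intersection, hence of
  -- inv(H), created a second time after H.
  have hdisj : ∀ b, b ∈ coloredInvSeq a P₁ → b ∉ coloredInvSeq a P₂ := by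
    intro b hb₁ hb₂
    refine notMem_coloredInvSeq_of_append cs ha hr (Q := H) hb₁ ?_
    have : coloredAct a H b ∈ {b | b ∈ coloredInvSeq a H} := by
      rw [hI]
      exact ⟨(hmem₁ _).2 (mem_coloredInvSeq_append.2 (Or.inr ⟨b, hb₁, rfl⟩)),
        (hmem₂ _).2 (mem_coloredInvSeq_append.2 (Or.inr ⟨b, hb₂, rfl⟩))⟩
    exact this
  have hred : ∀ {V P : List B} {x : B}, ofWord M V = ofWord M (H ++ P) →
      (∀ b ∈ coloredInvSeq a (V ++ [x]), b.2 = 0) → cs.IsReduced (P ++ [x]) := by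
    intro V P x e h0
    have h := isReduced_of_color_eq_zero cs ha hr h0
    have e' : ofWord M (V ++ [x]) = ofWord M (H ++ (P ++ [x])) := by
      rw [ofWord_concat, e, ← List.append_assoc, ofWord_concat]
    exact (cs.isReduced_append.1 (cs.isReduced_of_ofWord_eq e' h)).2.1
  have hred₁ := hred e₁ h0₁
  have hred₂ := hred e₂ h0₂
  have hlin : ∀ {Q : List B} {b : (B → ℝ) × ℕ}, (coloredAct a Q b).2 = 0 →
      coloredAct a Q b = (cs.geomRep ha (cs.wordProd Q) b.1, 0) := by
    intro Q b hb
    have := color_le_coloredAct (a := a) Q b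
    rw [cs.geomRep_wordProd]
    exact Prod.ext (coloredAct_fst_of_color_eq (by omega)) hb
  have hx : (coloredAct a V₁ (simpleRoot x, 0)).2 = 0 :=
    h0₁ _ (mem_coloredInvSeq_concat.2 (Or.inr rfl))
  have hVx := hlin hx
  have hVy := hVx
  rw [he] at hVy
  rw [coloredAct_eq_of_ofWord_eq cs ha hr e₁ (isPosRoot_simpleRoot x),
    coloredAct_eq_of_ofWord_eq cs ha hr e₂ (isPosRoot_simpleRoot y), coloredAct_append,
    coloredAct_append] at he
  have he' := coloredAct_injOn cs ha hr
    (IsPosRoot.coloredAct cs ha hr (b := (simpleRoot x, 0)) (isPosRoot_simpleRoot x) P₁)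
    (IsPosRoot.coloredAct cs ha hr (b := (simpleRoot y, 0)) (isPosRoot_simpleRoot y) P₂) he
  rw [coloredAct_eq_of_ofWord_eq cs ha hr e₁ (isPosRoot_simpleRoot x), coloredAct_append] at hx
  have hPx : (coloredAct a P₁ (simpleRoot x, 0)).2 = 0 := by
    have := color_le_coloredAct (a := a) H (coloredAct a P₁ (simpleRoot x, 0))
    omega
  have hγ₁ := hlin hPx
  have hγ₂ := hlin (he' ▸ hPx)
  have hpos := IsPosRoot.coloredAct cs ha hr (b := (simpleRoot x, 0)) (isPosRoot_simpleRoot x) P₁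
  rw [← he', hγ₁, Prod.mk.injEq] at hγ₂
  rw [hγ₁] at hpos hx
  have hβγ := hlin hx
  rw [← hγ₁, ← coloredAct_append, ← coloredAct_eq_of_ofWord_eq cs ha hr e₁
    (b := (simpleRoot x, 0)) (isPosRoot_simpleRoot x), hVx, Prod.mk.injEq] at hβγ
  replace hβγ := hβγ.1
  rw [hγ₁] at hβγ
  obtain ⟨hγ₂, -⟩ := hγ₂
  simp only at hβγ hγ₂ hpos hVx hVy
  set γ := cs.geomRep ha (cs.wordProd P₁) (simpleRoot x) with hγ
  by_cases hsimple : ∃ e, γ = simpleRoot e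
  · obtain ⟨e, h⟩ := hsimple
    refine ⟨ofWord M H, ofWord M P₁, ofWord M P₂, e, by rw [e₁, ofWord_append],
      by rw [e₂, ofWord_append], ?_, ?_⟩
    · exact ofWord_mul_gen_eq cs ha hF hred₁ h
    · exact ofWord_mul_gen_eq cs ha hF hred₂ (hγ₂.symm.trans h)
  exfalso
  obtain ⟨r, hr0⟩ := exists_mulVec_pos ha hF hpos.2 (ne_zero_of_mem_roots cs ha hpos.1)
  have hne : γ ≠ simpleRoot r := fun h => hsimple ⟨r, h⟩
  have hs := hpos.simpleRefl cs ha hr hne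
  have eγ : γ = (a *ᵥ γ) r • simpleRoot r + (1 : ℝ) • simpleRefl a r γ := by
    rw [simpleRefl]; module
  have key : ∀ (ρ σ : B → ℝ) (p q : ℝ), IsPosRoot a ρ → IsPosRoot a σ → ρ ≠ σ → 0 < p → 0 < q →
      γ = p • ρ + q • σ → (ρ, 0) ∈ coloredInvSeq a P₁ → (σ, 0) ∈ coloredInvSeq a P₂ → False := by
    intro ρ σ p q hρ hσ _ hp hq e hρ₁ hσ₂
    have hH : ∀ {V P : List B} {x : B} {b}, ofWord M V = ofWord M (H ++ P) →
        (∀ b ∈ coloredInvSeq a (V ++ [x]), b.2 = 0) → b ∈ coloredInvSeq a P →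
        coloredAct a H b = (cs.geomRep ha (cs.wordProd H) b.1, 0) := by
      intro V P x b e h0 hb
      refine hlin (h0 _ (mem_coloredInvSeq_concat.2 (Or.inl ?_)))
      rw [mem_coloredInvSeq_iff_of_ofWord_eq cs ha hr e, mem_coloredInvSeq_append]
      exact Or.inr ⟨b, hb, rfl⟩
    have hρH := hH e₁ h0₁ hρ₁
    have hσH := hH e₂ h0₂ hσ₂
    have a₁ := (isAligned_concat.1 h₁).2.omega_neg cs ha hr e₁ hVx hβγ hρH hσH hρ₁
      (fun h => hdisj _ h hσ₂) hσ (notMem_coloredInvSeq_of_append cs ha hr hσ₂) hp hq e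
    have a₂ := (isAligned_concat.1 h₂).2.omega_neg cs ha hr e₂ hVy hβγ hσH hρH hσ₂
      (hdisj _ hρ₁) hρ (notMem_coloredInvSeq_of_append cs ha hr hρ₁) hq hp (e.trans (add_comm _ _))
    rw [omega_antisymm] at a₂
    linarith
  have hne' : simpleRoot r ≠ simpleRefl a r γ := (hpos.simpleRefl_ne ha r).symm
  have hrr := isPosRoot_simpleRoot (a := a) r
  have b₁ := mem_coloredInvSeq_iff_not_of_eq_add cs ha hr (P := P₁) (x := x)
    (cs.isReduced_append.1 hred₁).1 rfl hrr hs hne' hr0 one_pos eγ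
  have b₂ := mem_coloredInvSeq_iff_not_of_eq_add cs ha hr (P := P₂) (x := y)
    (cs.isReduced_append.1 hred₂).1 hγ₂.symm hrr hs hne' hr0 one_pos eγ
  by_cases h : (simpleRoot r, 0) ∈ coloredInvSeq a P₁
  · have h' : (simpleRefl a r γ, 0) ∈ coloredInvSeq a P₂ := by
      by_contra hcon
      exact hdisj _ h (b₂.2 hcon)
    exact key _ _ _ _ hrr hs hne' hr0 one_pos eγ h h'
  · have h₁' : (simpleRefl a r γ, 0) ∈ coloredInvSeq a P₁ := by
      by_contra hcon
      exact h (b₁.2 hcon)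
    exact key _ _ _ _ hs hrr hne'.symm one_pos hr0 (eγ.trans (add_comm _ _)) h₁'
      (b₂.2 (hdisj _ h₁'))

/-- The inversion set of the meet of two reduced aligned words. -/
theorem IsAligned.coloredInv_eq_inter [Finite W] {c Q₁ Q₂ : List B}
    (h₁ : IsAligned a F c Q₁) (h₂ : IsAligned a F c Q₂)
    (h0₁ : ∀ b ∈ coloredInvSeq a Q₁, b.2 = 0) (h0₂ : ∀ b ∈ coloredInvSeq a Q₂, b.2 = 0)
    {g : ArtinMonoid M} (hg : IsGLB {ofWord M Q₁, ofWord M Q₂} g) :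
    coloredInv a g = coloredInv a (ofWord M Q₁) ∩ coloredInv a (ofWord M Q₂) := by
  refine coloredInv_eq_inter_of_haveCommonBase cs ha hr ?_ hg
  rintro V₁ x₁ R₁ V₂ x₂ R₂ rfl rfl he hI
  rw [← List.singleton_append, ← List.append_assoc] at h₁ h₂ h0₁ h0₂
  exact h₁.left.haveCommonBase cs ha hr hF h₂.left
    (fun b hb => h0₁ b (mem_coloredInvSeq_append.2 (Or.inl hb)))
    (fun b hb => h0₂ b (mem_coloredInvSeq_append.2 (Or.inl hb))) he hI

/-- First conjugate back to letters creating β⁽⁰⁾, then commute away the letters of positive color.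
The remaining reduced aligned words have a common base, using their own intersection formula, and
the three conjugations compose. -/
theorem IsSortingSeq.haveCommonBase [Finite W] {c V₁ V₂ : List B} {x y : B} (hc : c.Nodup)
    (h₁ : IsSortingSeq c (V₁ ++ [x])) (h₂ : IsSortingSeq c (V₂ ++ [y]))
    (he : coloredAct a V₁ (simpleRoot x, 0) = coloredAct a V₂ (simpleRoot y, 0)) :
    HaveCommonBase (ofWord M V₁) (ofWord M V₂) x y := by
  rcases hβ : coloredAct a V₁ (simpleRoot x, 0) with ⟨β, k⟩
  obtain ⟨S₁, x', P₁, i₁, c₁, e₁, f₁⟩ := h₁.exists_chain cs ha hF hr hc hβ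
  obtain ⟨S₂, y', P₂, i₂, c₂, e₂, f₂⟩ := h₂.exists_chain cs ha hF hr hc (he.symm.trans hβ)
  obtain ⟨Z₁, U₁, j₁, k₁, l₁, m₁, n₁⟩ :=
    (i₁.isAligned cs ha hF hr hc).exists_split_concat cs ha hF hr c₁
  obtain ⟨Z₂, U₂, j₂, k₂, l₂, m₂, n₂⟩ :=
    (i₂.isAligned cs ha hF hr hc).exists_split_concat cs ha hF hr c₂
  obtain ⟨h, p, q, e, q₁, q₂, r₁, r₂⟩ := m₁.haveCommonBase cs ha hr hF m₂ n₁ n₂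
    (l₁.trans l₂.symm) fun g hg => m₁.left.coloredInv_eq_inter cs ha hr hF m₂.left
      (fun b hb => n₁ b (mem_coloredInvSeq_append.2 (Or.inl hb)))
      (fun b hb => n₂ b (mem_coloredInvSeq_append.2 (Or.inl hb))) hg
  have aux : ∀ {p u P : ArtinMonoid M} {x x' : B}, P * gen M x = gen M x' * P →
      u * gen M x' = gen M x' * u → p * gen M x' = gen M e * p →
      p * (u * P) * gen M x = gen M e * (p * (u * P)) := by
    intro p u P x x' t₁ t₂ t₃
    rw [mul_assoc, mul_assoc, t₁, ← mul_assoc u, t₂, mul_assoc, ← mul_assoc p, t₃, mul_assoc]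
  refine ⟨h, p * (ofWord M U₁ * P₁), q * (ofWord M U₂ * P₂), e, ?_, ?_, aux f₁ k₁ r₁, aux f₂ k₂ r₂⟩
  · rw [e₁, j₁, q₁]; simp only [mul_assoc]
  · rw [e₂, j₂, q₂]; simp only [mul_assoc]

theorem IsSortingSeq.coloredInv_eq_inter [Finite W] {c Q₁ Q₂ : List B} (hc : c.Nodup)
    (h₁ : IsSortingSeq c Q₁) (h₂ : IsSortingSeq c Q₂)
    {g : ArtinMonoid M} (hg : IsGLB {ofWord M Q₁, ofWord M Q₂} g) :
    coloredInv a g = coloredInv a (ofWord M Q₁) ∩ coloredInv a (ofWord M Q₂) := by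
  refine coloredInv_eq_inter_of_haveCommonBase cs ha hr ?_ hg
  rintro V₁ x₁ R₁ V₂ x₂ R₂ rfl rfl he -
  rw [← List.singleton_append, ← List.append_assoc] at h₁ h₂
  exact IsSortingSeq.haveCommonBase cs ha hr hF hc h₁.left h₂.left he

end Base

/-! ### Sortable elements have sorting sequences -/

section Sortable

variable {B : Type*}

/-- The cyclic word at time N is the window of the next n positions, restricted to those active: in
the first copy, or used one round before. Using position N keeps position N + n active; leaving it
unused removes N + n. -/
theorem isSortingSeq_filter (L : ℕ → B) {n : ℕ} (hn : 0 < n) (hL : ∀ j, L (j + n) = L j)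
    (T : ℕ → Prop) [DecidablePred T] (hT : ∀ j, T (j + n) → T j) (m N : ℕ) :
    IsSortingSeq (((List.range' N n).filter fun j => decide (j < n ∨ T (j - n))).map L)
      (((List.range' N m).filter fun j => decide (T j)).map L) := by
  induction m generalizing N with
  | zero => exact IsSortingSeq.empty _
  | succ m ih =>
    obtain ⟨n, rfl⟩ := Nat.exists_eq_succ_of_ne_zero hn.ne'
    have ih' := ih (N + 1)
    have hlast : N + 1 + 1 * n = N + (n + 1) := by ring
    rw [List.range'_concat, hlast, List.filter_append, List.map_append] at ih'
    rw [List.range'_succ, List.range'_succ]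
    have h1 : ¬ N + (n + 1) < n + 1 := by omega
    have h2 : N + (n + 1) - (n + 1) = N := by omega
    by_cases hTN : T N
    · have hact : N < n + 1 ∨ T (N - (n + 1)) := by
        by_cases h : N < n + 1
        · exact Or.inl h
        · refine Or.inr (hT _ ?_)
          rwa [Nat.succ_eq_add_one, Nat.sub_add_cancel (by omega)]
      rw [List.filter_cons_of_pos (by simpa using hact), List.filter_cons_of_pos (by simpa using hTN),
        List.map_cons, List.map_cons]
      refine IsSortingSeq.use ?_
      rw [List.filter_cons_of_pos (by simpa [h2] using Or.inr hTN)] at ih'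
      simpa [hL] using ih'
    · rw [List.filter_cons_of_neg (by simp [h2, hTN]; omega), List.filter_nil, List.map_nil,
        List.append_nil] at ih'
      by_cases hact : N < n + 1 ∨ T (N - (n + 1))
      · rw [List.filter_cons_of_pos (by simpa using hact), List.map_cons,
          List.filter_cons_of_neg (by simpa using hTN)]
        exact IsSortingSeq.skip ih'
      · rw [List.filter_cons_of_neg (by simpa using hact),
          List.filter_cons_of_neg (by simpa using hTN)]
        exact ih'

/-- Position (k, i) becomes the number kn + i. Nested sets of positions mean that T(j + n) implies
T(j), and at time 0 every letter is active. -/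
theorem IsSortable.exists_isSortingSeq {n : ℕ} {M : CoxeterMatrix B} {c : Fin n ≃ B}
    {w : ArtinMonoid M} (h : IsSortable c w) :
    ∃ Q, ArtinMonoid.ofWord M Q = w ∧ IsSortingSeq (List.ofFn c) Q := by
  classical
  obtain ⟨P, ⟨⟨hP, rfl⟩, -⟩, hI⟩ := h
  refine ⟨_, rfl, ?_⟩
  rcases Nat.eq_zero_or_pos n with rfl | hn
  · rcases P with _ | ⟨p, P⟩
    · exact IsSortingSeq.empty _
    · exact (ofLex p).2.elim0
  let pos : ℕ ×ₗ Fin n → ℕ := fun p => (ofLex p).1 * n + (ofLex p).2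
  let L : ℕ → B := fun j => c ⟨j % n, Nat.mod_lt j hn⟩
  have hLpos : ∀ p, L (pos p) = c (ofLex p).2 := by
    intro p
    simp only [L, pos]
    congr 1
    ext
    simp [Nat.mod_eq_of_lt]
  have hlt : ∀ p q, p < q → pos p < pos q := by
    intro p q hpq
    rw [Prod.Lex.lt_iff] at hpq
    have h1 := (ofLex p).2.isLt
    rcases hpq with hpq | ⟨e, hpq⟩
    · have := Nat.mul_le_mul_right n (Nat.succ_le_of_lt hpq)
      rw [Nat.succ_mul] at this
      simp only [pos]
      omega
    · simp only [pos, e]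
      exact Nat.add_lt_add_left hpq _
  let T : ℕ → Prop := fun j => j ∈ P.map pos
  have hT : ∀ j, T (j + n) → T j := by
    intro j hj
    obtain ⟨p, hp, e⟩ := List.mem_map.1 hj
    obtain ⟨⟨k, i⟩, rfl⟩ := toLex.surjective p
    simp only [pos, ofLex_toLex] at e
    rcases k with _ | k
    · have := i.isLt
      omega
    · refine List.mem_map.2 ⟨toLex (k, i), hI k hp, ?_⟩
      simp only [pos, ofLex_toLex]
      rw [Nat.succ_mul] at e
      omega
  obtain ⟨K, hK⟩ : ∃ K, ∀ j ∈ P.map pos, j < K :=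
    ⟨(P.map pos).sum + 1, fun j hj => Nat.lt_succ_of_le (List.single_le_sum (by simp) j hj)⟩
  have e1 : P.map pos = (List.range' 0 K).filter fun j => decide (T j) := by
    refine List.Pairwise.eq_of_mem_iff (r := (· < ·)) ?_ ?_ ?_
    · exact List.pairwise_map.2 (hP.imp fun h => hlt _ _ h)
    · exact List.Pairwise.filter _ List.pairwise_lt_range'
    · intro j
      simp only [List.mem_filter, List.mem_range'_1, decide_eq_true_eq, T]
      exact ⟨fun h => ⟨⟨Nat.zero_le _, by simpa using hK j h⟩, h⟩, fun h => h.2⟩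
  have h1 := isSortingSeq_filter L hn (fun j => by simp [L]) T hT K 0
  rw [← e1, List.map_map] at h1
  have e2 : (List.range' 0 n).filter (fun j => decide (j < n ∨ T (j - n))) = List.range' 0 n := by
    rw [List.filter_eq_self]
    intro j hj
    rw [List.mem_range'_1] at hj
    simp only [decide_eq_true_eq]
    left
    omega
  have e3 : (List.range' 0 n).map L = List.ofFn c := by
    refine List.ext_getElem (by simp) fun i h₁ h₂ => ?_
    simp only [List.length_map, List.length_range'] at h₁
    simp [L, Nat.mod_eq_of_lt h₁]
  rw [e2, e3] at h1
  convert h1 using 2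
  funext p
  exact (hLpos p).symm

end Sortable

end

/-! ### The weak order and meets on sortable elements -/

theorem mainTheorem11 {B W : Type*} [Fintype B] [Group W] [Finite W] {M : CoxeterMatrix B}
    (cs : CoxeterSystem M W) (a : Matrix B B ℝ) (ha : IsGeneralizedCartanMatrix M a)
    (ha_red : IsReducedRoots a) (m : ℕ) {n : ℕ} (c : Fin n ≃ B)
    (w u : cs.mWeak m) (hw : w ∈ mSort cs m c) (hu : u ∈ mSort cs m c) :
    (w ≤ u ↔ coloredInv a (w : ArtinMonoid M) ⊆ coloredInv a (u : ArtinMonoid M)) ∧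
      ∃ v : cs.mWeak m, IsGLB {w, u} v ∧
        coloredInv a (v : ArtinMonoid M) =
          coloredInv a (w : ArtinMonoid M) ∩ coloredInv a (u : ArtinMonoid M) := by
  obtain ⟨F, hF⟩ := cs.exists_isInvariantForm ha
  obtain ⟨⟨w, hw'⟩, ⟨u, hu'⟩⟩ := w, u
  obtain ⟨Q₁, rfl, h₁⟩ := IsSortable.exists_isSortingSeq hw
  obtain ⟨Q₂, rfl, h₂⟩ := IsSortable.exists_isSortingSeq hu
  obtain ⟨g, hg⟩ := cs.exists_isGLB ha (ArtinMonoid.ofWord M Q₁) (ArtinMonoid.ofWord M Q₂)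
  have hinv := h₁.coloredInv_eq_inter cs ha ha_red hF (List.nodup_ofFn.2 c.injective) h₂ hg
  obtain ⟨hg₁, hg₂⟩ : g ≤ ArtinMonoid.ofWord M Q₁ ∧ g ≤ ArtinMonoid.ofWord M Q₂ := by
    simpa [lowerBounds] using hg.1
  refine ⟨⟨fun h => coloredInv_mono h, fun h => ?_⟩,
    -- The meet in B⁺ lies below w, hence in [1, w₀ᵐ], and is also the meet there.
    ⟨g, ArtinMonoid.one_le g, hg₁.trans hw'.2⟩, ⟨?_, fun z hz => ?_⟩, hinv⟩
  · simp only at h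
    -- Now inv(w ∧ u) = inv(w); as cardinality is length, the cofactor z of w ∧ u in w is 1 and w =
    -- w ∧ u ≤ u.
    rw [Set.inter_eq_left.2 h] at hinv
    obtain ⟨z, hz⟩ := ArtinMonoid.le_iff.1 hg₁
    have hl := congrArg ArtinMonoid.length hz
    rw [ArtinMonoid.length_mul, ← ncard_coloredInv cs ha ha_red g,
      ← ncard_coloredInv cs ha ha_red (ArtinMonoid.ofWord M Q₁), hinv] at hl
    rw [ArtinMonoid.eq_one_of_length_eq_zero (u := z) (by omega), mul_one] at hz
    rw [hz] at hg₂
    exact hg₂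
  · rintro z (rfl | rfl)
    · exact hg₁
    · exact hg₂
  · refine hg.2 ?_
    rintro z' (rfl | rfl)
    · exact hz (Or.inl rfl)
    · exact hz (Or.inr rfl)
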